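/- Let $\mathbb T=\mathbb R/2\pi\mathbb Z$, let $n,r\in\mathbb N_0$ with $n\ge 2$, and let $\nu>0$. $C^\infty(\mathbb T^n)^n$ is the space of smooth real vector fields on $\mathbb T^n$ with the topology of uniform convergence of all derivatives, and $C^r([0,\infty),C^\infty(\mathbb T^n)^n)$ is the set of $C^r$ curves in this space (one-sided derivatives at $t=0$). For $f:\mathbb T^n\to\mathbb R^n$ with Fourier coefficients $f_k=(2\pi)^{-n}\int_{\mathbb T^n}f(x)e^{-ik\cdot x}\,dx\in\mathbb C^n$ put $$\|f\|_{\mathsf A,d}:=\sum_{k\in\mathbb Z^n\setminus\{0\}}|k|^d\,|f_k|\quad(d\in\mathbb N_0),\qquad \mathbb P f(x):=\sum_{k\in\mathbb Z^n}(\mathbb P_kf_k)\,e^{ik\cdot x},$$ where $|\cdot|$ is the $l^2$-norm, $\mathbb P_0=\mathrm{id}$, and, for $k\ne0$, $\mathbb P_k=\mathrm{id}-|k|^{-2}kk^{T}$ is the orthogonal projection onto $k^\perp$ (Leray projector). Let $v\in C^r([0,\infty),C^\infty(\mathbb T^n)^n)$ with $\operatorname{div}v(\cdot,t)=0$ for all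 $t\ge0$, and let $u_0\in C^\infty(\mathbb T^n)^n$ with $\operatorname{div}u_0=0$. Then the initial value problem $$\partial_tu(x,t)=\nu\Delta u(x,t)+\mathbb P[v\cdot\nabla u](x,t)\quad(x\in\mathbb T^n,\ t\ge0),\qquad u(x,0)=u_0(x),$$ has a solution $u\in C^{r+1}([0,\infty),C^\infty(\mathbb T^n)^n)$, and it is the only solution in $C^{1}([0,\infty),C^\infty(\mathbb T^n)^n)$, in particular the only one in $C^{r+1}([0,\infty),C^\infty(\mathbb T^n)^n)$. Moreover: 1. $\int_{\mathbb T^n}u(x,t)\,dx=\int_{\mathbb T^n}u_0(x)\,dx$ for all $t\ge0$. 2. For every $d\in\mathbb N_0$, $\|u(\cdot,t)\|_{\mathsf A,d}$ is finite for all $t\geq 0$ and bounded on every interval $[0,t]$. For all $t\ge0$, $$\|u(\cdot,t)\|_{\mathsf A,0}\le\|u_0\|_{\mathsf A,0}\exp\Big(\tfrac1{4\nu}\int_0^t\|v(\cdot,s)\|_{\mathsf A,0}^2\,ds\Big),$$ $$\|u(\cdot,t)\|_{\mathsf A,1}\le\|u_0\|_{\mathsf A,1}\exp\Big(\int_0^t\|v(\cdot,s)\|_{\mathsf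 A,1}\,ds+\tfrac1{4\nu}\int_0^t\|v(\cdot,s)\|_{\mathsf A,0}^2\,ds\Big),$$ and for all $d\ge2$ $$\|u(\cdot,t)\|_{\mathsf A,d}\le\exp\Big(\tfrac1{4\nu}\int_0^t\|v(\cdot,s)\|_{\mathsf A,0}^2\,ds+d\int_0^t\|v(\cdot,s)\|_{\mathsf A,1}\,ds\Big)\Big(\|u_0\|_{\mathsf A,d}+\sum_{j=2}^d\binom dj\int_0^t\|v(\cdot,s)\|_{\mathsf A,j}\,ds\cdot\sup_{s\in[0,t]}\|u(\cdot,s)\|_{\mathsf A,d+1-j}\Big).$$ 3. If $\tau\ge0$ and $\delta\ge0$ are such that $\|v(\cdot,t)\|_{\mathsf A,0}+\delta\le\nu$ for all $t\in[0,\tau]$, then for all $t\in[0,\tau]$ $$\|u(\cdot,t)\|_{\mathsf A,0}\le\|u_0\|_{\mathsf A,0}\,e^{-\delta t},\qquad \|u(\cdot,t)\|_{\mathsf A,1}\le\|u_0\|_{\mathsf A,1}\exp\Big(\int_0^t\|v(\cdot,s)\|_{\mathsf A,1}\,ds-\delta t\Big).$$ -/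

import Mathlib

open scoped Topology Laplacian ContDiff

namespace TorusFlow

noncomputable section

/-- Euclidean space `ℝⁿ` with the `l²`-norm. -/
abbrev E (n : ℕ) := EuclideanSpace ℝ (Fin n)

/-- A frequency `k ∈ ℤⁿ`, viewed as a vector of `ℝⁿ`; in particular `‖freq k‖ = |k|`. -/
def freq {n : ℕ} (k : Fin n → ℤ) : E n := WithLp.toLp 2 fun i => (k i : ℝ)

/-- `2π`-periodicity in each coordinate, i.e. being a function on `𝕋ⁿ = (ℝ / 2πℤ)ⁿ`. -/
def IsPeriodic {n : ℕ} {β : Type*} (f : E n → β) : Prop :=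
  ∀ (k : Fin n → ℤ) (x : E n), f (x + (2 * Real.pi) • freq k) = f x

/-- `C^∞(𝕋ⁿ)ⁿ`: the real vector space of smooth `2π`-periodic vector fields `ℝⁿ → ℝⁿ`. -/
def SmoothField (n : ℕ) : Submodule ℝ (E n → E n) where
  carrier := {f | ContDiff ℝ ∞ f ∧ IsPeriodic f}
  zero_mem' := ⟨contDiff_const, fun _ _ => rfl⟩
  add_mem' := fun {f g} hf hg =>
    ⟨hf.1.add hg.1, fun k x => by simp only [Pi.add_apply, hf.2 k x, hg.2 k x]⟩
  smul_mem' := fun c f hf =>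
    ⟨hf.1.const_smul c, fun k x => by simp only [Pi.smul_apply, hf.2 k x]⟩

instance {n : ℕ} : CoeFun (SmoothField n) (fun _ => E n → E n) := ⟨Subtype.val⟩

/-- The period cell `[0, 2π)ⁿ`; integrals over `𝕋ⁿ` are integrals over this cell. -/
def cell (n : ℕ) : Set (E n) := {x | ∀ i, x i ∈ Set.Ico 0 (2 * Real.pi)}

/-! ### The Fréchet topology of `C^∞(𝕋ⁿ)ⁿ` -/

theorem exists_period_shift {n : ℕ} (x : E n) :
    ∃ k : Fin n → ℤ, ‖x + (2 * Real.pi) • freq k‖ ≤ Real.sqrt (n * (2 * Real.pi) ^ 2) := by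
  have hp : (0 : ℝ) < 2 * Real.pi := by positivity
  refine ⟨fun i => -⌊x i / (2 * Real.pi)⌋, ?_⟩
  rw [EuclideanSpace.norm_eq]
  apply Real.sqrt_le_sqrt
  have hb : ∀ i : Fin n,
      ‖(x + (2 * Real.pi) • freq fun i => -⌊x i / (2 * Real.pi)⌋) i‖ ^ 2
        ≤ (2 * Real.pi) ^ 2 := by
    intro i
    have h1 := Int.floor_le (x i / (2 * Real.pi))
    have h2 := Int.lt_floor_add_one (x i / (2 * Real.pi))
    rw [le_div_iff₀ hp] at h1
    rw [div_lt_iff₀ hp] at h2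
    rw [Real.norm_eq_abs, sq_abs]
    simp only [freq, PiLp.add_apply, PiLp.smul_apply, smul_eq_mul, Int.cast_neg]
    apply pow_le_pow_left₀ <;> nlinarith
  calc _ ≤ ∑ _i : Fin n, (2 * Real.pi) ^ 2 := Finset.sum_le_sum fun i _ => hb i
    _ = _ := by simp

theorem bddAbove_iteratedFDeriv {n : ℕ} (m : ℕ) (f : SmoothField n) :
    BddAbove (Set.range fun x => ‖iteratedFDeriv ℝ m f x‖) := by
  have hc : Continuous fun x => ‖iteratedFDeriv ℝ m f x‖ :=
    (f.2.1.continuous_iteratedFDeriv (by exact_mod_cast le_top)).norm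
  obtain ⟨C, hC⟩ := (isCompact_closedBall (0 : E n)
    (Real.sqrt (n * (2 * Real.pi) ^ 2))).bddAbove_image hc.continuousOn
  refine ⟨C, ?_⟩
  rintro _ ⟨x, rfl⟩
  obtain ⟨k, hk⟩ := exists_period_shift x
  have hper : iteratedFDeriv ℝ m f (x + (2 * Real.pi) • freq k) = iteratedFDeriv ℝ m f x := by
    rw [← iteratedFDeriv_comp_add_right m ((2 * Real.pi) • freq k)]
    congr 1
    funext y
    exact f.2.2 k y
  have := hC ⟨x + (2 * Real.pi) • freq k, by simpa using hk, rfl⟩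
  simpa only [hper] using this

/-- The seminorm `sup_x |D^m f(x)|` on `C^∞(𝕋ⁿ)ⁿ`. -/
def derivSeminorm (n m : ℕ) : Seminorm ℝ (SmoothField n) :=
  Seminorm.ofSMulLE (fun f => ⨆ x, ‖iteratedFDeriv ℝ m f x‖)
    (by
      have h : ∀ x : E n, iteratedFDeriv ℝ m ((0 : SmoothField n) : E n → E n) x = 0 := by
        intro x
        have : ((0 : SmoothField n) : E n → E n) = fun _ => 0 := rfl
        rw [this, iteratedFDeriv_fun_zero]
        rfl
      simp only [h, norm_zero, ciSup_const])
    (by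
      intro f g
      refine ciSup_le fun x => ?_
      have h : iteratedFDeriv ℝ m ((f + g : SmoothField n) : E n → E n) x
          = iteratedFDeriv ℝ m f x + iteratedFDeriv ℝ m g x :=
        iteratedFDeriv_add_apply (f.2.1.contDiffAt.of_le (by exact_mod_cast le_top))
          (g.2.1.contDiffAt.of_le (by exact_mod_cast le_top))
      rw [h]
      exact (norm_add_le _ _).trans (add_le_add (le_ciSup (bddAbove_iteratedFDeriv m f) x)
        (le_ciSup (bddAbove_iteratedFDeriv m g) x)))
    (by
      intro c f
      refine ciSup_le fun x => ?_
      have h : iteratedFDeriv ℝ m ((c • f : SmoothField n) : E n → E n) x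
          = c • iteratedFDeriv ℝ m f x :=
        iteratedFDeriv_const_smul_apply (f.2.1.contDiffAt.of_le (by exact_mod_cast le_top))
      rw [h, norm_smul]
      exact mul_le_mul_of_nonneg_left (le_ciSup (bddAbove_iteratedFDeriv m f) x) (norm_nonneg c))

/-- The topology of uniform convergence of all derivatives on `C^∞(𝕋ⁿ)ⁿ`. -/
instance (n : ℕ) : TopologicalSpace (SmoothField n) :=
  SeminormFamily.moduleFilterBasis (𝕜 := ℝ) (derivSeminorm n) |>.topology

/-- The topology on `C^∞(𝕋ⁿ)ⁿ` is the one generated by the seminorms `sup_x |D^m f(x)|`. -/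
theorem withSeminorms (n : ℕ) : WithSeminorms (derivSeminorm n) := ⟨rfl⟩

instance (n : ℕ) : IsTopologicalAddGroup (SmoothField n) :=
  (withSeminorms n).topologicalAddGroup

instance (n : ℕ) : ContinuousSMul ℝ (SmoothField n) :=
  (withSeminorms n).continuousSMul

/-- `f ∈ C^r([0,∞), C^∞(𝕋ⁿ)ⁿ)`; derivatives in `t` are limits of difference quotients in the
topology of `C^∞(𝕋ⁿ)ⁿ`, one-sided at `t = 0`. The values of `f` at `t < 0` play no role. -/
def IsCr {n : ℕ} : ℕ → (ℝ → SmoothField n) → Prop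
  | 0, f => ContinuousOn f (Set.Ici 0)
  | r + 1, f => ∃ f' : ℝ → SmoothField n,
      (∀ t ∈ Set.Ici (0 : ℝ),
        Filter.Tendsto (slope f t) (𝓝[Set.Ici 0 \ {t}] t) (𝓝 (f' t))) ∧ IsCr r f'

/-! ### Fourier coefficients, the Leray projector and the equation -/

/-- The divergence `∑ᵢ ∂ᵢ fᵢ`. -/
def divergence {n : ℕ} (f : E n → E n) (x : E n) : ℝ :=
  ∑ i, fderiv ℝ f x (EuclideanSpace.single i 1) i

/-- The Fourier coefficient `f_k = (2π)⁻ⁿ ∫_{𝕋ⁿ} f(x) e^{-i k·x} dx ∈ ℂⁿ`. -/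
def fourierVec {n : ℕ} (f : E n → E n) (k : Fin n → ℤ) : EuclideanSpace ℂ (Fin n) :=
  WithLp.toLp 2 fun j => ((2 * Real.pi : ℝ) : ℂ)⁻¹ ^ n *
    ∫ x in cell n, (f x j : ℂ) * Complex.exp (-(Complex.I * (inner ℝ (freq k) x : ℝ)))

/-- `‖f‖_{A,d} = ∑_{k ≠ 0} |k|^d |f_k|`. -/
def normA {n : ℕ} (d : ℕ) (f : E n → E n) : ℝ :=
  ∑' k : {k : Fin n → ℤ // k ≠ 0}, ‖freq k.1‖ ^ d * ‖fourierVec f k.1‖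

/-- The symbol `P_k` of the Leray projector: `P_0 = id`, and for `k ≠ 0` the matrix with entries
`(|k|² δ_{ij} - k_i k_j) / |k|²`. -/
def leraySymbol {n : ℕ} (k : Fin n → ℤ) : Matrix (Fin n) (Fin n) ℂ :=
  if k = 0 then 1
  else Matrix.of fun i j =>
    ((if i = j then (‖freq k‖ : ℂ) ^ 2 else 0) - (k i : ℂ) * (k j : ℂ)) / (‖freq k‖ : ℂ) ^ 2

/-- The Leray projector `P f (x) = ∑_k (P_k f_k) e^{i k·x}`. For a real field `f` this sum is real;
the real part below only serves to land in `ℝⁿ`. -/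
def leray {n : ℕ} (f : E n → E n) (x : E n) : E n :=
  WithLp.toLp 2 fun j => (∑' k : Fin n → ℤ,
    (leraySymbol k).mulVec (fourierVec f k) j *
      Complex.exp (Complex.I * (inner ℝ (freq k) x : ℝ))).re

/-- `v · ∇u = ∑ⱼ vⱼ ∂ⱼ u`. -/
def advect {n : ℕ} (v u : E n → E n) (x : E n) : E n := fderiv ℝ u x (v x)

/-- `u` solves `∂ₜ u = ν Δu + P[v · ∇u]` on `𝕋ⁿ × [0,∞)` with `u(·, 0) = u₀`. -/
def IsSolution {n : ℕ} (ν : ℝ) (v : ℝ → SmoothField n) (u₀ : SmoothField n)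
    (u : ℝ → SmoothField n) : Prop :=
  u 0 = u₀ ∧ ∀ t ∈ Set.Ici (0 : ℝ), ∀ x : E n,
    HasDerivWithinAt (fun s => u s x)
      (ν • Δ (u t : E n → E n) x + leray (advect (v t) (u t)) x) (Set.Ici 0) t

end

end TorusFlow

/-!
The equation is solved on the side of Fourier coefficients, where a smooth field is a rapidly
decreasing Hermitian family `a : ℤⁿ → ℂⁿ`, a sequence of fields converges in `C^∞(𝕋ⁿ)ⁿ` exactly when
it converges in all norms `∑ (1 + |k|)^d |a_k|` (`tendsto_iff_normW`), and the equation becomes the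
system of ordinary differential equations
`a_k' = -ν|k|² a_k + P_k ∑_l i (l · c_{k-l}) a_l`, with `c` the coefficients of `v` (`coeff_rhs`).

*Existence.* As `div v = 0`, the factor `l · c_{k-l}` equals `k · c_{k-l}`. In Duhamel's formula the
advection term therefore costs one factor `|k|` at the output frequency, and after insertion of a
time weight `e^{λt}` the heat semigroup returns `1 / (ν|k|² + λ)`. Because
`|k| / (ν|k|² + λ) ≤ 1 / (2√(νλ))`, the Picard iteration contracts for large `λ` in each of the norms
`sup_k (1 + |k|)^d |a_k|`, on every bounded time interval (`exists_picard_le`). Its sum solves the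
system (`solvesOn_picardSum`). The mean value inequality upgrades differentiability of the
coefficients to differentiability in `C^∞(𝕋ⁿ)ⁿ` (`tendsto_slope_of_coeff`), and since the right-hand
side is as regular in time as `v` and `u` together, regularity in time follows by induction
(`isCr_of_tendsto_slope`).

*A priori bounds.* The term `l = k` of the convolution contributes `i (k · c_0) P_k a_k` to `a_k'`.
Its inner product with `a_k` has real part zero, because `c_0` is real and `P_k` self-adjoint, and so
it does not change `|a_k|`. Hence `|a_k|` grows at most at the rate
`-ν|k|² |a_k| + ∑_{l ≠ k} |c_{k-l}| |l| |a_l|`; since `|a_k|` need not be differentiable where it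
vanishes, this is used in integrated form (`norm_le_of_energy`). After multiplication by `|k|^d` and
summation over `k ≠ 0`, the inequality `|k|^d ≤ (|k - l| + |l|)^d` and the binomial theorem bound the
production by `∑_j (d choose j) ‖v‖_{A,j} ‖u‖_{A,d+1-j}`. The term `j = 0` is absorbed by the
dissipation, up to a rate `β₀` with `‖v‖_{A,0} |l| ≤ ν|l|² + β₀` for `l ≠ 0`; the term `j = 1` is
linear in `‖u‖_{A,d}`. Gronwall's argument then gives `seqA_le`. By Young's inequality
`β₀ = ‖v‖_{A,0}² / (4ν)` is always admissible (`mul_le_dissipation`), whereas `β₀ = -δ` is admissible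
if `‖v‖_{A,0} + δ ≤ ν` (`seqA_le_of_small`).

*Uniqueness and the mean.* The coefficient `a_0` is constant in time, because `v · ∇u` is the
divergence of `u ⊗ v`. Applied to the difference of two solutions, the bound for `d = 0` shows that
the other coefficients agree (`SolvesOn.eq_zero`).
-/

open scoped Topology Laplacian ContDiff Pointwise

namespace TorusFlow

noncomputable section

open MeasureTheory

variable {n : ℕ}

/-! ### Fourier coefficients of scalar functions on the torus -/

/-- The character `x ↦ e^{i k·x}`. -/
def char (k : Fin n → ℤ) (x : E n) : ℂ :=
  Complex.exp (Complex.I * (inner ℝ (freq k) x : ℝ))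

/-- The Fourier coefficient `(2π)⁻ⁿ ∫ g(x) e^{-i k·x} dx` of a complex-valued function. -/
def fourierScalar (g : E n → ℂ) (k : Fin n → ℤ) : ℂ :=
  ((2 * Real.pi : ℝ) : ℂ)⁻¹ ^ n * ∫ x in cell n, g x * char (-k) x

@[simp]
theorem freq_apply (k : Fin n → ℤ) (i : Fin n) : freq k i = k i := rfl

@[simp]
theorem freq_zero : freq (0 : Fin n → ℤ) = 0 := by ext i; simp

theorem freq_neg (k : Fin n → ℤ) : freq (-k) = -freq k := by ext i; simp

theorem freq_add (k l : Fin n → ℤ) : freq (k + l) = freq k + freq l := by ext i; simp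

theorem freq_sub (k l : Fin n → ℤ) : freq (k - l) = freq k - freq l := by ext i; simp

theorem freq_injective : Function.Injective (freq : (Fin n → ℤ) → E n) := by
  intro k l h
  funext i
  have := congrArg (fun x : E n => x i) h
  simpa using this

theorem inner_freq (k : Fin n → ℤ) (x : E n) : inner ℝ (freq k) x = ∑ i, (k i : ℝ) * x i := by
  simp [PiLp.inner_apply, mul_comm]

theorem char_neg (k : Fin n → ℤ) (x : E n) :
    char (-k) x = Complex.exp (-(Complex.I * (inner ℝ (freq k) x : ℝ))) := by
  simp [char, freq_neg]

theorem char_add (k l : Fin n → ℤ) (x : E n) : char (k + l) x = char k x * char l x := by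
  simp [char, freq_add, inner_add_left, mul_add, Complex.exp_add]

@[simp]
theorem char_zero (x : E n) : char 0 x = 1 := by simp [char]

theorem norm_char (k : Fin n → ℤ) (x : E n) : ‖char k x‖ = 1 := by
  rw [char, mul_comm, Complex.norm_exp_ofReal_mul_I]

theorem conj_char (k : Fin n → ℤ) (x : E n) : (starRingEnd ℂ) (char k x) = char (-k) x := by
  rw [char_neg, char, ← Complex.exp_conj]
  simp

theorem char_periodic (k : Fin n → ℤ) : IsPeriodic (char k) := by
  intro l x
  have : (inner ℝ (freq k) (freq l) : ℝ) = ((∑ i, k i * l i : ℤ) : ℝ) := by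
    rw [inner_freq]; simp
  rw [char, char, inner_add_right, inner_smul_right, this, Complex.exp_eq_exp_iff_exists_int]
  refine ⟨∑ i, k i * l i, ?_⟩
  push_cast
  ring

theorem contDiff_char (k : Fin n → ℤ) : ContDiff ℝ ∞ (char k) := by
  unfold char
  refine Complex.contDiff_exp.comp (contDiff_const.mul ?_)
  exact Complex.ofRealCLM.contDiff.comp (contDiff_const.inner ℝ contDiff_id)

theorem continuous_char (k : Fin n → ℤ) : Continuous (char k) := (contDiff_char k).continuous

theorem hasFDerivAt_char (k : Fin n → ℤ) (x : E n) :
    HasFDerivAt (char k) ((Complex.I * char k x) •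
      (Complex.ofRealCLM.comp (innerSL ℝ (freq k)))) x := by
  have h1 : HasFDerivAt (fun x : E n => ((inner ℝ (freq k) x : ℝ) : ℂ))
      (Complex.ofRealCLM.comp (innerSL ℝ (freq k))) x :=
    (Complex.ofRealCLM.comp (innerSL ℝ (freq k))).hasFDerivAt
  have h2 := (h1.const_mul Complex.I).cexp
  convert! h2 using 1
  rw [smul_smul, mul_comm, char]

theorem fderiv_char (k : Fin n → ℤ) (x : E n) (j : Fin n) :
    fderiv ℝ (char k) x (EuclideanSpace.single j 1) = Complex.I * k j * char k x := by
  rw [(hasFDerivAt_char k x).fderiv]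
  simp [inner_freq]
  ring

/-! ### Integration over the period cell -/

theorem cell_eq_preimage :
    cell n = (WithLp.ofLp : E n → Fin n → ℝ) ⁻¹'
      (Set.univ.pi fun _ => Set.Ico 0 (2 * Real.pi)) := by
  ext x; simp [cell]

theorem setIntegral_cell {F : Type*} [NormedAddCommGroup F] [NormedSpace ℝ F] (g : E n → F) :
    ∫ x in cell n, g x =
      ∫ y in Set.Icc (0 : Fin n → ℝ) (fun _ => 2 * Real.pi), g (WithLp.toLp 2 y) := by
  have h := (EuclideanSpace.volume_preserving_symm_measurableEquiv_toLp (Fin n)).setIntegral_preimage_emb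
    (MeasurableEquiv.toLp 2 (Fin n → ℝ)).symm.measurableEmbedding
    (fun y => g (WithLp.toLp 2 y)) (Set.univ.pi fun _ => Set.Ico 0 (2 * Real.pi))
  refine Eq.trans ?_ (h.trans (setIntegral_congr_set Measure.univ_pi_Ico_ae_eq_Icc))
  rw [cell_eq_preimage]
  rfl

theorem volume_cell : (volume (cell n)).toReal = (2 * Real.pi) ^ n := by
  have := setIntegral_cell (n := n) (fun _ => (1 : ℝ))
  simp only [setIntegral_const, smul_eq_mul, mul_one] at this
  rw [measureReal_def, measureReal_def, Real.volume_Icc_pi_toReal] at this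
  · simpa using this
  · intro i; simp [Real.pi_nonneg]

theorem cell_subset_closedBall :
    cell n ⊆ Metric.closedBall (0 : E n) (Real.sqrt (n * (2 * Real.pi) ^ 2)) := by
  intro x hx
  rw [mem_closedBall_zero_iff, EuclideanSpace.norm_eq]
  apply Real.sqrt_le_sqrt
  calc ∑ i, ‖x i‖ ^ 2 ≤ ∑ _i : Fin n, (2 * Real.pi) ^ 2 := by
        refine Finset.sum_le_sum fun i _ => ?_
        rw [Real.norm_eq_abs, abs_of_nonneg (hx i).1]
        exact pow_le_pow_left₀ (hx i).1 (hx i).2.le 2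
    _ = _ := by simp

theorem volume_cell_lt_top : volume (cell n) < ⊤ :=
  (measure_mono cell_subset_closedBall).trans_lt (isCompact_closedBall _ _).measure_lt_top

theorem integrableOn_cell {F : Type*} [NormedAddCommGroup F] {g : E n → F} (hg : Continuous g) :
    IntegrableOn g (cell n) :=
  (hg.continuousOn.integrableOn_compact (isCompact_closedBall _ _)).mono_set
    cell_subset_closedBall

/-- The integral of a partial derivative of a periodic function vanishes: in the divergence theorem
on the box, opposite faces cancel. -/
theorem integral_cell_fderiv {g : E n → ℂ} (hg : ContDiff ℝ 1 g) (hp : IsPeriodic g) (j : Fin n) :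
    ∫ x in cell n, fderiv ℝ g x (EuclideanSpace.single j 1) = 0 := by
  obtain ⟨m, rfl⟩ : ∃ m, n = m + 1 := ⟨n - 1, by have := j.pos; omega⟩
  rw [setIntegral_cell]
  let L : (Fin (m + 1) → ℝ) →L[ℝ] E (m + 1) :=
    ((PiLp.continuousLinearEquiv 2 ℝ (fun _ : Fin (m + 1) => ℝ)).symm : _ →L[ℝ] _)
  have hL : ∀ y, L y = WithLp.toLp 2 y := fun _ => rfl
  have hcont : Continuous fun y : Fin (m + 1) → ℝ => fderiv ℝ g (L y) :=
    (hg.continuous_fderiv one_ne_zero).comp L.continuous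
  have key := integral_divergence_of_hasFDerivAt_off_countable'
    (0 : Fin (m + 1) → ℝ) (fun _ => 2 * Real.pi) (fun i => by simp [Real.pi_nonneg])
    (fun i y => if i = j then g (L y) else 0)
    (fun i y => if i = j then (fderiv ℝ g (L y)).comp L else 0) ∅ Set.countable_empty
    (fun i => by
      by_cases h : i = j
      · simpa only [h, if_true] using! (hg.continuous.comp L.continuous).continuousOn
      · simpa [h] using continuousOn_const)
    (fun y _ i => by
      by_cases h : i = j
      · simpa only [h, if_true] using!
          (hg.differentiable one_ne_zero (L y)).hasFDerivAt.comp y L.hasFDerivAt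
      · simpa [h] using hasFDerivAt_const (0 : ℂ) y)
    (by
      refine Continuous.integrableOn_Icc ?_
      refine continuous_finsetSum _ fun i _ => ?_
      by_cases h : i = j
      · simp only [h, if_true]
        exact (hcont.clm_comp continuous_const).clm_apply continuous_const
      · simp only [h, if_false]
        exact continuous_const)
  have hs : ∀ y : Fin (m + 1) → ℝ,
      (∑ i, (if i = j then (fderiv ℝ g (L y)).comp L else 0) (Pi.single i 1))
        = fderiv ℝ g (WithLp.toLp 2 y) (EuclideanSpace.single j 1) := by
    intro y
    rw [Finset.sum_eq_single j]
    · simp [hL]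
    · intro i _ h; simp [h]
    · simp
  simp only [hs] at key
  rw [key]
  refine Finset.sum_eq_zero fun i _ => ?_
  by_cases h : i = j
  · subst h
    rw [sub_eq_zero]
    congr 1
    funext y
    simp only [if_true, hL, Pi.zero_apply]
    -- the two faces differ by one period in the direction `i`
    rw [← hp (Pi.single i 1) (WithLp.toLp 2 (i.insertNth 0 y))]
    congr 1
    ext l
    rcases Fin.eq_self_or_eq_succAbove i l with rfl | ⟨l, rfl⟩
    · simp
    · simp [Fin.succAbove_ne]
  · simp [h]

/-! ### Coefficients of derivatives, characters and products -/

theorem fourierScalar_fderiv {g : E n → ℂ} (hg : ContDiff ℝ 1 g) (hp : IsPeriodic g) (j : Fin n)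
    (k : Fin n → ℤ) :
    fourierScalar (fun x => fderiv ℝ g x (EuclideanSpace.single j 1)) k
      = Complex.I * k j * fourierScalar g k := by
  have hc : ContDiff ℝ 1 (char (-k) : E n → ℂ) := (contDiff_char _).of_le (by exact_mod_cast le_top)
  have h0 := integral_cell_fderiv (hg.mul hc)
    (fun l x => by simp only [hp l x, char_periodic (-k) l x]) j
  have hd : ∀ x, fderiv ℝ (fun y => g y * char (-k) y) x (EuclideanSpace.single j 1)
      = fderiv ℝ g x (EuclideanSpace.single j 1) * char (-k) x
        - Complex.I * k j * (g x * char (-k) x) := by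
    intro x
    rw [fderiv_fun_mul (hg.differentiable one_ne_zero x) (hc.differentiable one_ne_zero x)]
    simp only [add_apply, smul_apply, smul_eq_mul,
      fderiv_char, Pi.neg_apply, Int.cast_neg]
    ring
  simp only [hd] at h0
  rw [integral_sub, integral_const_mul, sub_eq_zero] at h0
  · rw [fourierScalar, fourierScalar, h0]; ring
  · exact integrableOn_cell (((hg.continuous_fderiv one_ne_zero).clm_apply continuous_const).mul
      (continuous_char _))
  · exact integrableOn_cell (continuous_const.mul (hg.continuous.mul (continuous_char _)))

theorem fourierScalar_one (k : Fin n → ℤ) :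
    fourierScalar (fun _ => 1) k = if k = 0 then 1 else 0 := by
  split_ifs with h
  · subst h
    have : (volume.real (cell n) : ℂ) = (2 * Real.pi : ℝ) ^ n := by
      rw [measureReal_def, volume_cell]; push_cast; ring
    simp only [fourierScalar, neg_zero, char_zero, mul_one, setIntegral_const, Complex.real_smul,
      this]
    rw [inv_pow, inv_mul_cancel₀]
    exact pow_ne_zero _ (by exact_mod_cast (by positivity : (2 * Real.pi) ≠ 0))
  · obtain ⟨j, hj⟩ := Function.ne_iff.mp h
    have := fourierScalar_fderiv (g := fun _ : E n => (1 : ℂ)) contDiff_const (fun _ _ => rfl) j k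
    have h0 : fourierScalar (fun x : E n => (fderiv ℝ (fun _ : E n => (1 : ℂ)) x)
        (EuclideanSpace.single j 1)) k = 0 := by
      simp [fourierScalar]
    rw [h0] at this
    have hj' : (k j : ℂ) ≠ 0 := by exact_mod_cast hj
    simpa [hj'] using this.symm

theorem norm_fourierScalar_le {g : E n → ℂ} {C : ℝ} (hC : ∀ x, ‖g x‖ ≤ C) (k : Fin n → ℤ) :
    ‖fourierScalar g k‖ ≤ C := by
  have hp : (0 : ℝ) < (2 * Real.pi) ^ n := by positivity
  have h1 : ‖∫ x in cell n, g x * char (-k) x‖ ≤ C * (2 * Real.pi) ^ n := by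
    have := norm_setIntegral_le_of_norm_le_const (f := fun x => g x * char (-k) x) (C := C)
      (volume_cell_lt_top (n := n)) (fun x _ => by rw [norm_mul, norm_char, mul_one]; exact hC x)
    rwa [measureReal_def, volume_cell] at this
  rw [fourierScalar, norm_mul, norm_pow, norm_inv, Complex.norm_real, Real.norm_eq_abs,
    abs_of_pos (by positivity : (0 : ℝ) < 2 * Real.pi), inv_pow, inv_mul_le_iff₀ hp, mul_comm]
  exact h1

/-- The Fourier coefficients of a product are the convolution of the coefficients, when one factor
is an absolutely convergent Fourier series. -/
theorem hasSum_fourierScalar_mul {h g : E n → ℂ} (hh : Continuous h) {c : (Fin n → ℤ) → ℂ}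
    (hc : Summable fun l => ‖c l‖) (hg : ∀ x, g x = ∑' l, c l * char l x) (k : Fin n → ℤ) :
    HasSum (fun l => fourierScalar h (k - l) * c l) (fourierScalar (fun x => h x * g x) k) := by
  have hF : ∀ l, Integrable (fun x => c l * (h x * char (-(k - l)) x))
      (volume.restrict (cell n)) :=
    fun l => integrableOn_cell (continuous_const.mul (hh.mul (continuous_char _)))
  have hs : Summable fun l => ∫ x in cell n, ‖c l * (h x * char (-(k - l)) x)‖ := by
    simp only [norm_mul, norm_char, mul_one, integral_const_mul]
    exact hc.mul_right _
  have h1 := (hasSum_integral_of_summable_integral_norm hF hs).mul_left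
    (((2 * Real.pi : ℝ) : ℂ)⁻¹ ^ n)
  simp only [integral_const_mul] at h1
  convert! h1 using 1
  · funext l
    rw [fourierScalar]; ring
  · rw [fourierScalar]
    congr 2
    funext x
    rw [hg x, ← tsum_mul_left, ← tsum_mul_right]
    refine tsum_congr fun l => ?_
    rw [show -(k - l) = l + -k by abel, char_add]
    ring

theorem fourierScalar_tsum {c : (Fin n → ℤ) → ℂ} (hc : Summable fun l => ‖c l‖) (k : Fin n → ℤ) :
    fourierScalar (fun x => ∑' l, c l * char l x) k = c k := by
  have h := hasSum_fourierScalar_mul (h := fun _ => (1 : ℂ)) continuous_const hc (fun _ => rfl) k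
  simp only [one_mul, fourierScalar_one] at h
  refine h.unique ?_
  convert! hasSum_ite_eq k (c k) using 2 with l
  by_cases hl : l = k
  · simp [hl]
  · simp [hl, sub_eq_zero, Ne.symm hl]

/-! ### Fourier inversion -/

/-- A continuous periodic function with summable Fourier coefficients is the sum of its Fourier
series. -/
theorem fourier_inversion {g : E n → ℂ} (hg : Continuous g) (hp : IsPeriodic g)
    (hs : Summable (fourierScalar g)) (x : E n) : g x = ∑' k, fourierScalar g k * char k x := by
  have hpi : (2 * Real.pi) ≠ 0 := by positivity
  -- After the rescaling `y ↦ 2πy`, `g` descends to a function `G` on the standard torus. It is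
  -- defined by means of a section `r` of the projection, the choice of which does not matter.
  let π : (Fin n → ℝ) → UnitAddTorus (Fin n) := fun y i => (y i : UnitAddCircle)
  have hπ : IsOpenQuotientMap π :=
    IsOpenQuotientMap.piMap fun _ => QuotientAddGroup.isOpenQuotientMap_mk
  let r : UnitAddTorus (Fin n) → (Fin n → ℝ) := Function.surjInv hπ.surjective
  have hr : ∀ y, π (r y) = y := Function.surjInv_eq hπ.surjective
  let G : UnitAddTorus (Fin n) → ℂ := fun y => g (WithLp.toLp 2 ((2 * Real.pi) • r y))
  have hG : ∀ y, G (π y) = g (WithLp.toLp 2 ((2 * Real.pi) • y)) := by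
    intro y
    have h1 : ∀ i, ∃ m : ℤ, r (π y) i = y i + m := by
      intro i
      have h2 : ((r (π y) i : ℝ) : UnitAddCircle) = (y i : UnitAddCircle) :=
        congrFun (hr (π y)) i
      rw [eq_comm, QuotientAddGroup.eq, AddSubgroup.mem_zmultiples_iff] at h2
      obtain ⟨m, hm⟩ := h2
      exact ⟨m, by simp at hm; linarith⟩
    choose m hm using h1
    simp only [G]
    rw [← hp m (WithLp.toLp 2 ((2 * Real.pi) • y))]
    congr 1
    ext i
    simp [hm, mul_add]
  have hGc : Continuous G := by
    rw [hπ.isQuotientMap.continuous_iff]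
    have : G ∘ π = fun y => g (WithLp.toLp 2 ((2 * Real.pi) • y)) := funext hG
    rw [this]
    exact hg.comp ((PiLp.continuous_toLp 2 _).comp (continuous_const_smul _))
  have hmF : ∀ (k : Fin n → ℤ) (y : Fin n → ℝ),
      UnitAddTorus.mFourier k (π y) = char k (WithLp.toLp 2 ((2 * Real.pi) • y)) := by
    intro k y
    simp only [UnitAddTorus.mFourier, ContinuousMap.coe_mk, π, fourier_coe_apply, char]
    rw [← Complex.exp_sum, inner_freq]
    congr 1
    push_cast
    rw [Finset.mul_sum]
    refine Finset.sum_congr rfl fun i _ => ?_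
    simp
    ring
  have hcoef : UnitAddTorus.mFourierCoeff G = fourierScalar g := by
    funext k
    rw [UnitAddTorus.mFourierCoeff_eq_integral G k 0]
    have h1 : ∀ y : Fin n → ℝ, UnitAddTorus.mFourier (-k) (fun i => (y i : UnitAddCircle)) •
        G (fun i => (y i : UnitAddCircle)) = (fun z : Fin n → ℝ => g (WithLp.toLp 2 z) *
          char (-k) (WithLp.toLp 2 z)) ((2 * Real.pi) • y) := by
      intro y
      rw [smul_eq_mul, mul_comm]
      exact congrArg₂ _ (hG y) (hmF (-k) y)
    simp only [h1]
    have h2 : {x : Fin n → ℝ | ∀ i, x i ∈ Set.Ioc ((0 : Fin n → ℝ) i) ((0 : Fin n → ℝ) i + 1)}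
        =ᵐ[volume] Set.Icc (0 : Fin n → ℝ) (fun _ => 1) := by
      have := Measure.univ_pi_Ioc_ae_eq_Icc (μ := fun _ : Fin n => (volume : Measure ℝ))
        (f := 0) (g := fun _ => 1)
      rw [show {x : Fin n → ℝ | ∀ i, x i ∈ Set.Ioc ((0 : Fin n → ℝ) i) ((0 : Fin n → ℝ) i + 1)}
        = Set.univ.pi fun i => Set.Ioc ((0 : Fin n → ℝ) i) 1 by ext x; simp]
      exact this
    rw [setIntegral_congr_set h2, Measure.setIntegral_comp_smul volume
      (fun z : Fin n → ℝ => g (WithLp.toLp 2 z) * char (-k) (WithLp.toLp 2 z)) _ hpi,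
      fourierScalar, setIntegral_cell]
    have h3 : (fun y : Fin n → ℝ => (2 * Real.pi) • y) '' Set.Icc (0 : Fin n → ℝ) (fun _ => 1)
        = Set.Icc (0 : Fin n → ℝ) (fun _ => 2 * Real.pi) := by
      have := (OrderIso.smulRight (β := Fin n → ℝ) (by positivity : 0 < 2 * Real.pi)).image_Icc
        (0 : Fin n → ℝ) (fun _ => 1)
      simpa [Pi.smul_def] using this
    rw [← Set.image_smul, h3]
    rw [Module.finrank_fin_fun, abs_of_nonneg (by positivity), Complex.real_smul]
    push_cast
    rw [inv_pow]
  have hsum : Summable (UnitAddTorus.mFourierCoeff G) := by rw [hcoef]; exact hs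
  have := UnitAddTorus.hasSum_mFourier_series_apply_of_summable (f := ⟨G, hGc⟩) hsum
    (π ((2 * Real.pi)⁻¹ • WithLp.ofLp x))
  simp only [ContinuousMap.coe_mk, hcoef, hG, hmF, smul_smul, mul_inv_cancel₀ hpi, one_smul,
    smul_eq_mul] at this
  exact this.tsum_eq.symm

/-! ### Weights on the frequency lattice -/

/-- Complex vectors `ℂⁿ`, in which the Fourier coefficients live. -/
abbrev V (n : ℕ) := EuclideanSpace ℂ (Fin n)

/-- The submultiplicative weight `1 + |k|`. -/
def wt (k : Fin n → ℤ) : ℝ := 1 + ‖freq k‖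

theorem one_le_wt (k : Fin n → ℤ) : 1 ≤ wt k := by simp [wt]

theorem wt_pos (k : Fin n → ℤ) : 0 < wt k := zero_lt_one.trans_le (one_le_wt k)

theorem norm_freq_le_wt (k : Fin n → ℤ) : ‖freq k‖ ≤ wt k := by simp [wt]

theorem wt_le_mul (k l : Fin n → ℤ) : wt k ≤ wt (k - l) * wt l := by
  have h : ‖freq k‖ ≤ ‖freq (k - l)‖ + ‖freq l‖ := by
    rw [freq_sub]; simpa using norm_add_le (freq k - freq l) (freq l)
  have := mul_nonneg (norm_nonneg (freq (k - l))) (norm_nonneg (freq l))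
  simp only [wt]
  nlinarith

theorem abs_le_norm_freq (k : Fin n → ℤ) (j : Fin n) : |(k j : ℝ)| ≤ ‖freq k‖ := by
  simpa using PiLp.norm_apply_le (freq k) j

theorem one_le_norm_freq {k : Fin n → ℤ} (hk : k ≠ 0) : 1 ≤ ‖freq k‖ := by
  obtain ⟨j, hj⟩ := Function.ne_iff.mp hk
  refine le_trans ?_ (abs_le_norm_freq k j)
  exact_mod_cast Int.one_le_abs hj

theorem norm_freq_ne_zero {k : Fin n → ℤ} (hk : k ≠ 0) : ‖freq k‖ ≠ 0 :=
  (zero_lt_one.trans_le (one_le_norm_freq hk)).ne'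

theorem norm_le_sum_norm {𝕜 : Type*} [RCLike 𝕜] (z : EuclideanSpace 𝕜 (Fin n)) :
    ‖z‖ ≤ ∑ j, ‖z j‖ := by
  rw [EuclideanSpace.norm_eq]
  apply Real.sqrt_le_iff.mpr
  exact ⟨Finset.sum_nonneg fun _ _ => norm_nonneg _,
    Finset.sum_sq_le_sq_sum_of_nonneg fun _ _ => norm_nonneg _⟩

theorem wt_le_sum (k : Fin n → ℤ) : wt k ≤ 1 + ∑ j, |(k j : ℝ)| := by
  have := norm_le_sum_norm (freq k)
  simp only [freq_apply, Real.norm_eq_abs] at this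
  simpa [wt] using this

/-- Any exponent above the rank `n` of the frequency lattice would do. -/
theorem summable_wt_inv : Summable fun k : Fin n → ℤ => ((wt k)⁻¹) ^ (n + 1) := by
  let b := (EuclideanSpace.basisFun (Fin n) ℝ).toBasis
  let L : Submodule ℤ (E n) := Submodule.span ℤ (Set.range b)
  have hmem : ∀ k : Fin n → ℤ, freq k ∈ L := by
    intro k
    have : freq k = ∑ i, k i • b i := by
      ext j
      simp [b, Finset.sum_apply, Pi.single_apply]
    rw [this]
    exact Submodule.sum_mem _ fun i _ => Submodule.smul_mem _ _ (Submodule.subset_span ⟨i, rfl⟩)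
  have hfin : Module.finrank ℤ L < n + 1 := by
    have := ZLattice.rank ℝ L
    rw [this]
    simp
  have h := (ZLattice.summable_norm_pow_inv L (n + 1) hfin).comp_injective
    (i := fun k : Fin n → ℤ => (⟨freq k, hmem k⟩ : L))
    (fun k l h => freq_injective (congrArg Subtype.val h))
  refine h.of_norm_bounded_eventually ?_
  filter_upwards [(Set.finite_singleton (0 : Fin n → ℤ)).compl_mem_cofinite] with k hk
  have h1 := one_le_norm_freq hk
  rw [Real.norm_of_nonneg (by have := wt_pos k; positivity)]
  simp only [Function.comp]
  have : ‖(⟨freq k, hmem k⟩ : L)‖ = ‖freq k‖ := rfl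
  rw [this]
  have h2 := norm_freq_le_wt k
  have h3 := wt_pos k
  gcongr

/-! ### Rapidly decreasing families of coefficients -/

/-- Families of coefficients that decay faster than every power of `1 + |k|`. -/
def Rapid (a : (Fin n → ℤ) → V n) : Prop := ∀ d : ℕ, ∃ C, ∀ k, wt k ^ d * ‖a k‖ ≤ C

/-- The symmetry `a_{-k} = conj a_k` of the Fourier coefficients of real fields. -/
def Hermitian (a : (Fin n → ℤ) → V n) : Prop := ∀ k j, a (-k) j = (starRingEnd ℂ) (a k j)

/-- The weighted `l¹`-norm `∑ (1 + |k|)^d |a_k|`. -/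
def normW (d : ℕ) (a : (Fin n → ℤ) → V n) : ℝ := ∑' k, wt k ^ d * ‖a k‖

/-- A surplus of powers of the weight is traded for decay. -/
theorem le_mul_wt_inv {x C : ℝ} {d e : ℕ} {k : Fin n → ℤ} (h : wt k ^ (d + e) * x ≤ C) :
    wt k ^ d * x ≤ C * (wt k)⁻¹ ^ e := by
  have := wt_pos k
  rw [inv_pow, ← div_eq_mul_inv, le_div_iff₀ (by positivity)]
  calc _ = wt k ^ (d + e) * x := by ring
    _ ≤ C := h

theorem summable_of_le {d : ℕ} {C : ℝ} {a : (Fin n → ℤ) → V n}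
    (h : ∀ k, wt k ^ (d + (n + 1)) * ‖a k‖ ≤ C) : Summable fun k => wt k ^ d * ‖a k‖ :=
  (summable_wt_inv.mul_left C).of_nonneg_of_le
    (fun k => mul_nonneg (pow_nonneg (wt_pos k).le _) (norm_nonneg _)) fun k => le_mul_wt_inv (h k)

theorem normW_le {d : ℕ} {C : ℝ} {a : (Fin n → ℤ) → V n}
    (h : ∀ k, wt k ^ (d + (n + 1)) * ‖a k‖ ≤ C) :
    normW d a ≤ C * ∑' k : Fin n → ℤ, (wt k)⁻¹ ^ (n + 1) := by
  rw [← tsum_mul_left]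
  exact (summable_of_le h).tsum_le_tsum (fun k => le_mul_wt_inv (h k))
    (summable_wt_inv.mul_left C)

theorem Rapid.summable {a : (Fin n → ℤ) → V n} (ha : Rapid a) (d : ℕ) :
    Summable fun k => wt k ^ d * ‖a k‖ := by
  obtain ⟨C, hC⟩ := ha (d + (n + 1))
  exact summable_of_le hC

theorem normW_nonneg (d : ℕ) (a : (Fin n → ℤ) → V n) : 0 ≤ normW d a :=
  tsum_nonneg fun k => mul_nonneg (pow_nonneg (wt_pos k).le _) (norm_nonneg _)

theorem Rapid.le_normW {a : (Fin n → ℤ) → V n} (ha : Rapid a) (d : ℕ) (k : Fin n → ℤ) :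
    wt k ^ d * ‖a k‖ ≤ normW d a :=
  (ha.summable d).le_tsum k fun l _ => mul_nonneg (pow_nonneg (wt_pos l).le _) (norm_nonneg _)

theorem Rapid.norm_le_normW {a : (Fin n → ℤ) → V n} (ha : Rapid a) (k : Fin n → ℤ) :
    ‖a k‖ ≤ normW 0 a := by simpa using ha.le_normW 0 k

theorem Rapid.summable_norm {a : (Fin n → ℤ) → V n} (ha : Rapid a) : Summable fun k => ‖a k‖ := by
  simpa using ha.summable 0

theorem Rapid.summable_apply {a : (Fin n → ℤ) → V n} (ha : Rapid a) (j : Fin n) :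
    Summable fun k => ‖a k j‖ :=
  ha.summable_norm.of_nonneg_of_le (fun _ => norm_nonneg _) fun k => PiLp.norm_apply_le (a k) j

theorem Rapid.summable_mul_char {a : (Fin n → ℤ) → V n} (ha : Rapid a) (j : Fin n) (x : E n) :
    Summable fun k => a k j * char k x :=
  Summable.of_norm (by simpa [norm_char] using ha.summable_apply j)

theorem Rapid.of_le {a b : (Fin n → ℤ) → V n} (ha : Rapid a) {m : ℕ}
    (h : ∀ k, ‖b k‖ ≤ wt k ^ m * ‖a k‖) : Rapid b := by
  intro d
  obtain ⟨C, hC⟩ := ha (d + m)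
  refine ⟨C, fun k => le_trans ?_ (hC k)⟩
  rw [pow_add, mul_assoc]
  exact mul_le_mul_of_nonneg_left (h k) (pow_nonneg (wt_pos k).le _)

theorem Rapid.add {a b : (Fin n → ℤ) → V n} (ha : Rapid a) (hb : Rapid b) : Rapid (a + b) := by
  intro d
  obtain ⟨C, hC⟩ := ha d
  obtain ⟨D, hD⟩ := hb d
  refine ⟨C + D, fun k => ?_⟩
  calc wt k ^ d * ‖a k + b k‖ ≤ wt k ^ d * (‖a k‖ + ‖b k‖) :=
        mul_le_mul_of_nonneg_left (norm_add_le _ _) (pow_nonneg (wt_pos k).le _)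
    _ ≤ C + D := by rw [mul_add]; exact add_le_add (hC k) (hD k)

theorem normW_add_le {a b : (Fin n → ℤ) → V n} (ha : Rapid a) (hb : Rapid b) (d : ℕ) :
    normW d (a + b) ≤ normW d a + normW d b := by
  rw [normW, normW, normW, ← (ha.summable d).tsum_add (hb.summable d)]
  refine ((ha.add hb).summable d).tsum_le_tsum (fun k => ?_)
    ((ha.summable d).add (hb.summable d))
  rw [← mul_add]
  exact mul_le_mul_of_nonneg_left (norm_add_le _ _) (pow_nonneg (wt_pos k).le _)

/-! ### Synthesis of a field from its coefficients -/

/-- The field `x ↦ Re ∑ a_k e^{i k·x}`. For Hermitian `a` the sum is real. -/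
def synth (a : (Fin n → ℤ) → V n) (x : E n) : E n :=
  WithLp.toLp 2 fun j => (∑' k, a k j * char k x).re

/-- The field `x ↦ Re (c e^{i k·x})`. -/
def mode (k : Fin n → ℤ) (c : V n) (x : E n) : E n :=
  WithLp.toLp 2 fun j => (c j * char k x).re

theorem iteratedDeriv_cexp_I (m : ℕ) :
    iteratedDeriv m (fun s : ℝ => Complex.exp (Complex.I * s))
      = fun s : ℝ => Complex.I ^ m * Complex.exp (Complex.I * s) := by
  induction m with
  | zero => simp
  | succ m ih =>
    rw [iteratedDeriv_succ, ih]
    funext s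
    have h : HasDerivAt (fun s : ℝ => Complex.exp (Complex.I * s))
        (Complex.exp (Complex.I * s) * Complex.I) s := by
      simpa using (Complex.ofRealCLM.hasDerivAt.const_mul Complex.I).cexp
    rw [(h.const_mul _).deriv]
    ring

theorem contDiff_cexp_I : ContDiff ℝ ∞ (fun s : ℝ => Complex.exp (Complex.I * s)) :=
  Complex.contDiff_exp.comp (contDiff_const.mul Complex.ofRealCLM.contDiff)

/-- The real-linear map `z ↦ Re (z c)` from `ℂ` to `ℝⁿ`. -/
def reSMul (c : V n) : ℂ →L[ℝ] E n :=
  LinearMap.mkContinuous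
    { toFun := fun z => WithLp.toLp 2 fun j => (c j * z).re
      map_add' := fun z w => by ext j; simp; ring
      map_smul' := fun r z => by ext j; simp; ring }
    ‖c‖ (fun z => by
      simp only [LinearMap.coe_mk, AddHom.coe_mk]
      rw [EuclideanSpace.norm_eq, EuclideanSpace.norm_eq, ← Real.sqrt_sq (norm_nonneg z),
        ← Real.sqrt_mul (Finset.sum_nonneg fun _ _ => sq_nonneg _), Finset.sum_mul]
      refine Real.sqrt_le_sqrt (Finset.sum_le_sum fun j _ => ?_)
      rw [← mul_pow, ← norm_mul]
      exact pow_le_pow_left₀ (norm_nonneg _) (Complex.abs_re_le_norm _) 2)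

theorem norm_reSMul_le (c : V n) : ‖reSMul c‖ ≤ ‖c‖ :=
  LinearMap.mkContinuous_norm_le _ (norm_nonneg _) _

theorem mode_eq (k : Fin n → ℤ) (c : V n) :
    mode k c = reSMul c ∘ ((fun s : ℝ => Complex.exp (Complex.I * s)) ∘ innerSL ℝ (freq k)) :=
  rfl

theorem contDiff_mode (k : Fin n → ℤ) (c : V n) : ContDiff ℝ ∞ (mode k c) := by
  rw [mode_eq]
  exact (reSMul c).contDiff.comp (contDiff_cexp_I.comp (innerSL ℝ (freq k)).contDiff)

theorem norm_iteratedFDeriv_mode_le (m : ℕ) (k : Fin n → ℤ) (c : V n) (x : E n) :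
    ‖iteratedFDeriv ℝ m (mode k c) x‖ ≤ ‖freq k‖ ^ m * ‖c‖ := by
  have hm : (m : WithTop ℕ∞) ≤ ∞ := by exact_mod_cast le_top
  have h1 := (reSMul c).norm_iteratedFDeriv_comp_left
    ((contDiff_cexp_I.comp (innerSL ℝ (freq k)).contDiff).contDiffAt (x := x)) hm
  rw [← mode_eq] at h1
  refine h1.trans ?_
  rw [(innerSL ℝ (freq k)).iteratedFDeriv_comp_right contDiff_cexp_I x hm]
  have h2 := (iteratedFDeriv ℝ m (fun s : ℝ => Complex.exp (Complex.I * s))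
    (innerSL ℝ (freq k) x)).norm_compContinuousLinearMap_le (fun _ => innerSL ℝ (freq k))
  rw [norm_iteratedFDeriv_eq_norm_iteratedDeriv, iteratedDeriv_cexp_I, Finset.prod_const,
    Finset.card_univ, Fintype.card_fin, innerSL_apply_norm, norm_mul, norm_pow, Complex.norm_I,
    one_pow, one_mul, mul_comm Complex.I, Complex.norm_exp_ofReal_mul_I, one_mul] at h2
  calc _ ≤ ‖c‖ * ‖freq k‖ ^ m :=
        mul_le_mul (norm_reSMul_le c) h2 (norm_nonneg _) (norm_nonneg _)
    _ = _ := mul_comm _ _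

theorem Rapid.summable_freq {a : (Fin n → ℤ) → V n} (ha : Rapid a) (m : ℕ) :
    Summable fun k => ‖freq k‖ ^ m * ‖a k‖ :=
  (ha.summable m).of_nonneg_of_le (fun k => by positivity) fun k =>
    mul_le_mul_of_nonneg_right (pow_le_pow_left₀ (norm_nonneg _) (norm_freq_le_wt k) m)
      (norm_nonneg _)

theorem Rapid.synth_eq {a : (Fin n → ℤ) → V n} (ha : Rapid a) (x : E n) :
    synth a x = ∑' k, mode k (a k) x := by
  have hs : Summable fun k => mode k (a k) x := by
    refine Summable.of_norm_bounded ha.summable_norm fun k => ?_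
    simpa using norm_iteratedFDeriv_mode_le 0 k (a k) x
  ext j
  have h1 : (∑' k, mode k (a k) x) j = ∑' k, mode k (a k) x j :=
    (EuclideanSpace.proj (𝕜 := ℝ) j : E n →L[ℝ] ℝ).map_tsum hs
  rw [h1]
  exact Complex.reCLM.map_tsum (ha.summable_mul_char j x)

theorem Rapid.contDiff_synth {a : (Fin n → ℤ) → V n} (ha : Rapid a) : ContDiff ℝ ∞ (synth a) := by
  rw [funext ha.synth_eq]
  exact contDiff_tsum (N := ⊤) (fun k => contDiff_mode k (a k))
    (fun m _ => ha.summable_freq m) (fun m k x _ => norm_iteratedFDeriv_mode_le m k (a k) x)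

theorem Rapid.norm_iteratedFDeriv_synth_le {a : (Fin n → ℤ) → V n} (ha : Rapid a) (m : ℕ)
    (x : E n) : ‖iteratedFDeriv ℝ m (synth a) x‖ ≤ normW m a := by
  rw [funext ha.synth_eq, iteratedFDeriv_tsum_apply (N := ⊤) (fun k => contDiff_mode k (a k))
    (fun m _ => ha.summable_freq m) (fun m k x _ => norm_iteratedFDeriv_mode_le m k (a k) x) le_top]
  refine tsum_of_norm_bounded (ha.summable m).hasSum fun k => ?_
  exact (norm_iteratedFDeriv_mode_le m k (a k) x).trans
    (mul_le_mul_of_nonneg_right (pow_le_pow_left₀ (norm_nonneg _) (norm_freq_le_wt k) m)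
      (norm_nonneg _))

theorem synth_periodic (a : (Fin n → ℤ) → V n) : IsPeriodic (synth a) := by
  intro l x
  simp only [synth, char_periodic _ l x]

/-- The smooth field with a given rapidly decreasing family of coefficients. -/
def Rapid.field {a : (Fin n → ℤ) → V n} (ha : Rapid a) : SmoothField n :=
  ⟨synth a, ha.contDiff_synth, synth_periodic a⟩

theorem Hermitian.ofReal_synth {a : (Fin n → ℤ) → V n} (hh : Hermitian a)
    (x : E n) (j : Fin n) : ((synth a x j : ℝ) : ℂ) = ∑' k, a k j * char k x := by
  refine Complex.conj_eq_iff_re.mp ?_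
  rw [Complex.conj_tsum, ← (Equiv.neg (Fin n → ℤ)).tsum_eq]
  refine tsum_congr fun k => ?_
  simp [hh k j, conj_char]

theorem fourierVec_apply (f : E n → E n) (k : Fin n → ℤ) (j : Fin n) :
    fourierVec f k j = fourierScalar (fun x => (f x j : ℂ)) k := by
  simp only [fourierVec, fourierScalar, char_neg]

/-- Synthesis is a right inverse of taking Fourier coefficients. -/
theorem Rapid.fourierVec_synth {a : (Fin n → ℤ) → V n} (ha : Rapid a) (hh : Hermitian a) :
    fourierVec (synth a) = a := by
  funext k
  ext j
  simp only [fourierVec_apply, hh.ofReal_synth]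
  exact fourierScalar_tsum (ha.summable_apply j) k

/-! ### Coefficients of smooth fields -/

theorem SmoothField.differentiable (f : SmoothField n) : Differentiable ℝ f :=
  f.2.1.differentiable (by simp)

theorem SmoothField.contDiff_apply (f : SmoothField n) (j : Fin n) :
    ContDiff ℝ ∞ fun x => (f x j : ℂ) :=
  Complex.ofRealCLM.contDiff.comp
    ((EuclideanSpace.proj (𝕜 := ℝ) j : E n →L[ℝ] ℝ).contDiff.comp f.2.1)

theorem SmoothField.continuous_apply (f : SmoothField n) (j : Fin n) :
    Continuous fun x => (f x j : ℂ) := (SmoothField.contDiff_apply f j).continuous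

theorem SmoothField.periodic_apply (f : SmoothField n) (j : Fin n) :
    IsPeriodic fun x => (f x j : ℂ) := fun k x => by simp only [f.2.2 k x]

/-- The Fourier coefficients as a real-linear map on smooth fields. -/
def coeff : SmoothField n →ₗ[ℝ] ((Fin n → ℤ) → V n) where
  toFun f := fourierVec f
  map_add' f g := by
    funext k
    ext j
    have : ∀ x, ((f + g : SmoothField n) : E n → E n) x = f x + g x := fun _ => rfl
    simp only [Pi.add_apply, PiLp.add_apply, fourierVec_apply, fourierScalar, this,
      Complex.ofReal_add, add_mul]
    rw [integral_add, mul_add]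
    · exact integrableOn_cell ((SmoothField.continuous_apply f j).mul (continuous_char _))
    · exact integrableOn_cell ((SmoothField.continuous_apply g j).mul (continuous_char _))
  map_smul' c f := by
    funext k
    ext j
    have : ∀ x, ((c • f : SmoothField n) : E n → E n) x = c • f x := fun _ => rfl
    simp only [Pi.smul_apply, PiLp.smul_apply, fourierVec_apply, fourierScalar, this,
      RingHom.id_apply, smul_eq_mul, Complex.ofReal_mul, mul_assoc, Complex.real_smul]
    rw [integral_const_mul]
    ring

theorem coeff_def (f : SmoothField n) : coeff f = fourierVec f := rfl

theorem coeff_apply (f : SmoothField n) (k : Fin n → ℤ) (j : Fin n) :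
    coeff f k j = fourierScalar (fun x => (f x j : ℂ)) k := fourierVec_apply f k j

theorem hermitian_coeff (f : SmoothField n) : Hermitian (coeff f) := by
  intro k j
  rw [coeff_apply, coeff_apply, fourierScalar, fourierScalar, map_mul, map_pow, map_inv₀,
    Complex.conj_ofReal, ← integral_conj]
  simp [conj_char]

theorem contDiff_fderiv_apply (f : SmoothField n) (e : E n) :
    ContDiff ℝ ∞ fun x => fderiv ℝ f x e :=
  (f.2.1.fderiv_right (m := ∞) (by simp)).clm_apply contDiff_const

theorem fderiv_periodic (f : SmoothField n) (k : Fin n → ℤ) (x : E n) :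
    fderiv ℝ f (x + (2 * Real.pi) • freq k) = fderiv ℝ f x := by
  rw [← fderiv_comp_add_right]
  congr 1
  funext y
  exact f.2.2 k y

/-- The partial derivative `∂_j` on smooth fields. -/
def partialDeriv (j : Fin n) (f : SmoothField n) : SmoothField n :=
  ⟨fun x => fderiv ℝ f x (EuclideanSpace.single j 1), contDiff_fderiv_apply f _,
    fun k x => by simp only [fderiv_periodic]⟩

theorem fderiv_ofReal_apply (f : SmoothField n) (i : Fin n) (x e : E n) :
    fderiv ℝ (fun x => (f x i : ℂ)) x e = ((fderiv ℝ f x e i : ℝ) : ℂ) := by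
  have h := ((Complex.ofRealCLM.comp (EuclideanSpace.proj (𝕜 := ℝ) i : E n →L[ℝ] ℝ)).hasFDerivAt).comp
    x (SmoothField.differentiable f x).hasFDerivAt
  have h2 : HasFDerivAt (fun x => (f x i : ℂ)) _ x := h
  rw [h2.fderiv]
  rfl

theorem coeff_partialDeriv (j : Fin n) (f : SmoothField n) (k : Fin n → ℤ) :
    coeff (partialDeriv j f) k = (Complex.I * k j) • coeff f k := by
  ext i
  rw [PiLp.smul_apply, coeff_apply, coeff_apply, smul_eq_mul,
    ← fourierScalar_fderiv ((SmoothField.contDiff_apply f i).of_le (by exact_mod_cast le_top))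
      (SmoothField.periodic_apply f i) j k]
  simp only [fderiv_ofReal_apply]
  rfl

theorem le_derivSeminorm (m : ℕ) (f : SmoothField n) (x : E n) :
    ‖iteratedFDeriv ℝ m f x‖ ≤ derivSeminorm n m f :=
  le_ciSup (bddAbove_iteratedFDeriv m f) x

theorem derivSeminorm_partialDeriv_le (j : Fin n) (m : ℕ) (f : SmoothField n) :
    derivSeminorm n m (partialDeriv j f) ≤ derivSeminorm n (m + 1) f := by
  refine ciSup_le fun x => ?_
  let A : (E n →L[ℝ] E n) →L[ℝ] E n := ContinuousLinearMap.apply ℝ (E n) (EuclideanSpace.single j 1)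
  have hA : ‖A‖ ≤ 1 := by
    refine ContinuousLinearMap.opNorm_le_bound _ zero_le_one fun L => ?_
    simpa [A, mul_comm] using L.le_opNorm (EuclideanSpace.single j 1)
  have h := A.norm_iteratedFDeriv_comp_left (x := x) (n := m) (N := ∞)
    (f.2.1.fderiv_right (m := ∞) (by simp)).contDiffAt (by exact_mod_cast le_top)
  rw [norm_iteratedFDeriv_fderiv] at h
  calc _ ≤ ‖A‖ * ‖iteratedFDeriv ℝ (m + 1) f x‖ := h
    _ ≤ 1 * derivSeminorm n (m + 1) f :=
        mul_le_mul hA (le_derivSeminorm _ _ _) (norm_nonneg _) zero_le_one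
    _ = _ := one_mul _

theorem norm_coeff_le (f : SmoothField n) (k : Fin n → ℤ) :
    ‖coeff f k‖ ≤ n * derivSeminorm n 0 f := by
  refine (norm_le_sum_norm _).trans ?_
  calc ∑ j, ‖coeff f k j‖ ≤ ∑ _j : Fin n, derivSeminorm n 0 f := by
        refine Finset.sum_le_sum fun j _ => ?_
        rw [coeff_apply]
        refine norm_fourierScalar_le (fun x => ?_) k
        have h := le_derivSeminorm 0 f x
        rw [norm_iteratedFDeriv_zero] at h
        rw [Complex.norm_real]
        exact (PiLp.norm_apply_le (f x) j).trans h
    _ = _ := by simp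

/-- The Fourier coefficients decay rapidly, with constants controlled by the seminorms: every
derivative brings down one factor `k_j`. -/
theorem exists_wt_mul_norm_coeff_le (d : ℕ) : ∃ C : ℝ, 0 ≤ C ∧ ∀ (f : SmoothField n) k,
    wt k ^ d * ‖coeff f k‖ ≤ C * ∑ m ∈ Finset.range (d + 1), derivSeminorm n m f := by
  induction d with
  | zero => exact ⟨n, n.cast_nonneg, fun f k => by simpa using norm_coeff_le f k⟩
  | succ d ih =>
    obtain ⟨C, hC0, hC⟩ := ih
    refine ⟨C * (1 + n), by positivity, fun f k => ?_⟩
    have hw : 0 ≤ wt k ^ d := pow_nonneg (wt_pos k).le _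
    have h1 : wt k * ‖coeff f k‖ ≤ ‖coeff f k‖ + ∑ j, ‖coeff (partialDeriv j f) k‖ := by
      have := mul_le_mul_of_nonneg_right (wt_le_sum k) (norm_nonneg (coeff f k))
      simpa [coeff_partialDeriv, norm_smul, add_mul, Finset.sum_mul] using this
    have hS : ∀ m, 0 ≤ derivSeminorm n m f := fun m => apply_nonneg _ _
    have h2 : ∑ m ∈ Finset.range (d + 1), derivSeminorm n m f
        ≤ ∑ m ∈ Finset.range (d + 2), derivSeminorm n m f := by
      rw [Finset.sum_range_succ _ (d + 1)]
      linarith [hS (d + 1)]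
    have h3 : ∀ j, ∑ m ∈ Finset.range (d + 1), derivSeminorm n m (partialDeriv j f)
        ≤ ∑ m ∈ Finset.range (d + 2), derivSeminorm n m f := by
      intro j
      rw [Finset.sum_range_succ' _ (d + 1)]
      have := Finset.sum_le_sum fun m (_ : m ∈ Finset.range (d + 1)) =>
        derivSeminorm_partialDeriv_le j m f
      linarith [hS 0]
    calc wt k ^ (d + 1) * ‖coeff f k‖ = wt k ^ d * (wt k * ‖coeff f k‖) := by ring
      _ ≤ wt k ^ d * (‖coeff f k‖ + ∑ j, ‖coeff (partialDeriv j f) k‖) :=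
          mul_le_mul_of_nonneg_left h1 hw
      _ = wt k ^ d * ‖coeff f k‖ + ∑ j, wt k ^ d * ‖coeff (partialDeriv j f) k‖ := by
          rw [mul_add, Finset.mul_sum]
      _ ≤ C * ∑ m ∈ Finset.range (d + 2), derivSeminorm n m f
          + ∑ _j : Fin n, C * ∑ m ∈ Finset.range (d + 2), derivSeminorm n m f :=
          add_le_add ((hC f k).trans (mul_le_mul_of_nonneg_left h2 hC0))
            (Finset.sum_le_sum fun j _ => (hC _ k).trans (mul_le_mul_of_nonneg_left (h3 j) hC0))
      _ = _ := by simp; ring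

theorem rapid_coeff (f : SmoothField n) : Rapid (coeff f) := fun d => by
  obtain ⟨C, _, hC⟩ := exists_wt_mul_norm_coeff_le (n := n) d
  exact ⟨_, hC f⟩

/-- Synthesis is a left inverse of taking Fourier coefficients. -/
theorem synth_coeff (f : SmoothField n) : synth (coeff f) = f := by
  funext x
  ext j
  have h := fourier_inversion (SmoothField.continuous_apply f j) (SmoothField.periodic_apply f j)
    (by simpa only [coeff_apply] using ((rapid_coeff f).summable_apply j).of_norm) x
  have h2 := (hermitian_coeff f).ofReal_synth x j
  simp only [coeff_apply] at h2
  exact_mod_cast h2.trans h.symm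

theorem coeff_injective : Function.Injective (coeff : SmoothField n → _) := fun f g h =>
  Subtype.ext (by rw [← synth_coeff f, ← synth_coeff g, h])

theorem Rapid.coeff_field {a : (Fin n → ℤ) → V n} (ha : Rapid a) (hh : Hermitian a) :
    coeff ha.field = a := ha.fourierVec_synth hh

/-! ### The topology in terms of coefficients -/

theorem exists_normW_coeff_le (d : ℕ) : ∃ C : ℝ, 0 ≤ C ∧ ∀ f : SmoothField n,
    normW d (coeff f) ≤ C * ∑ m ∈ Finset.range (d + (n + 1) + 1), derivSeminorm n m f := by
  obtain ⟨C, hC0, hC⟩ := exists_wt_mul_norm_coeff_le (n := n) (d + (n + 1))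
  refine ⟨C * ∑' k : Fin n → ℤ, (wt k)⁻¹ ^ (n + 1), mul_nonneg hC0
    (tsum_nonneg fun k => pow_nonneg (inv_nonneg.mpr (wt_pos k).le) _), fun f => ?_⟩
  exact (normW_le (hC f)).trans (le_of_eq (by ring))

theorem derivSeminorm_le_normW (m : ℕ) (f : SmoothField n) :
    derivSeminorm n m f ≤ normW m (coeff f) := by
  refine ciSup_le fun x => ?_
  have := (rapid_coeff f).norm_iteratedFDeriv_synth_le m x
  rwa [synth_coeff] at this

/-- Convergence of smooth fields is convergence in all weighted `l¹`-norms of the coefficients. -/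
theorem tendsto_iff_normW {ι : Type*} {l : Filter ι} {F : ι → SmoothField n} {f : SmoothField n} :
    Filter.Tendsto F l (𝓝 f) ↔
      ∀ d, Filter.Tendsto (fun i => normW d (coeff (F i - f))) l (𝓝 0) := by
  have hT : Filter.Tendsto F l (𝓝 f) ↔
      ∀ m, Filter.Tendsto (fun i => derivSeminorm n m (F i - f)) l (𝓝 0) := by
    rw [(withSeminorms n).tendsto_nhds]
    refine forall_congr' fun m => ?_
    rw [Metric.tendsto_nhds]
    refine forall₂_congr fun ε _ => Filter.eventually_congr (Filter.Eventually.of_forall fun i => ?_)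
    rw [Real.dist_eq, sub_zero, abs_of_nonneg (apply_nonneg _ _)]
  rw [hT]
  constructor
  · intro h d
    obtain ⟨C, -, hC⟩ := exists_normW_coeff_le (n := n) d
    refine squeeze_zero (fun i => normW_nonneg _ _) (fun i => hC _) ?_
    simpa using (tendsto_finsetSum _ fun m _ => h m).const_mul C
  · intro h m
    exact squeeze_zero (fun i => apply_nonneg _ _) (fun i => derivSeminorm_le_normW m _) (h m)

/-- Coefficientwise convergence together with uniform rapid decay is convergence of fields. -/
theorem tendsto_of_coeff {ι : Type*} {l : Filter ι} {F : ι → SmoothField n} {f : SmoothField n}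
    (h : ∀ k, Filter.Tendsto (fun i => coeff (F i) k) l (𝓝 (coeff f k)))
    (hb : ∀ d, ∃ C, ∀ᶠ i in l, ∀ k, wt k ^ d * ‖coeff (F i) k‖ ≤ C) :
    Filter.Tendsto F l (𝓝 f) := by
  rw [tendsto_iff_normW]
  intro d
  obtain ⟨C, hC⟩ := hb (d + (n + 1))
  obtain ⟨D, hD⟩ := rapid_coeff f (d + (n + 1))
  have h0 : (0 : ℝ) = ∑' k : Fin n → ℤ, 0 := by simp
  simp only [normW]
  rw [h0]
  refine tendsto_tsum_of_dominated_convergence (summable_wt_inv.mul_left (C + D)) (fun k => ?_) ?_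
  · have := ((h k).sub_const (coeff f k)).norm.const_mul (wt k ^ d)
    simpa using this
  · filter_upwards [hC] with i hi k
    rw [Real.norm_of_nonneg (mul_nonneg (pow_nonneg (wt_pos k).le _) (norm_nonneg _))]
    refine le_mul_wt_inv (le_trans ?_ (add_le_add (hi k) (hD k)))
    rw [← mul_add, map_sub, Pi.sub_apply]
    exact mul_le_mul_of_nonneg_left (norm_sub_le _ _) (pow_nonneg (wt_pos k).le _)

theorem tendsto_coeff {ι : Type*} {l : Filter ι} {F : ι → SmoothField n} {f : SmoothField n}
    (h : Filter.Tendsto F l (𝓝 f)) (k : Fin n → ℤ) :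
    Filter.Tendsto (fun i => coeff (F i) k) l (𝓝 (coeff f k)) := by
  rw [tendsto_iff_norm_sub_tendsto_zero]
  refine squeeze_zero (fun i => norm_nonneg _) (fun i => ?_) (tendsto_iff_normW.mp h 0)
  have := (rapid_coeff (F i - f)).norm_le_normW k
  rwa [map_sub] at this ⊢

theorem tendsto_normW {ι : Type*} {l : Filter ι} {F : ι → SmoothField n} {f : SmoothField n}
    (h : Filter.Tendsto F l (𝓝 f)) (d : ℕ) :
    Filter.Tendsto (fun i => normW d (coeff (F i))) l (𝓝 (normW d (coeff f))) := by
  rw [tendsto_iff_norm_sub_tendsto_zero]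
  refine squeeze_zero (fun i => norm_nonneg _) (fun i => ?_) (tendsto_iff_normW.mp h d)
  have h1 := normW_add_le (rapid_coeff (F i - f)) (rapid_coeff f) d
  have h2 := normW_add_le (rapid_coeff (f - F i)) (rapid_coeff (F i)) d
  have h3 : normW d (coeff (f - F i)) = normW d (coeff (F i - f)) := by
    simp only [normW, map_sub, Pi.sub_apply, norm_sub_rev]
  rw [← map_add, sub_add_cancel] at h1 h2
  rw [Real.norm_eq_abs, abs_le]
  constructor <;> linarith

theorem tendsto_eval {ι : Type*} {l : Filter ι} {F : ι → SmoothField n} {f : SmoothField n}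
    (h : Filter.Tendsto F l (𝓝 f)) (x : E n) : Filter.Tendsto (fun i => F i x) l (𝓝 (f x)) := by
  rw [tendsto_iff_norm_sub_tendsto_zero]
  refine squeeze_zero (fun i => norm_nonneg _) (fun i => ?_) (tendsto_iff_normW.mp h 0)
  have h1 := (le_derivSeminorm 0 (F i - f) x).trans (derivSeminorm_le_normW 0 _)
  rwa [norm_iteratedFDeriv_zero] at h1

/-! ### The Leray projector -/

/-- The bilinear pairing `k · c` of a frequency with a complex vector. -/
def dot (k : Fin n → ℤ) (c : V n) : ℂ := ∑ i, (k i : ℂ) * c i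

/-- A frequency as a complex vector. -/
def freqC (k : Fin n → ℤ) : V n := WithLp.toLp 2 fun i => (k i : ℂ)

theorem norm_freqC (k : Fin n → ℤ) : ‖freqC k‖ = ‖freq k‖ := by
  simp [EuclideanSpace.norm_eq, freqC]

theorem inner_freqC (k : Fin n → ℤ) (c : V n) : inner ℂ (freqC k) c = dot k c := by
  simp [PiLp.inner_apply, freqC, dot, mul_comm]

theorem norm_dot_le (k : Fin n → ℤ) (c : V n) : ‖dot k c‖ ≤ ‖freq k‖ * ‖c‖ := by
  rw [← inner_freqC, ← norm_freqC]
  exact norm_inner_le_norm _ _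

theorem dot_sub_left (k l : Fin n → ℤ) (c : V n) : dot (k - l) c = dot k c - dot l c := by
  simp [dot, sub_mul]

theorem dot_neg_left (k : Fin n → ℤ) (c : V n) : dot (-k) c = -dot k c := by simp [dot]

/-- The symbol of the Leray projector as an orthogonal projection of `ℂⁿ`. For `k = 0` the spanned
line degenerates to `0`, and the projection is the identity, as it should be. -/
def lerayOp (k : Fin n → ℤ) : V n →L[ℂ] V n := (Submodule.span ℂ {freqC k})ᗮ.starProjection

theorem lerayOp_eq (k : Fin n → ℤ) (z : V n) :
    lerayOp k z = z - (dot k z / ((‖freq k‖ ^ 2 : ℝ) : ℂ)) • freqC k := by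
  rw [lerayOp, Submodule.starProjection_orthogonal_val, Submodule.starProjection_singleton,
    inner_freqC, norm_freqC]
  rfl

theorem lerayOp_apply (k : Fin n → ℤ) (z : V n) (j : Fin n) :
    lerayOp k z j = (leraySymbol k).mulVec z j := by
  rw [lerayOp_eq]
  by_cases hk : k = 0
  · simp [hk, leraySymbol]
  · have h0 : ((‖freq k‖ : ℝ) : ℂ) ≠ 0 := by exact_mod_cast norm_freq_ne_zero hk
    simp only [leraySymbol, hk, if_false, Matrix.mulVec, dotProduct, Matrix.of_apply,
      PiLp.sub_apply, PiLp.smul_apply, freqC, smul_eq_mul, dot]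
    have : ∀ i, ((if j = i then (‖freq k‖ : ℂ) ^ 2 else 0) - (k j : ℂ) * (k i : ℂ))
        / (‖freq k‖ : ℂ) ^ 2 * z i
        = (if j = i then z i else 0) - (k i * z i) * (k j / (‖freq k‖ : ℂ) ^ 2) := by
      intro i
      split_ifs <;> field_simp
      ring
    simp only [this, Finset.sum_sub_distrib, ← Finset.sum_mul, Finset.sum_ite_eq,
      Finset.mem_univ, if_true]
    push_cast
    ring

theorem norm_lerayOp_le (k : Fin n → ℤ) (z : V n) : ‖lerayOp k z‖ ≤ ‖z‖ :=
  Submodule.norm_starProjection_apply_le _ z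

/-- The Leray symbol is self-adjoint, so a transport by a constant real velocity does not change
the norm of a mode. -/
theorem re_inner_I_smul_lerayOp (k : Fin n → ℤ) (z : V n) (r : ℝ) :
    (inner ℂ z ((Complex.I * r) • lerayOp k z)).re = 0 := by
  have h : (starRingEnd ℂ) (inner ℂ z (lerayOp k z)) = inner ℂ z (lerayOp k z) := by
    rw [inner_conj_symm, lerayOp, Submodule.inner_starProjection_left_eq_right]
  have h2 := Complex.conj_eq_iff_im.mp h
  rw [inner_smul_right]
  simp [h2]

theorem conj_lerayOp (k : Fin n → ℤ) {z w : V n} (h : ∀ j, w j = (starRingEnd ℂ) (z j))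
    (j : Fin n) : lerayOp (-k) w j = (starRingEnd ℂ) (lerayOp k z j) := by
  have hd : dot k w = (starRingEnd ℂ) (dot k z) := by simp [dot, h]
  simp only [lerayOp_eq, PiLp.sub_apply, PiLp.smul_apply, smul_eq_mul, map_sub, map_mul, map_div₀,
    dot_neg_left, freq_neg, norm_neg, hd, h, Complex.conj_ofReal, freqC, Pi.neg_apply,
    Int.cast_neg, map_intCast]
  ring

theorem rapid_lerayOp (f : SmoothField n) : Rapid fun k => lerayOp k (coeff f k) :=
  (rapid_coeff f).of_le (m := 0) fun k => by simpa using norm_lerayOp_le k (coeff f k)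

theorem coeff_field_lerayOp (f : SmoothField n) :
    coeff (rapid_lerayOp f).field = fun k => lerayOp k (coeff f k) :=
  (rapid_lerayOp f).coeff_field fun k j => conj_lerayOp k (hermitian_coeff f k) j

/-- The Leray projector as a linear map on smooth fields. -/
def lerayField : SmoothField n →ₗ[ℝ] SmoothField n where
  toFun f := (rapid_lerayOp f).field
  map_add' f g := coeff_injective ((coeff_field_lerayOp (f + g)).trans (by
    rw [map_add coeff (rapid_lerayOp f).field, coeff_field_lerayOp, coeff_field_lerayOp]
    funext k
    simp))
  map_smul' c f := coeff_injective ((coeff_field_lerayOp (c • f)).trans (by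
    rw [RingHom.id_apply, map_smul coeff c (rapid_lerayOp f).field, coeff_field_lerayOp]
    funext k
    rw [map_smul, Pi.smul_apply, Pi.smul_apply]
    exact (lerayOp k).map_smul_of_tower c _))

theorem coeff_lerayField (f : SmoothField n) (k : Fin n → ℤ) :
    coeff (lerayField f) k = lerayOp k (coeff f k) :=
  congrFun (coeff_field_lerayOp f) k

theorem lerayField_apply (f : SmoothField n) (x : E n) : lerayField f x = leray f x := by
  have : ∀ k j, lerayOp k (coeff f k) j = (leraySymbol k).mulVec (fourierVec f k) j :=
    fun k j => lerayOp_apply k _ j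
  change synth (fun k => lerayOp k (coeff f k)) x = _
  simp only [synth, leray, this]
  rfl

/-! ### The Laplacian -/

/-- The Laplacian on smooth fields. -/
def laplaceField (f : SmoothField n) : SmoothField n := ∑ j, partialDeriv j (partialDeriv j f)

theorem coeff_laplaceField (f : SmoothField n) (k : Fin n → ℤ) :
    coeff (laplaceField f) k = -((‖freq k‖ ^ 2 : ℝ) • coeff f k) := by
  rw [laplaceField, map_sum, Finset.sum_apply]
  simp only [coeff_partialDeriv, smul_smul]
  rw [← Finset.sum_smul]
  ext j
  have : ∑ i, Complex.I * (k i : ℂ) * (Complex.I * (k i : ℂ)) = -((‖freq k‖ ^ 2 : ℝ) : ℂ) := by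
    rw [EuclideanSpace.real_norm_sq_eq]
    push_cast
    rw [← Finset.sum_neg_distrib]
    refine Finset.sum_congr rfl fun i _ => ?_
    rw [freq_apply, Complex.ofReal_intCast]
    linear_combination (k i : ℂ) ^ 2 * Complex.I_mul_I
  rw [this]
  simp

theorem laplaceField_apply (f : SmoothField n) (x : E n) :
    laplaceField f x = (Δ (f : E n → E n)) x := by
  rw [InnerProductSpace.laplacian_eq_iteratedFDeriv_orthonormalBasis _
    (EuclideanSpace.basisFun (Fin n) ℝ)]
  have h1 : laplaceField f x = ∑ j, partialDeriv j (partialDeriv j f) x := by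
    rw [laplaceField, Submodule.coe_sum, Finset.sum_apply]
  rw [h1]
  refine Finset.sum_congr rfl fun j _ => ?_
  have hd : DifferentiableAt ℝ (fderiv ℝ f) x :=
    (f.2.1.fderiv_right (m := ∞) (by simp)).differentiable (by simp) x
  rw [iteratedFDeriv_two_apply]
  simp only [partialDeriv]
  rw [fderiv_clm_apply hd (differentiableAt_const _)]
  simp

theorem normW_laplaceField_le (d : ℕ) (f : SmoothField n) :
    normW d (coeff (laplaceField f)) ≤ normW (d + 2) (coeff f) := by
  refine ((rapid_coeff _).summable d).tsum_le_tsum (fun k => ?_) ((rapid_coeff f).summable _)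
  rw [coeff_laplaceField, norm_neg, norm_smul, pow_add, mul_assoc, Real.norm_of_nonneg (sq_nonneg _)]
  have := wt_pos k
  have := norm_freq_le_wt k
  gcongr

/-! ### Convolutions on the frequency lattice -/

/-- The shear `(k, l) ↦ (k - l, l)`, which turns convolutions into products. -/
def shear : (Fin n → ℤ) × (Fin n → ℤ) ≃ (Fin n → ℤ) × (Fin n → ℤ) where
  toFun p := (p.1 - p.2, p.2)
  invFun p := (p.1 + p.2, p.2)
  left_inv p := by simp
  right_inv p := by simp

theorem shear_apply (p : (Fin n → ℤ) × (Fin n → ℤ)) : shear p = (p.1 - p.2, p.2) := rfl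

theorem summable_conv {F G : (Fin n → ℤ) → ℝ} (hF : Summable F) (hG : Summable G) :
    Summable fun p : (Fin n → ℤ) × (Fin n → ℤ) => F (p.1 - p.2) * G p.2 := by
  have h : Summable fun p : (Fin n → ℤ) × (Fin n → ℤ) => F p.1 * G p.2 :=
    summable_mul_of_summable_norm hF.norm hG.norm
  have h2 := shear.summable_iff.mpr h
  simpa only [Function.comp_def, shear_apply] using h2

theorem tsum_conv {F G : (Fin n → ℤ) → ℝ} (hF : Summable F) (hG : Summable G) :
    ∑' k, ∑' l, F (k - l) * G l = (∑' k, F k) * ∑' l, G l := by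
  rw [← (summable_conv hF hG).tsum_prod,
    tsum_mul_tsum_of_summable_norm hF.norm hG.norm]
  exact shear.tsum_eq (fun p => F p.1 * G p.2)

theorem summable_conv_left {F G : (Fin n → ℤ) → ℝ} (hF : Summable F) (hG : Summable G)
    (k : Fin n → ℤ) : Summable fun l => F (k - l) * G l :=
  (summable_conv hF hG).prod_factor k

/-! ### The advection term -/

/-- The coefficients `∑_l i (l · c_{k-l}) b_l` of `v · ∇u`, where `c` and `b` are those of `v`
and `u`. -/
def advCoeff (c b : (Fin n → ℤ) → V n) (k : Fin n → ℤ) : V n :=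
  ∑' l, (Complex.I * dot l (c (k - l))) • b l

theorem norm_advTerm_le (c b : (Fin n → ℤ) → V n) (k l : Fin n → ℤ) :
    ‖(Complex.I * dot l (c (k - l))) • b l‖ ≤ ‖c (k - l)‖ * (wt l * ‖b l‖) := by
  rw [norm_smul, norm_mul, Complex.norm_I, one_mul]
  calc _ ≤ ‖freq l‖ * ‖c (k - l)‖ * ‖b l‖ :=
        mul_le_mul_of_nonneg_right (norm_dot_le _ _) (norm_nonneg _)
    _ ≤ wt l * ‖c (k - l)‖ * ‖b l‖ := by have := norm_freq_le_wt l; gcongr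
    _ = _ := by ring

theorem wt_mul_norm_advTerm_le (d : ℕ) (c b : (Fin n → ℤ) → V n) (k l : Fin n → ℤ) :
    wt k ^ d * ‖(Complex.I * dot l (c (k - l))) • b l‖
      ≤ (wt (k - l) ^ d * ‖c (k - l)‖) * (wt l ^ (d + 1) * ‖b l‖) := by
  have h1 : wt k ^ d ≤ wt (k - l) ^ d * wt l ^ d := by
    rw [← mul_pow]; exact pow_le_pow_left₀ (wt_pos k).le (wt_le_mul k l) d
  have := wt_pos (k - l)
  have := wt_pos l
  calc _ ≤ (wt (k - l) ^ d * wt l ^ d) * (‖c (k - l)‖ * (wt l * ‖b l‖)) :=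
        mul_le_mul h1 (norm_advTerm_le c b k l) (norm_nonneg _) (by positivity)
    _ = _ := by ring

theorem wt_norm_nonneg (d : ℕ) (a : (Fin n → ℤ) → V n) (k : Fin n → ℤ) : 0 ≤ wt k ^ d * ‖a k‖ :=
  mul_nonneg (pow_nonneg (wt_pos k).le _) (norm_nonneg _)

theorem summable_advTerm {c b : (Fin n → ℤ) → V n} (hc : Rapid c) (hb : Rapid b)
    (k : Fin n → ℤ) : Summable fun l => (Complex.I * dot l (c (k - l))) • b l := by
  refine Summable.of_norm_bounded (summable_conv_left
    (hc.summable 0) (hb.summable 1) k) fun l => ?_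
  simpa using wt_mul_norm_advTerm_le 0 c b k l

theorem wt_mul_norm_advCoeff_le {c b : (Fin n → ℤ) → V n} (hc : Rapid c) (hb : Rapid b) (d : ℕ)
    (k : Fin n → ℤ) : wt k ^ d * ‖advCoeff c b k‖
      ≤ ∑' l, (wt (k - l) ^ d * ‖c (k - l)‖) * (wt l ^ (d + 1) * ‖b l‖) := by
  have hs := summable_conv_left (hc.summable d) (hb.summable (d + 1)) k
  have hn := (summable_advTerm hc hb k).norm
  calc _ ≤ wt k ^ d * ∑' l, ‖(Complex.I * dot l (c (k - l))) • b l‖ :=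
        mul_le_mul_of_nonneg_left (norm_tsum_le_tsum_norm hn) (pow_nonneg (wt_pos k).le _)
    _ = ∑' l, wt k ^ d * ‖(Complex.I * dot l (c (k - l))) • b l‖ := tsum_mul_left.symm
    _ ≤ _ := (hn.mul_left _).tsum_le_tsum (fun l => wt_mul_norm_advTerm_le d c b k l) hs

/-- The advection `v · ∇u` as a bilinear map on smooth fields. -/
def advectField : SmoothField n →ₗ[ℝ] SmoothField n →ₗ[ℝ] SmoothField n :=
  LinearMap.mk₂ ℝ
    (fun v u => ⟨advect v u, (u.2.1.fderiv_right (m := ∞) (by simp)).clm_apply v.2.1,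
      fun k x => by simp only [advect, fderiv_periodic, v.2.2 k x]⟩)
    (fun v w u => Subtype.ext (funext fun x => (fderiv ℝ u x).map_add (v x) (w x)))
    (fun c v u => Subtype.ext (funext fun x => (fderiv ℝ u x).map_smul c (v x)))
    (fun v u w => Subtype.ext (funext fun x => by
      change fderiv ℝ ((u : E n → E n) + (w : E n → E n)) x (v x) = _
      rw [fderiv_add (SmoothField.differentiable u x) (SmoothField.differentiable w x)]
      rfl))
    (fun c v u => Subtype.ext (funext fun x => by
      change fderiv ℝ (c • (u : E n → E n)) x (v x) = _
      rw [fderiv_const_smul (SmoothField.differentiable u x)]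
      rfl))

theorem advectField_apply (v u : SmoothField n) (x : E n) :
    advectField v u x = advect v u x := rfl

theorem fourierScalar_sum {ι : Type*} (s : Finset ι) {g : ι → E n → ℂ}
    (hg : ∀ i, Continuous (g i)) (k : Fin n → ℤ) :
    fourierScalar (fun x => ∑ i ∈ s, g i x) k = ∑ i ∈ s, fourierScalar (g i) k := by
  simp only [fourierScalar, Finset.sum_mul, ← Finset.mul_sum]
  rw [integral_finsetSum]
  exact fun i _ => integrableOn_cell ((hg i).mul (continuous_char _))

theorem coeff_advectField (v u : SmoothField n) (k : Fin n → ℤ) :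
    coeff (advectField v u) k = advCoeff (coeff v) (coeff u) k := by
  ext j
  have hexp : ∀ x, ((advectField v u x j : ℝ) : ℂ)
      = ∑ i, (v x i : ℂ) * (partialDeriv i u x j : ℂ) := by
    intro x
    have hv : v x = ∑ i, v x i • EuclideanSpace.single i (1 : ℝ) := by
      ext i; simp [Finset.sum_apply, Pi.single_apply]
    have : advectField v u x = ∑ i, v x i • partialDeriv i u x := by
      rw [advectField_apply, advect]
      conv_lhs => rw [hv]
      rw [map_sum]
      exact Finset.sum_congr rfl fun i _ => map_smul _ _ _
    rw [this]
    simp [Finset.sum_apply]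
  have hR := summable_advTerm (rapid_coeff v) (rapid_coeff u) k
  rw [coeff_apply]
  simp only [hexp]
  rw [fourierScalar_sum (g := fun i x => (v x i : ℂ) * (partialDeriv i u x j : ℂ)) Finset.univ
    fun i => (SmoothField.continuous_apply v i).mul
      (SmoothField.continuous_apply (partialDeriv i u) j)]
  have h1 : ∀ i, HasSum (fun l => coeff v (k - l) i * (Complex.I * l i * coeff u l j))
      (fourierScalar (fun x => (v x i : ℂ) * (partialDeriv i u x j : ℂ)) k) := by
    intro i
    have h := hasSum_fourierScalar_mul (SmoothField.continuous_apply v i)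
      (c := fun l => coeff (partialDeriv i u) l j) ((rapid_coeff (partialDeriv i u)).summable_apply j)
      (g := fun x => (partialDeriv i u x j : ℂ)) (fun x => by
        rw [← (hermitian_coeff (partialDeriv i u)).ofReal_synth, synth_coeff]) k
    simpa only [coeff_partialDeriv, coeff_apply, PiLp.smul_apply, smul_eq_mul] using h
  have h2 := hasSum_sum (s := Finset.univ) fun i _ => h1 i
  have h3 : advCoeff (coeff v) (coeff u) k j
      = ∑' l, ((Complex.I * dot l (coeff v (k - l))) • coeff u l) j :=
    (EuclideanSpace.proj (𝕜 := ℂ) j : V n →L[ℂ] ℂ).map_tsum hR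
  rw [h3, ← h2.tsum_eq]
  refine tsum_congr fun l => ?_
  simp only [PiLp.smul_apply, smul_eq_mul, dot, Finset.mul_sum, Finset.sum_mul]
  exact Finset.sum_congr rfl fun i _ => by ring

/-- The coefficients of a divergence-free field are orthogonal to their frequencies. -/
theorem dot_coeff_of_divergence {v : SmoothField n} (hv : ∀ x, divergence v x = 0)
    (k : Fin n → ℤ) : dot k (coeff v k) = 0 := by
  have h1 : ∀ x, ∑ i, (partialDeriv i v x i : ℂ) = 0 := by
    intro x
    have : ∑ i, partialDeriv i v x i = 0 := hv x
    exact_mod_cast this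
  have h2 := fourierScalar_sum Finset.univ
    (fun i => SmoothField.continuous_apply (partialDeriv i v) i) k
  simp only [h1, ← coeff_apply, coeff_partialDeriv, PiLp.smul_apply, smul_eq_mul, mul_assoc,
    ← Finset.mul_sum] at h2
  have h0 : fourierScalar (fun _ : E n => (0 : ℂ)) k = 0 := by simp [fourierScalar]
  rw [h0] at h2
  have h3 := h2.symm
  exact (mul_eq_zero.mp h3).resolve_left Complex.I_ne_zero

/-- The projected advection `P[v · ∇u]` as a bilinear map on smooth fields. -/
def transport : SmoothField n →ₗ[ℝ] SmoothField n →ₗ[ℝ] SmoothField n :=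
  advectField.compr₂ lerayField

theorem coeff_transport (v u : SmoothField n) (k : Fin n → ℤ) :
    coeff (transport v u) k = lerayOp k (advCoeff (coeff v) (coeff u) k) := by
  rw [transport, LinearMap.compr₂_apply, coeff_lerayField, coeff_advectField]

theorem transport_apply (v u : SmoothField n) (x : E n) :
    transport v u x = leray (advect v u) x := by
  rw [transport, LinearMap.compr₂_apply, lerayField_apply]
  rfl

theorem normW_transport_le (d : ℕ) (v u : SmoothField n) :
    normW d (coeff (transport v u)) ≤ normW d (coeff v) * normW (d + 1) (coeff u) := by
  have hv := rapid_coeff v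
  have hu := rapid_coeff u
  have hs := summable_conv (hv.summable d) (hu.summable (d + 1))
  rw [normW, normW, normW, ← tsum_conv (hv.summable d) (hu.summable (d + 1))]
  refine ((rapid_coeff _).summable d).tsum_le_tsum (fun k => ?_) hs.prod
  refine le_trans ?_ (wt_mul_norm_advCoeff_le hv hu d k)
  rw [coeff_transport]
  exact mul_le_mul_of_nonneg_left (norm_lerayOp_le _ _) (pow_nonneg (wt_pos k).le _)

theorem tendsto_transport {ι : Type*} {l : Filter ι} {F G : ι → SmoothField n}
    {f g : SmoothField n} (hF : Filter.Tendsto F l (𝓝 f)) (hG : Filter.Tendsto G l (𝓝 g)) :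
    Filter.Tendsto (fun i => transport (F i) (G i)) l (𝓝 (transport f g)) := by
  rw [tendsto_iff_normW]
  intro d
  have h1 := (tendsto_iff_normW.mp hF d).mul (tendsto_normW hG (d + 1))
  have h2 := (tendsto_iff_normW.mp hG (d + 1)).const_mul (normW d (coeff f))
  have h12 := h1.add h2
  rw [zero_mul, mul_zero, zero_add] at h12
  refine squeeze_zero (fun i => normW_nonneg _ _) (fun i => ?_) h12
  have h3 : transport (F i) (G i) - transport f g
      = transport (F i - f) (G i) + transport f (G i - g) := by
    simp only [map_sub, LinearMap.sub_apply]
    abel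
  rw [h3, map_add]
  exact (normW_add_le (rapid_coeff _) (rapid_coeff _) d).trans
    (add_le_add (normW_transport_le d _ _) (normW_transport_le d _ _))

theorem laplaceField_sub (f g : SmoothField n) :
    laplaceField (f - g) = laplaceField f - laplaceField g :=
  coeff_injective (by
    funext k
    simp only [map_sub, Pi.sub_apply, coeff_laplaceField, smul_sub]
    abel)

theorem laplaceField_smul (c : ℝ) (f : SmoothField n) :
    laplaceField (c • f) = c • laplaceField f :=
  coeff_injective (by
    funext k
    simp only [map_smul, Pi.smul_apply, coeff_laplaceField, smul_neg, smul_comm c])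

theorem tendsto_laplaceField {ι : Type*} {l : Filter ι} {F : ι → SmoothField n}
    {f : SmoothField n} (hF : Filter.Tendsto F l (𝓝 f)) :
    Filter.Tendsto (fun i => laplaceField (F i)) l (𝓝 (laplaceField f)) := by
  rw [tendsto_iff_normW]
  intro d
  refine squeeze_zero (fun i => normW_nonneg _ _) (fun i => ?_) (tendsto_iff_normW.mp hF (d + 2))
  rw [← laplaceField_sub]
  exact normW_laplaceField_le d _

/-! ### Regularity in time -/

theorem continuousOn_of_slope {f f' : ℝ → SmoothField n}
    (h : ∀ t ∈ Set.Ici (0 : ℝ), Filter.Tendsto (slope f t) (𝓝[Set.Ici 0 \ {t}] t) (𝓝 (f' t))) :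
    ContinuousOn f (Set.Ici 0) := by
  intro t ht
  rw [← continuousWithinAt_sdiff_self]
  have h1 : Filter.Tendsto (fun s => s - t) (𝓝[Set.Ici 0 \ {t}] t) (𝓝 0) := by
    have : Continuous fun s : ℝ => s - t := by fun_prop
    simpa using (this.tendsto t).mono_left nhdsWithin_le_nhds
  have h2 := (h1.smul (h t ht)).add_const (f t)
  simp only [zero_smul, zero_add] at h2
  refine h2.congr fun s => ?_
  have := sub_smul_slope f t s
  rw [this, vsub_eq_sub, sub_add_cancel]

theorem IsCr.continuousOn {r : ℕ} {f : ℝ → SmoothField n} (h : IsCr r f) :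
    ContinuousOn f (Set.Ici 0) := by
  cases r with
  | zero => exact h
  | succ r => obtain ⟨f', hf', -⟩ := h; exact continuousOn_of_slope hf'

theorem IsCr.of_succ {r : ℕ} {f : ℝ → SmoothField n} (h : IsCr (r + 1) f) : IsCr r f := by
  induction r generalizing f with
  | zero => exact h.continuousOn
  | succ r ih =>
    obtain ⟨f', hf', h'⟩ := h
    exact ⟨f', hf', ih h'⟩

theorem IsCr.of_le {r s : ℕ} {f : ℝ → SmoothField n} (h : IsCr s f) (hrs : r ≤ s) : IsCr r f := by
  induction hrs with
  | refl => exact h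
  | step _ ih => exact ih h.of_succ

theorem IsCr.add {r : ℕ} {f g : ℝ → SmoothField n} (hf : IsCr r f) (hg : IsCr r g) :
    IsCr r (fun t => f t + g t) := by
  induction r generalizing f g with
  | zero => exact ContinuousOn.add hf hg
  | succ r ih =>
    obtain ⟨f', hf', hf''⟩ := hf
    obtain ⟨g', hg', hg''⟩ := hg
    refine ⟨_, fun t ht => ?_, ih hf'' hg''⟩
    refine ((hf' t ht).add (hg' t ht)).congr fun s => ?_
    simp only [slope_def_module, ← smul_add]
    congr 1
    abel

theorem IsCr.const_smul {r : ℕ} {f : ℝ → SmoothField n} (hf : IsCr r f) (c : ℝ) :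
    IsCr r (fun t => c • f t) := by
  induction r generalizing f with
  | zero => exact ContinuousOn.const_smul hf c
  | succ r ih =>
    obtain ⟨f', hf', hf''⟩ := hf
    refine ⟨_, fun t ht => ?_, ih hf''⟩
    refine ((hf' t ht).const_smul c).congr fun s => ?_
    have : c • f s - c • f t = c • (f s - f t) := (smul_sub c (f s) (f t)).symm
    rw [slope_def_module, slope_def_module, this, smul_comm c]

theorem IsCr.laplaceField {r : ℕ} {f : ℝ → SmoothField n} (hf : IsCr r f) :
    IsCr r (fun t => laplaceField (f t)) := by
  induction r generalizing f with
  | zero => exact fun t ht => tendsto_laplaceField (hf t ht)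
  | succ r ih =>
    obtain ⟨f', hf', hf''⟩ := hf
    refine ⟨_, fun t ht => ?_, ih hf''⟩
    refine (tendsto_laplaceField (hf' t ht)).congr fun s => ?_
    simp only [slope_def_module, laplaceField_smul, laplaceField_sub]

/-- The product rule for the projected advection. -/
theorem IsCr.transport {r : ℕ} {f g : ℝ → SmoothField n} (hf : IsCr r f) (hg : IsCr r g) :
    IsCr r (fun t => transport (f t) (g t)) := by
  induction r generalizing f g with
  | zero => exact fun t ht => tendsto_transport (hf t ht) (hg t ht)
  | succ r ih =>
    have hf0 := hf.of_succ
    have hg0 := hg.of_succ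
    have hgc := hg.continuousOn
    obtain ⟨f', hf', hf''⟩ := hf
    obtain ⟨g', hg', hg''⟩ := hg
    refine ⟨_, fun t ht => ?_, (ih hf'' hg0).add (ih hf0 hg'')⟩
    have hgt : Filter.Tendsto g (𝓝[Set.Ici 0 \ {t}] t) (𝓝 (g t)) :=
      (hgc t ht).mono_left (nhdsWithin_mono _ Set.sdiff_subset)
    refine ((tendsto_transport (hf' t ht) hgt).add
      (tendsto_transport tendsto_const_nhds (hg' t ht))).congr fun s => ?_
    simp only [slope_def_module, map_smul, map_sub, LinearMap.smul_apply, LinearMap.sub_apply,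
      ← smul_add]
    congr 1
    abel

/-- The right-hand side `ν Δu + P[v · ∇u]` of the equation. -/
def rhs (ν : ℝ) (v u : SmoothField n) : SmoothField n := ν • laplaceField u + transport v u

theorem rhs_apply (ν : ℝ) (v u : SmoothField n) (x : E n) :
    rhs ν v u x = ν • (Δ (u : E n → E n)) x + leray (advect v u) x := by
  rw [← laplaceField_apply, ← transport_apply]
  rfl

theorem coeff_rhs (ν : ℝ) (v u : SmoothField n) (k : Fin n → ℤ) :
    coeff (rhs ν v u) k = -((ν * ‖freq k‖ ^ 2) • coeff u k)
      + lerayOp k (advCoeff (coeff v) (coeff u) k) := by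
  rw [rhs, map_add, Pi.add_apply, coeff_transport, map_smul, Pi.smul_apply, coeff_laplaceField,
    smul_neg, smul_smul]

theorem IsCr.rhs {r : ℕ} {v u : ℝ → SmoothField n} (hv : IsCr r v) (hu : IsCr r u) (ν : ℝ) :
    IsCr r (fun t => rhs ν (v t) (u t)) := (hu.laplaceField.const_smul ν).add (hv.transport hu)

/-- Differentiability in `C^∞(𝕋ⁿ)ⁿ` implies differentiability of each coefficient. -/
theorem hasDerivWithinAt_coeff {f : ℝ → SmoothField n} {f' : SmoothField n} {t : ℝ}
    (h : Filter.Tendsto (slope f t) (𝓝[Set.Ici 0 \ {t}] t) (𝓝 f')) (k : Fin n → ℤ) :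
    HasDerivWithinAt (fun s => coeff (f s) k) (coeff f' k) (Set.Ici 0) t := by
  rw [hasDerivWithinAt_iff_tendsto_slope]
  refine (tendsto_coeff h k).congr fun s => ?_
  simp only [slope_def_module, map_smul, map_sub, Pi.smul_apply, Pi.sub_apply]

theorem hasDerivWithinAt_eval {f : ℝ → SmoothField n} {f' : SmoothField n} {t : ℝ}
    (h : Filter.Tendsto (slope f t) (𝓝[Set.Ici 0 \ {t}] t) (𝓝 f')) (x : E n) :
    HasDerivWithinAt (fun s => f s x) (f' x) (Set.Ici 0) t := by
  rw [hasDerivWithinAt_iff_tendsto_slope]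
  refine (tendsto_eval h x).congr fun s => ?_
  simp only [slope_def_module]
  rfl

/-! ### Differential inequalities -/

theorem hasDerivWithinAt_integral_Icc {F : Type*} [NormedAddCommGroup F] [NormedSpace ℝ F]
    [CompleteSpace F] {T : ℝ} {h : ℝ → F} (hc : ContinuousOn h (Set.Icc 0 T)) {s : ℝ}
    (hs : s ∈ Set.Icc 0 T) :
    HasDerivWithinAt (fun s => ∫ x in (0 : ℝ)..s, h x) (h s) (Set.Icc 0 T) s := by
  have hT : 0 ≤ T := hs.1.trans hs.2
  have hext : Continuous (Set.IccExtend hT ((Set.Icc 0 T).domRestrict h)) :=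
    (continuousOn_iff_continuous_domRestrict.mp hc).Icc_extend'
  have heq : ∀ x ∈ Set.Icc 0 T, Set.IccExtend hT ((Set.Icc 0 T).domRestrict h) x = h x := fun x hx =>
    Set.IccExtend_of_mem hT _ hx
  have h1 := (hext.integral_hasStrictDerivAt 0 s).hasDerivAt.hasDerivWithinAt (s := Set.Icc 0 T)
  rw [heq s hs] at h1
  have h2 : ∀ x ∈ Set.Icc 0 T, ∫ y in (0 : ℝ)..x, h y
      = ∫ y in (0 : ℝ)..x, Set.IccExtend hT ((Set.Icc 0 T).domRestrict h) y := by
    intro x hx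
    refine intervalIntegral.integral_congr fun y hy => (heq y ?_).symm
    rw [Set.uIcc_of_le hx.1] at hy
    exact ⟨hy.1, hy.2.trans hx.2⟩
  exact h1.congr h2 (h2 s hs)

theorem hasDerivWithinAt_Ici_of_Icc {F : Type*} [NormedAddCommGroup F] [NormedSpace ℝ F]
    {T : ℝ} {f : ℝ → F} {f' : F} {s : ℝ} (hs : s ∈ Set.Ico 0 T)
    (h : HasDerivWithinAt f f' (Set.Icc 0 T) s) : HasDerivWithinAt f f' (Set.Ici s) s :=
  h.mono_of_mem_nhdsWithin (Icc_mem_nhdsGE_of_mem hs)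

/-- An energy inequality `⟨f, f'⟩ ≤ -μ |f|² + γ |f|` integrates to the bound
`|f(T)| ≤ |f(0)| + ∫ (-μ |f| + γ)`. The proof differentiates `√(|f|² + ε²)`, which is smooth also
where `f` vanishes, and lets `ε → 0`. -/
theorem norm_le_of_energy {H : Type*} [NormedAddCommGroup H] [InnerProductSpace ℝ H]
    {f f' : ℝ → H} {μ γ : ℝ → ℝ} {T : ℝ} (hT : 0 ≤ T)
    (hf : ∀ s ∈ Set.Icc 0 T, HasDerivWithinAt f (f' s) (Set.Icc 0 T) s)
    (hμ : ContinuousOn μ (Set.Icc 0 T)) (hγ : ContinuousOn γ (Set.Icc 0 T))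
    (hγ0 : ∀ s ∈ Set.Icc 0 T, 0 ≤ γ s)
    (he : ∀ s ∈ Set.Icc 0 T, inner ℝ (f s) (f' s) ≤ -μ s * ‖f s‖ ^ 2 + γ s * ‖f s‖) :
    ‖f T‖ ≤ ‖f 0‖ + ∫ s in (0 : ℝ)..T, (-μ s * ‖f s‖ + γ s) := by
  have hfc : ContinuousOn f (Set.Icc 0 T) := fun s hs => (hf s hs).continuousWithinAt
  have hc1 : ContinuousOn (fun s => -μ s * ‖f s‖ + γ s) (Set.Icc 0 T) :=
    (hμ.neg.mul hfc.norm).add hγ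
  have hc2 : ContinuousOn (fun s => |μ s|) (Set.Icc 0 T) := hμ.abs
  have hi1 : IntervalIntegrable (fun s => -μ s * ‖f s‖ + γ s) volume 0 T :=
    ContinuousOn.intervalIntegrable (by rwa [Set.uIcc_of_le hT])
  have hi2 : IntervalIntegrable (fun s => |μ s|) volume 0 T :=
    ContinuousOn.intervalIntegrable (by rwa [Set.uIcc_of_le hT])
  -- the bound up to an error of order `ε`
  have key : ∀ ε : ℝ, 0 < ε → ‖f T‖ ≤ ‖f 0‖ + (∫ s in (0 : ℝ)..T, (-μ s * ‖f s‖ + γ s))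
      + ε * (1 + ∫ s in (0 : ℝ)..T, |μ s|) := by
    intro ε hε
    set R : ℝ → ℝ := fun s => Real.sqrt (‖f s‖ ^ 2 + ε ^ 2) with hR
    have hpos : ∀ s, 0 < ‖f s‖ ^ 2 + ε ^ 2 := fun s => by positivity
    have hRpos : ∀ s, 0 < R s := fun s => Real.sqrt_pos.mpr (hpos s)
    have hRsq : ∀ s, R s ^ 2 = ‖f s‖ ^ 2 + ε ^ 2 := fun s => Real.sq_sqrt (hpos s).le
    have hle1 : ∀ s, ‖f s‖ ≤ R s := fun s => by
      rw [hR]; exact Real.le_sqrt_of_sq_le (by nlinarith)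
    have hle2 : ∀ s, R s ≤ ‖f s‖ + ε := fun s => by
      refine Real.sqrt_le_iff.mpr ⟨by positivity, ?_⟩
      nlinarith [norm_nonneg (f s)]
    have hRd : ∀ s ∈ Set.Icc 0 T, HasDerivWithinAt R (inner ℝ (f s) (f' s) / R s)
        (Set.Icc 0 T) s := by
      intro s hs
      have h1 := (((hf s hs).norm_sq).add_const (ε ^ 2)).sqrt (hpos s).ne'
      convert! h1 using 1
      simp only [hR]
      field_simp
    have hB : ∀ s ∈ Set.Icc 0 T, HasDerivWithinAt
        (fun s => R 0 + ∫ x in (0 : ℝ)..s, ((-μ x * ‖f x‖ + γ x) + ε * |μ x|))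
        ((-μ s * ‖f s‖ + γ s) + ε * |μ s|) (Set.Icc 0 T) s := fun s hs =>
      (hasDerivWithinAt_integral_Icc (hc1.add (hc2.const_mul ε)) hs).const_add _
    have hmain := image_le_of_deriv_right_le_deriv_boundary
      (fun s hs => (hRd s hs).continuousWithinAt)
      (fun s hs => hasDerivWithinAt_Ici_of_Icc hs (hRd s (Set.Ico_subset_Icc_self hs)))
      (B := fun s => R 0 + ∫ x in (0 : ℝ)..s, ((-μ x * ‖f x‖ + γ x) + ε * |μ x|))
      (by simp) (fun s hs => (hB s hs).continuousWithinAt)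
      (fun s hs => hasDerivWithinAt_Ici_of_Icc hs (hB s (Set.Ico_subset_Icc_self hs)))
      (fun s hs => by
        have hs' := Set.Ico_subset_Icc_self hs
        rw [div_le_iff₀ (hRpos s)]
        refine (he s hs').trans ?_
        have h1 := hle1 s
        have h2 := hle2 s
        have h3 := hγ0 s hs'
        have h4 := norm_nonneg (f s)
        have h5 : μ s * (‖f s‖ * (R s - ‖f s‖)) ≤ |μ s| * (R s * ε) := by
          refine mul_le_mul (le_abs_self _) ?_ (mul_nonneg h4 (by linarith)) (abs_nonneg _)
          exact mul_le_mul h1 (by linarith) (by linarith) (hRpos s).le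
        have h6 := mul_le_mul_of_nonneg_left h1 h3
        nlinarith) (Set.right_mem_Icc.mpr hT)
    rw [intervalIntegral.integral_add hi1 (hi2.const_mul ε),
      intervalIntegral.integral_const_mul] at hmain
    have := hle1 T
    have := hle2 0
    linarith
  refine le_of_forall_pos_le_add fun δ hδ => ?_
  have hM : 0 < 1 + ∫ s in (0 : ℝ)..T, |μ s| := by
    have := intervalIntegral.integral_nonneg hT (fun s _ => abs_nonneg (μ s))
      (μ := volume) (f := fun s => |μ s|)
    linarith
  have := key (δ / (1 + ∫ s in (0 : ℝ)..T, |μ s|)) (by positivity)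
  rwa [div_mul_cancel₀ _ hM.ne'] at this

/-! ### Homogeneous norms of families of coefficients -/

/-- The summands `|k|^d |a_k|` of `‖·‖_{A,d}`, set to zero at the frequency `0`. -/
def termA (d : ℕ) (a : (Fin n → ℤ) → V n) (k : Fin n → ℤ) : ℝ :=
  if k = 0 then 0 else ‖freq k‖ ^ d * ‖a k‖

/-- The norm `‖·‖_{A,d}` on families of coefficients. -/
def seqA (d : ℕ) (a : (Fin n → ℤ) → V n) : ℝ := ∑' k, termA d a k

theorem termA_zero (d : ℕ) (a : (Fin n → ℤ) → V n) : termA d a 0 = 0 := if_pos rfl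

theorem termA_of_ne (d : ℕ) (a : (Fin n → ℤ) → V n) {k : Fin n → ℤ} (hk : k ≠ 0) :
    termA d a k = ‖freq k‖ ^ d * ‖a k‖ := if_neg hk

theorem termA_nonneg (d : ℕ) (a : (Fin n → ℤ) → V n) (k : Fin n → ℤ) : 0 ≤ termA d a k := by
  unfold termA; split_ifs <;> positivity

theorem termA_le (d : ℕ) (a : (Fin n → ℤ) → V n) (k : Fin n → ℤ) :
    termA d a k ≤ wt k ^ d * ‖a k‖ := by
  unfold termA
  have := wt_pos k
  split_ifs
  · positivity
  · have := norm_freq_le_wt k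
    gcongr

theorem seqA_nonneg (d : ℕ) (a : (Fin n → ℤ) → V n) : 0 ≤ seqA d a :=
  tsum_nonneg (termA_nonneg d a)

theorem Rapid.summable_termA {a : (Fin n → ℤ) → V n} (ha : Rapid a) (d : ℕ) :
    Summable (termA d a) :=
  (ha.summable d).of_nonneg_of_le (termA_nonneg d a) (termA_le d a)

theorem normA_eq (d : ℕ) (f : SmoothField n) : normA d f = seqA d (coeff f) := by
  refine (tsum_subtype {k : Fin n → ℤ | k ≠ 0}
    fun k => ‖freq k‖ ^ d * ‖fourierVec f k‖).trans (tsum_congr fun k => ?_)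
  by_cases hk : k = 0 <;> simp [termA, hk, coeff_def]

/-! ### The production term -/

/-- The rate `∑_{l ≠ k} |c_{k-l}| |l| |a_l|` at which advection feeds the mode `k`. The term `l = k`
is absent: transport by the mean velocity does not change the modulus of a mode. -/
def production (c a : (Fin n → ℤ) → V n) (k : Fin n → ℤ) : ℝ :=
  ∑' l, termA 0 c (k - l) * (‖freq l‖ * ‖a l‖)

theorem production_nonneg (c a : (Fin n → ℤ) → V n) (k : Fin n → ℤ) : 0 ≤ production c a k :=
  tsum_nonneg fun l => mul_nonneg (termA_nonneg _ _ _) (by positivity)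

theorem summable_production {c a : (Fin n → ℤ) → V n} (hc : Rapid c) (ha : Rapid a)
    (k : Fin n → ℤ) : Summable fun l => termA 0 c (k - l) * (‖freq l‖ * ‖a l‖) :=
  summable_conv_left (F := termA 0 c) (G := fun l => ‖freq l‖ * ‖a l‖) (hc.summable_termA 0)
    (by simpa using ha.summable_freq 1) k

/-- Advection increases `|a_k|` at most at the rate `production c a k`. The term `l = k` of the
convolution is `i (k · c_0) a_k`, where `k · c_0` is real, and drops out because the Leray symbol is
self-adjoint. -/
theorem re_inner_lerayOp_advCoeff_le {c a : (Fin n → ℤ) → V n} (hc : Rapid c) (ha : Rapid a)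
    (hh : Hermitian c) (k : Fin n → ℤ) :
    (inner ℂ (a k) (lerayOp k (advCoeff c a k))).re ≤ production c a k * ‖a k‖ := by
  have hs := summable_advTerm hc ha k
  obtain ⟨r, hr⟩ : ∃ r : ℝ, dot k (c 0) = r := by
    refine ⟨∑ i, (k i : ℝ) * (c 0 i).re, ?_⟩
    have : ∀ i, c 0 i = ((c 0 i).re : ℂ) := fun i => by
      have := hh 0 i
      rw [neg_zero] at this
      exact (Complex.conj_eq_iff_re.mp this.symm).symm
    rw [dot]
    push_cast
    exact Finset.sum_congr rfl fun i _ => by rw [← this i]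
  set rest : V n := ∑' l, if l = k then 0 else (Complex.I * dot l (c (k - l))) • a l with hrest
  have h1 : advCoeff c a k = (Complex.I * r) • a k + rest := by
    rw [advCoeff, hs.tsum_eq_add_tsum_ite k, sub_self, hr]
  have h2 : ‖rest‖ ≤ production c a k := by
    refine tsum_of_norm_bounded (summable_production hc ha k).hasSum fun l => ?_
    by_cases hl : l = k
    · simp [hl, termA_zero]
    · rw [if_neg hl, termA_of_ne _ _ (sub_ne_zero.mpr (Ne.symm hl)), norm_smul, norm_mul,
        Complex.norm_I, one_mul, pow_zero, one_mul]
      calc _ ≤ (‖freq l‖ * ‖c (k - l)‖) * ‖a l‖ :=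
            mul_le_mul_of_nonneg_right (norm_dot_le _ _) (norm_nonneg _)
        _ = _ := by ring
  rw [h1, map_add, map_smul, inner_add_right, Complex.add_re, re_inner_I_smul_lerayOp, zero_add]
  calc _ ≤ ‖a k‖ * ‖lerayOp k rest‖ := re_inner_le_norm (𝕜 := ℂ) _ _
    _ ≤ ‖a k‖ * production c a k :=
        mul_le_mul_of_nonneg_left ((norm_lerayOp_le _ _).trans h2) (norm_nonneg _)
    _ = _ := mul_comm _ _

/-- The binomial theorem applied to `|k|^d ≤ (|k - l| + |l|)^d` distributes the `d` derivatives over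
the two factors of the convolution. -/
theorem norm_pow_mul_production_le (d : ℕ) {c a : (Fin n → ℤ) → V n} (hc : Rapid c) (ha : Rapid a)
    (k : Fin n → ℤ) : ‖freq k‖ ^ d * production c a k ≤
      ∑ j ∈ Finset.range (d + 1), (d.choose j : ℝ) *
        ∑' l, termA j c (k - l) * termA (d + 1 - j) a l := by
  have hs := fun j => summable_conv_left (hc.summable_termA j) (ha.summable_termA (d + 1 - j)) k
  have hR : ∑ j ∈ Finset.range (d + 1), (d.choose j : ℝ) *
        ∑' l, termA j c (k - l) * termA (d + 1 - j) a l
      = ∑' l, ∑ j ∈ Finset.range (d + 1), (d.choose j : ℝ) *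
        (termA j c (k - l) * termA (d + 1 - j) a l) := by
    rw [Summable.tsum_finsetSum fun j _ => (hs j).mul_left _]
    exact Finset.sum_congr rfl fun j _ => tsum_mul_left.symm
  rw [hR, production, ← tsum_mul_left]
  refine ((summable_production hc ha k).mul_left _).tsum_le_tsum (fun l => ?_)
    (summable_sum fun j _ => (hs j).mul_left _)
  by_cases hl : l = 0
  · simp [hl, termA_zero]
  by_cases hkl : k - l = 0
  · simp [hkl, termA_zero]
  have hk : ‖freq k‖ ≤ ‖freq (k - l)‖ + ‖freq l‖ := by
    rw [freq_sub]; simpa using norm_add_le (freq k - freq l) (freq l)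
  have hk' := pow_le_pow_left₀ (norm_nonneg _) hk d
  rw [add_pow] at hk'
  calc _ ≤ (∑ j ∈ Finset.range (d + 1), ‖freq (k - l)‖ ^ j * ‖freq l‖ ^ (d - j) * (d.choose j))
          * (termA 0 c (k - l) * (‖freq l‖ * ‖a l‖)) :=
        mul_le_mul_of_nonneg_right hk' (mul_nonneg (termA_nonneg _ _ _) (by positivity))
    _ = _ := by
        rw [Finset.sum_mul]
        refine Finset.sum_congr rfl fun j hj => ?_
        have : d + 1 - j = (d - j) + 1 := by have := Finset.mem_range.mp hj; omega
        rw [termA_of_ne _ _ hkl, termA_of_ne _ _ hkl, termA_of_ne _ _ hl, this]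
        ring

theorem sum_choose_split (d : ℕ) (X : ℕ → ℝ) :
    ∑ j ∈ Finset.range (d + 1), (d.choose j : ℝ) * X j
      = X 0 + d * X 1 + ∑ j ∈ Finset.Icc 2 d, (d.choose j : ℝ) * X j := by
  have hI : Finset.Icc 2 d = Finset.Ico 2 (d + 1) := by ext; simp
  rw [hI]
  rcases d with _ | e
  · simp
  · rw [Finset.range_eq_Ico, Finset.sum_eq_sum_Ico_succ_bot (by omega),
      Finset.sum_eq_sum_Ico_succ_bot (by omega)]
    simp [add_assoc]

/-- The summand of the balance of `‖a‖_{A,d}`: dissipation, damping at rate `β`, and production. -/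
def balance (ν β : ℝ) (d : ℕ) (c a : (Fin n → ℤ) → V n) (k : Fin n → ℤ) : ℝ :=
  if k = 0 then 0 else ‖freq k‖ ^ d * (-(ν * ‖freq k‖ ^ 2 + β) * ‖a k‖ + production c a k)

/-- Dissipation and damping absorb the production of `‖a‖_{A,d}`, except for the terms in which at
least two derivatives fall on the velocity. -/
theorem tsum_balance_le {ν β₀ : ℝ} (d : ℕ) {c a : (Fin n → ℤ) → V n} (hc : Rapid c)
    (ha : Rapid a) (hβ : ∀ l : Fin n → ℤ, l ≠ 0 → seqA 0 c * ‖freq l‖ ≤ ν * ‖freq l‖ ^ 2 + β₀) :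
    ∑' k, balance ν (β₀ + d * seqA 1 c) d c a k
      ≤ ∑ j ∈ Finset.Icc 2 d, (d.choose j : ℝ) * (seqA j c * seqA (d + 1 - j) a) := by
  set β := β₀ + d * seqA 1 c with hβd
  have hconv := fun j => summable_conv (hc.summable_termA j) (ha.summable_termA (d + 1 - j))
  have hcs : ∀ j, Summable fun k => ∑' l, termA j c (k - l) * termA (d + 1 - j) a l :=
    fun j => (hconv j).prod
  -- the contributions of dissipation and damping
  have hDs : Summable fun k : Fin n → ℤ => ν * termA (d + 2) a k + β * termA d a k :=
    ((ha.summable_termA _).mul_left _).add ((ha.summable_termA _).mul_left _)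
  have hPs : Summable fun k => ∑ j ∈ Finset.range (d + 1), (d.choose j : ℝ) *
      ∑' l, termA j c (k - l) * termA (d + 1 - j) a l :=
    summable_sum fun j _ => (hcs j).mul_left _
  -- the production summed over all output frequencies: each convolution factorizes
  have hP : ∑' k, ∑ j ∈ Finset.range (d + 1), (d.choose j : ℝ) *
      ∑' l, termA j c (k - l) * termA (d + 1 - j) a l
      = ∑ j ∈ Finset.range (d + 1), (d.choose j : ℝ) * (seqA j c * seqA (d + 1 - j) a) := by
    rw [Summable.tsum_finsetSum fun j _ => (hcs j).mul_left _]
    refine Finset.sum_congr rfl fun j _ => ?_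
    rw [tsum_mul_left, tsum_conv (hc.summable_termA j) (ha.summable_termA (d + 1 - j))]
    rfl
  have hle : ∀ k, balance ν β d c a k ≤ (∑ j ∈ Finset.range (d + 1), (d.choose j : ℝ) *
      ∑' l, termA j c (k - l) * termA (d + 1 - j) a l)
      - (ν * termA (d + 2) a k + β * termA d a k) := by
    intro k
    have h1 := norm_pow_mul_production_le d hc ha k
    by_cases hk : k = 0
    · simp only [balance, hk, if_true, termA_zero, mul_zero, add_zero, sub_zero]
      exact Finset.sum_nonneg fun j _ => mul_nonneg (Nat.cast_nonneg _)
        (tsum_nonneg fun l => mul_nonneg (termA_nonneg _ _ _) (termA_nonneg _ _ _))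
    · simp only [balance, hk, if_false, termA_of_ne _ _ hk]
      linarith [show ‖freq k‖ ^ d * (-(ν * ‖freq k‖ ^ 2 + β) * ‖a k‖ + production c a k)
        = ‖freq k‖ ^ d * production c a k - (ν * (‖freq k‖ ^ (d + 2) * ‖a k‖)
          + β * (‖freq k‖ ^ d * ‖a k‖)) by ring]
  have hbs : Summable (balance ν β d c a) := by
    have hge : ∀ k, -(ν * termA (d + 2) a k + β * termA d a k) ≤ balance ν β d c a k := by
      intro k
      by_cases hk : k = 0
      · simp [balance, hk, termA_zero]
      · simp only [balance, hk, if_false, termA_of_ne _ _ hk]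
        have := mul_nonneg (pow_nonneg (norm_nonneg (freq k)) d) (production_nonneg c a k)
        linarith [show ‖freq k‖ ^ d * (-(ν * ‖freq k‖ ^ 2 + β) * ‖a k‖ + production c a k)
          = ‖freq k‖ ^ d * production c a k - (ν * (‖freq k‖ ^ (d + 2) * ‖a k‖)
            + β * (‖freq k‖ ^ d * ‖a k‖)) by ring]
    refine Summable.of_norm_bounded (hPs.abs.add hDs.abs) fun k => ?_
    rw [Real.norm_eq_abs, abs_le]
    have h1 := hle k
    have h2 := hge k
    have h3 := le_abs_self (∑ j ∈ Finset.range (d + 1), (d.choose j : ℝ) *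
      ∑' l, termA j c (k - l) * termA (d + 1 - j) a l)
    have h4 := abs_nonneg (∑ j ∈ Finset.range (d + 1), (d.choose j : ℝ) *
      ∑' l, termA j c (k - l) * termA (d + 1 - j) a l)
    have h5 := le_abs_self (ν * termA (d + 2) a k + β * termA d a k)
    have h6 := neg_abs_le (ν * termA (d + 2) a k + β * termA d a k)
    constructor <;> linarith
  have hsum := hbs.tsum_le_tsum hle (hPs.sub hDs)
  rw [hPs.tsum_sub hDs, hP, sum_choose_split d fun j => seqA j c * seqA (d + 1 - j) a] at hsum
  -- `hβ`, multiplied by `|k|^d |a_k|` and summed, takes care of the production with `j = 0`; the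
  -- remainder `d ‖c‖_{A,1}` of the damping rate cancels that with `j = 1`
  have habs : seqA 0 c * seqA (d + 1) a + d * (seqA 1 c * seqA d a)
      ≤ ∑' k, (ν * termA (d + 2) a k + β * termA d a k) := by
    simp only [seqA]
    rw [← tsum_mul_left, ← tsum_mul_left, ← tsum_mul_left,
      ← ((ha.summable_termA _).mul_left _).tsum_add (((ha.summable_termA _).mul_left _).mul_left _)]
    refine (((ha.summable_termA _).mul_left _).add
      (((ha.summable_termA _).mul_left _).mul_left _)).tsum_le_tsum (fun k => ?_) hDs
    by_cases hk : k = 0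
    · simp [hk, termA_zero]
    · simp only [termA_of_ne _ _ hk]
      have h1 := mul_le_mul_of_nonneg_right (hβ k hk)
        (mul_nonneg (pow_nonneg (norm_nonneg (freq k)) d) (norm_nonneg (a k)))
      rw [hβd]
      simp only [seqA] at h1 ⊢
      rw [pow_add, pow_add]
      linarith
  have h10 : d + 1 - 1 = d := rfl
  simp only [Nat.sub_zero, h10] at hsum
  linarith

/-! ### Curves of rapidly decreasing families -/

/-- Continuous curves of families of coefficients that decay rapidly, uniformly on `[0, T]`. -/
structure RapidOn (T : ℝ) (a : ℝ → (Fin n → ℤ) → V n) : Prop where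
  cont : ∀ k, ContinuousOn (fun s => a s k) (Set.Icc 0 T)
  bound : ∀ d, ∃ C, ∀ s ∈ Set.Icc 0 T, ∀ k, wt k ^ d * ‖a s k‖ ≤ C

theorem RapidOn.rapid {T : ℝ} {a : ℝ → (Fin n → ℤ) → V n} (ha : RapidOn T a) {s : ℝ}
    (hs : s ∈ Set.Icc 0 T) : Rapid (a s) := fun d => by
  obtain ⟨C, hC⟩ := ha.bound d
  exact ⟨C, hC s hs⟩

theorem RapidOn.exists_normW_le {T : ℝ} {a : ℝ → (Fin n → ℤ) → V n} (ha : RapidOn T a) (d : ℕ) :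
    ∃ C, ∀ s ∈ Set.Icc 0 T, normW d (a s) ≤ C := by
  obtain ⟨C, hC⟩ := ha.bound (d + (n + 1))
  exact ⟨_, fun s hs => normW_le (hC s hs)⟩

theorem RapidOn.continuousOn_termA {T : ℝ} {a : ℝ → (Fin n → ℤ) → V n} (ha : RapidOn T a) (d : ℕ)
    (k : Fin n → ℤ) : ContinuousOn (fun s => termA d (a s) k) (Set.Icc 0 T) := by
  unfold termA
  split_ifs
  · exact continuousOn_const
  · exact continuousOn_const.mul (ha.cont k).norm

theorem RapidOn.continuousOn_seqA {T : ℝ} {a : ℝ → (Fin n → ℤ) → V n} (ha : RapidOn T a) (d : ℕ) :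
    ContinuousOn (fun s => seqA d (a s)) (Set.Icc 0 T) := by
  obtain ⟨C, hC⟩ := ha.bound (d + (n + 1))
  refine continuousOn_tsum (fun k => ha.continuousOn_termA d k) (summable_wt_inv.mul_left C)
    fun k s hs => ?_
  rw [Real.norm_of_nonneg (termA_nonneg _ _ _)]
  exact (termA_le _ _ _).trans (le_mul_wt_inv (hC s hs k))

theorem tsum_conv_le {F G : (Fin n → ℤ) → ℝ} {C : ℝ} (hF0 : ∀ k, 0 ≤ F k) (hF : Summable F)
    (hG0 : ∀ k, 0 ≤ G k) (hG : ∀ k, G k ≤ C) (k : Fin n → ℤ) :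
    ∑' l, F (k - l) * G l ≤ (∑' l, F l) * C := by
  have hFk : Summable fun l => F (k - l) * C :=
    (hF.comp_injective (Equiv.subLeft k).injective).mul_right C
  have hle : ∀ l, F (k - l) * G l ≤ F (k - l) * C := fun l =>
    mul_le_mul_of_nonneg_left (hG l) (hF0 _)
  have hs : Summable fun l => F (k - l) * G l :=
    hFk.of_nonneg_of_le (fun l => mul_nonneg (hF0 _) (hG0 _)) hle
  refine (hs.tsum_le_tsum hle hFk).trans (le_of_eq ?_)
  rw [tsum_mul_right]
  congr 1
  exact (Equiv.subLeft k).tsum_eq F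

theorem wt_pow_mul_production_le (d : ℕ) {c a : (Fin n → ℤ) → V n} {C : ℝ} (hc : Rapid c)
    (ha : Rapid a) (hC : ∀ l, wt l ^ (d + 1) * ‖a l‖ ≤ C) (k : Fin n → ℤ) :
    wt k ^ d * production c a k ≤ normW d c * C := by
  refine le_trans ?_ (tsum_conv_le (wt_norm_nonneg d c) (hc.summable d)
    (wt_norm_nonneg (d + 1) a) hC k)
  rw [production, ← tsum_mul_left]
  refine ((summable_production hc ha k).mul_left _).tsum_le_tsum (fun l => ?_)
    (summable_conv_left (hc.summable d) (ha.summable (d + 1)) k)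
  have h1 : wt k ^ d ≤ wt (k - l) ^ d * wt l ^ d := by
    rw [← mul_pow]; exact pow_le_pow_left₀ (wt_pos k).le (wt_le_mul k l) d
  have h2 := termA_le 0 c (k - l)
  have h3 := norm_freq_le_wt l
  have h4 := wt_pos l
  have h5 := wt_pos (k - l)
  rw [pow_zero, one_mul] at h2
  calc _ ≤ (wt (k - l) ^ d * wt l ^ d) * (‖c (k - l)‖ * (wt l * ‖a l‖)) := by
        have := termA_nonneg 0 c (k - l)
        have := wt_pos k
        gcongr
    _ = _ := by ring

theorem RapidOn.continuousOn_production {T : ℝ} {c a : ℝ → (Fin n → ℤ) → V n} (hc : RapidOn T c)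
    (ha : RapidOn T a) (k : Fin n → ℤ) :
    ContinuousOn (fun s => production (c s) (a s) k) (Set.Icc 0 T) := by
  obtain ⟨C, hC⟩ := hc.bound 0
  obtain ⟨D, hD⟩ := ha.bound (1 + (n + 1))
  refine continuousOn_tsum (fun l => (hc.continuousOn_termA 0 (k - l)).mul
    (continuousOn_const.mul (ha.cont l).norm)) ((summable_wt_inv.mul_left D).mul_left C)
    fun l s hs => ?_
  have h1 := (termA_le 0 (c s) (k - l)).trans (hC s hs (k - l))
  have h2 := le_mul_wt_inv (hD s hs l)
  have h3 := norm_freq_le_wt l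
  have h4 := termA_nonneg 0 (c s) (k - l)
  rw [Real.norm_of_nonneg (mul_nonneg h4 (by positivity))]
  refine mul_le_mul h1 (le_trans ?_ h2) (by positivity) (h4.trans h1)
  rw [pow_one]
  gcongr

/-! ### The a priori estimate -/

/-- Countably many integral inequalities with dominated integrands may be summed under the integral
sign. -/
theorem tsum_le_of_integral {ι : Type*} [Countable ι] {T : ℝ} (hT : 0 ≤ T) {x₀ x₁ : ι → ℝ}
    {y : ι → ℝ → ℝ} {M : ι → ℝ} {Γ : ℝ → ℝ} (hx₀ : Summable x₀) (hx₁ : Summable x₁)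
    (hy : ∀ k, ContinuousOn (y k) (Set.Icc 0 T)) (hM : Summable M)
    (hyM : ∀ k, ∀ s ∈ Set.Icc 0 T, |y k s| ≤ M k) (hΓ : ContinuousOn Γ (Set.Icc 0 T))
    (hyΓ : ∀ s ∈ Set.Icc 0 T, ∑' k, y k s ≤ Γ s)
    (h : ∀ k, x₁ k ≤ x₀ k + ∫ s in (0 : ℝ)..T, y k s) :
    ∑' k, x₁ k ≤ ∑' k, x₀ k + ∫ s in (0 : ℝ)..T, Γ s := by
  have hmem : ∀ s ∈ Set.uIoc 0 T, s ∈ Set.Icc 0 T := fun s hs => by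
    rw [Set.uIoc_of_le hT] at hs
    exact Set.Ioc_subset_Icc_self hs
  have hyc : ContinuousOn (fun s => ∑' k, y k s) (Set.Icc 0 T) :=
    continuousOn_tsum hy hM hyM
  have hsum : HasSum (fun k => ∫ s in (0 : ℝ)..T, y k s) (∫ s in (0 : ℝ)..T, ∑' k, y k s) := by
    refine intervalIntegral.hasSum_integral_of_dominated_convergence (fun k _ => M k)
      (fun k => ?_) (fun k => ?_) ?_ ?_ ?_
    · exact ((hy k).mono hmem).aestronglyMeasurable measurableSet_uIoc
    · exact Filter.Eventually.of_forall fun s hs => hyM k s (hmem s hs)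
    · exact Filter.Eventually.of_forall fun s _ => hM
    · exact intervalIntegrable_const
    · refine Filter.Eventually.of_forall fun s hs => ?_
      exact (Summable.of_norm_bounded hM fun k => hyM k s (hmem s hs)).hasSum
  calc ∑' k, x₁ k ≤ ∑' k, (x₀ k + ∫ s in (0 : ℝ)..T, y k s) :=
        hx₁.tsum_le_tsum h (hx₀.add hsum.summable)
    _ = ∑' k, x₀ k + ∫ s in (0 : ℝ)..T, ∑' k, y k s := by
        rw [hx₀.tsum_add hsum.summable, hsum.tsum_eq]
    _ ≤ _ := by
        refine add_le_add le_rfl (intervalIntegral.integral_mono_on hT ?_ ?_ hyΓ)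
        · exact ContinuousOn.intervalIntegrable (by rwa [Set.uIcc_of_le hT])
        · exact ContinuousOn.intervalIntegrable (by rwa [Set.uIcc_of_le hT])

/-- The equation satisfied by the coefficients of a solution, on `[0, T]`. -/
def SolvesOn (ν T : ℝ) (c a : ℝ → (Fin n → ℤ) → V n) : Prop :=
  ∀ s ∈ Set.Icc 0 T, ∀ k, HasDerivWithinAt (fun s => a s k)
    (-((ν * ‖freq k‖ ^ 2) • a s k) + lerayOp k (advCoeff (c s) (a s) k)) (Set.Icc 0 T) s

theorem inner_real_eq_re (x y : V n) : inner ℝ x y = (inner ℂ x y).re := by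
  simp [PiLp.inner_apply, Complex.inner, mul_comm]

/-- The growth of a single mode, damped by the factor `e^{-∫β}`. -/
theorem norm_mode_le {ν T : ℝ} (hT : 0 ≤ T) {c a : ℝ → (Fin n → ℤ) → V n}
    (hc : RapidOn T c) (ha : RapidOn T a) (hh : ∀ s ∈ Set.Icc 0 T, Hermitian (c s))
    (hode : SolvesOn ν T c a) {β : ℝ → ℝ} (hβ : ContinuousOn β (Set.Icc 0 T)) (k : Fin n → ℤ) :
    Real.exp (-∫ x in (0 : ℝ)..T, β x) * ‖a T k‖ ≤ ‖a 0 k‖ +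
      ∫ s in (0 : ℝ)..T, Real.exp (-∫ x in (0 : ℝ)..s, β x) *
        (-(ν * ‖freq k‖ ^ 2 + β s) * ‖a s k‖ + production (c s) (a s) k) := by
  set w : ℝ → ℝ := fun s => Real.exp (-∫ x in (0 : ℝ)..s, β x) with hw
  have hwd : ∀ s ∈ Set.Icc 0 T, HasDerivWithinAt w (w s * -β s) (Set.Icc 0 T) s := fun s hs =>
    (hasDerivWithinAt_integral_Icc hβ hs).neg.exp
  have hwpos : ∀ s, 0 < w s := fun s => Real.exp_pos _
  have hwc : ContinuousOn w (Set.Icc 0 T) := fun s hs => (hwd s hs).continuousWithinAt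
  have key := norm_le_of_energy (H := V n) (f := fun s => w s • a s k)
    (μ := fun s => ν * ‖freq k‖ ^ 2 + β s) (γ := fun s => w s * production (c s) (a s) k) hT
    (fun s hs => (hwd s hs).smul (hode s hs k)) (continuousOn_const.add hβ)
    (hwc.mul (hc.continuousOn_production ha k))
    (fun s _ => mul_nonneg (hwpos s).le (production_nonneg _ _ _))
    (fun s hs => by
      have h1 := re_inner_lerayOp_advCoeff_le (hc.rapid hs) (ha.rapid hs) (hh s hs) k
      have h2 : inner ℝ (a s k) (lerayOp k (advCoeff (c s) (a s) k))
        = (inner ℂ (a s k) (lerayOp k (advCoeff (c s) (a s) k))).re :=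
        inner_real_eq_re _ _
      rw [← h2] at h1
      rw [inner_add_right, inner_smul_left, inner_smul_right, inner_smul_left, inner_smul_right,
        inner_add_right, inner_neg_right, inner_smul_right, real_inner_self_eq_norm_sq, norm_smul,
        Real.norm_of_nonneg (hwpos s).le]
      simp only [conj_trivial]
      have h3 := mul_le_mul_of_nonneg_left h1 (mul_nonneg (hwpos s).le (hwpos s).le)
      nlinarith)
  have hw0 : w 0 = 1 := by simp [hw]
  simp only [norm_smul, hw0, norm_one, one_mul, Real.norm_of_nonneg (hwpos _).le] at key
  refine key.trans (le_of_eq ?_)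
  congr 1
  refine intervalIntegral.integral_congr fun s _ => ?_
  ring

/-- The a priori estimate in `‖·‖_{A,d}`: if the dissipation dominates the lowest order part of the
production up to a rate `β₀`, then `‖a‖_{A,d}` grows at most at the rate `β₀ + d ‖c‖_{A,1}`, up to
the terms in which at least two derivatives fall on the velocity. -/
theorem seqA_le {ν T : ℝ} (hT : 0 ≤ T) {c a : ℝ → (Fin n → ℤ) → V n}
    (hc : RapidOn T c) (ha : RapidOn T a) (hh : ∀ s ∈ Set.Icc 0 T, Hermitian (c s))
    (hode : SolvesOn ν T c a) {β₀ : ℝ → ℝ} (hβ₀ : ContinuousOn β₀ (Set.Icc 0 T)) (d : ℕ)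
    (hβ : ∀ s ∈ Set.Icc 0 T, ∀ l : Fin n → ℤ, l ≠ 0 →
      seqA 0 (c s) * ‖freq l‖ ≤ ν * ‖freq l‖ ^ 2 + β₀ s) :
    seqA d (a T) ≤ Real.exp (∫ x in (0 : ℝ)..T, (β₀ x + d * seqA 1 (c x))) *
      (seqA d (a 0) + ∫ s in (0 : ℝ)..T,
        Real.exp (-∫ x in (0 : ℝ)..s, (β₀ x + d * seqA 1 (c x))) *
          ∑ j ∈ Finset.Icc 2 d, (d.choose j : ℝ) * (seqA j (c s) * seqA (d + 1 - j) (a s))) := by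
  set β : ℝ → ℝ := fun x => β₀ x + d * seqA 1 (c x) with hβd
  have hβc : ContinuousOn β (Set.Icc 0 T) :=
    hβ₀.add (continuousOn_const.mul (hc.continuousOn_seqA 1))
  set w : ℝ → ℝ := fun s => Real.exp (-∫ x in (0 : ℝ)..s, β x) with hw
  have hwpos : ∀ s, 0 < w s := fun s => Real.exp_pos _
  have hwc : ContinuousOn w (Set.Icc 0 T) := fun s hs =>
    (hasDerivWithinAt_integral_Icc hβc hs).neg.exp.continuousWithinAt
  have h0 : (0 : ℝ) ∈ Set.Icc 0 T := ⟨le_rfl, hT⟩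
  have h1 : T ∈ Set.Icc 0 T := ⟨hT, le_rfl⟩
  have hΓc : ContinuousOn (fun s => w s * ∑ j ∈ Finset.Icc 2 d,
      (d.choose j : ℝ) * (seqA j (c s) * seqA (d + 1 - j) (a s))) (Set.Icc 0 T) :=
    hwc.mul (continuousOn_finsetSum _ fun j _ => continuousOn_const.mul
      ((hc.continuousOn_seqA j).mul (ha.continuousOn_seqA _)))
  -- uniform bounds for the summands of the balance
  obtain ⟨Cβ, hCβ⟩ := isCompact_Icc.exists_bound_of_continuousOn hβc
  obtain ⟨Cw, hCw⟩ := isCompact_Icc.exists_bound_of_continuousOn hwc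
  obtain ⟨D₁, hD₁⟩ := ha.bound (d + 2 + (n + 1))
  obtain ⟨D₂, hD₂⟩ := ha.bound (d + (n + 1) + 1)
  obtain ⟨D₃, hD₃⟩ := hc.exists_normW_le (d + (n + 1))
  have hbound : ∀ k : Fin n → ℤ, ∀ s ∈ Set.Icc 0 T, |w s * balance ν (β s) d (c s) (a s) k|
      ≤ Cw * ((|ν| + Cβ) * D₁ + D₃ * D₂) * (wt k)⁻¹ ^ (n + 1) := by
    intro k s hs
    have hwt := wt_pos k
    have hwt1 := one_le_wt k
    have hCβ' := hCβ s hs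
    have hCw' := hCw s hs
    rw [Real.norm_eq_abs] at hCβ' hCw'
    have e1 : wt k ^ (d + 2) * ‖a s k‖ ≤ D₁ * (wt k)⁻¹ ^ (n + 1) := le_mul_wt_inv (hD₁ s hs k)
    have e2 : wt k ^ d * production (c s) (a s) k ≤ D₃ * D₂ * (wt k)⁻¹ ^ (n + 1) := by
      refine le_mul_wt_inv ((wt_pow_mul_production_le _ (hc.rapid hs) (ha.rapid hs)
        (hD₂ s hs) k).trans ?_)
      exact mul_le_mul_of_nonneg_right (hD₃ s hs)
        ((mul_nonneg (pow_nonneg hwt.le _) (norm_nonneg _)).trans (hD₂ s hs k))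
    have e3 : |balance ν (β s) d (c s) (a s) k|
        ≤ (|ν| + Cβ) * (wt k ^ (d + 2) * ‖a s k‖) + wt k ^ d * production (c s) (a s) k := by
      have hp := production_nonneg (c s) (a s) k
      have hCβ0 := (abs_nonneg _).trans hCβ'
      by_cases hk : k = 0
      · simp only [balance, hk, if_true, abs_zero]
        subst hk
        positivity
      · simp only [balance, hk, if_false]
        have hf := norm_freq_le_wt k
        rw [abs_mul, abs_of_nonneg (by positivity : 0 ≤ ‖freq k‖ ^ d)]
        have e4 : |-(ν * ‖freq k‖ ^ 2 + β s) * ‖a s k‖ + production (c s) (a s) k|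
            ≤ (|ν| + Cβ) * wt k ^ 2 * ‖a s k‖ + production (c s) (a s) k := by
          refine (abs_add_le _ _).trans ?_
          rw [abs_mul, abs_neg, abs_norm, abs_of_nonneg hp]
          have e5 : |ν * ‖freq k‖ ^ 2 + β s| ≤ (|ν| + Cβ) * wt k ^ 2 := by
            refine (abs_add_le _ _).trans ?_
            rw [abs_mul, abs_of_nonneg (sq_nonneg ‖freq k‖), add_mul]
            have e6 : |ν| * ‖freq k‖ ^ 2 ≤ |ν| * wt k ^ 2 := by gcongr
            have e7 : 1 ≤ wt k ^ 2 := one_le_pow₀ hwt1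
            nlinarith
          gcongr
        calc _ ≤ wt k ^ d * ((|ν| + Cβ) * wt k ^ 2 * ‖a s k‖ + production (c s) (a s) k) := by
              gcongr
          _ = _ := by ring
    rw [abs_mul, mul_assoc]
    refine mul_le_mul hCw' (e3.trans ?_) (abs_nonneg _) ((abs_nonneg _).trans hCw')
    rw [add_mul _ (D₃ * D₂), mul_assoc (|ν| + Cβ)]
    exact add_le_add (mul_le_mul_of_nonneg_left e1
      (add_nonneg (abs_nonneg _) ((abs_nonneg _).trans hCβ'))) e2
  -- the bounds for the single modes, multiplied by `|k|^d` and summed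
  have hmain := tsum_le_of_integral hT (x₀ := termA d (a 0)) (x₁ := fun k => w T * termA d (a T) k)
    (y := fun k s => w s * balance ν (β s) d (c s) (a s) k)
    (M := fun k => Cw * ((|ν| + Cβ) * D₁ + D₃ * D₂) * (wt k)⁻¹ ^ (n + 1))
    ((ha.rapid h0).summable_termA d) (((ha.rapid h1).summable_termA d).mul_left _)
    (fun k => by
      unfold balance
      split_ifs
      · simpa using continuousOn_const
      · exact hwc.mul (continuousOn_const.mul ((((continuousOn_const.add hβc).neg).mul
          (ha.cont k).norm).add (hc.continuousOn_production ha k))))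
    (summable_wt_inv.mul_left _) hbound hΓc
    (fun s hs => by
      rw [tsum_mul_left]
      exact mul_le_mul_of_nonneg_left
        (tsum_balance_le d (hc.rapid hs) (ha.rapid hs) (hβ s hs)) (hwpos s).le)
    (fun k => by
      by_cases hk : k = 0
      · simp [hk, termA_zero, balance]
      · have h2 := mul_le_mul_of_nonneg_left (norm_mode_le hT hc ha hh hode hβc k)
          (pow_nonneg (norm_nonneg (freq k)) d)
        simp only [termA_of_ne _ _ hk, balance, hk, if_false]
        rw [mul_add, ← intervalIntegral.integral_const_mul] at h2
        calc _ = ‖freq k‖ ^ d * (w T * ‖a T k‖) := by ring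
          _ ≤ _ := h2
          _ = _ := by
            congr 1
            refine intervalIntegral.integral_congr fun s _ => ?_
            simp only [hw]
            ring)
  rw [tsum_mul_left] at hmain
  have hwT : Real.exp (∫ x in (0 : ℝ)..T, β x) * w T = 1 := by
    rw [hw, ← Real.exp_add]; simp
  calc seqA d (a T) = Real.exp (∫ x in (0 : ℝ)..T, β x) * (w T * seqA d (a T)) := by
        rw [← mul_assoc, hwT, one_mul]
    _ ≤ _ := mul_le_mul_of_nonneg_left hmain (Real.exp_pos _).le

/-! ### Advection by a divergence-free field -/

/-- For divergence-free `c` the derivative in `v · ∇u` can be moved to the output frequency. -/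
theorem wt_pow_mul_norm_advCoeff_le_of_div (d : ℕ) {c b : (Fin n → ℤ) → V n} {C : ℝ}
    (hc : Rapid c) (hdiv : ∀ m, dot m (c m) = 0) (hb : ∀ l, wt l ^ d * ‖b l‖ ≤ C)
    (k : Fin n → ℤ) : wt k ^ d * ‖advCoeff c b k‖ ≤ ‖freq k‖ * (normW d c * C) := by
  have hw : 0 < wt k ^ d := pow_pos (wt_pos k) d
  have hC := tsum_conv_le (wt_norm_nonneg d c) (hc.summable d) (wt_norm_nonneg d b) hb k
  have hs : Summable fun l => (wt (k - l) ^ d * ‖c (k - l)‖) * (wt l ^ d * ‖b l‖) :=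
    (((hc.summable d).comp_injective (Equiv.subLeft k).injective).mul_right C).of_nonneg_of_le
      (fun l => mul_nonneg (wt_norm_nonneg d c _) (wt_norm_nonneg d b l))
      (fun l => mul_le_mul_of_nonneg_left (hb l) (wt_norm_nonneg d c _))
  have hterm : ∀ l, ‖(Complex.I * dot l (c (k - l))) • b l‖ ≤ (wt k ^ d)⁻¹ * (‖freq k‖ *
      ((wt (k - l) ^ d * ‖c (k - l)‖) * (wt l ^ d * ‖b l‖))) := by
    intro l
    have h0 : dot l (c (k - l)) = dot k (c (k - l)) := by
      have := hdiv (k - l)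
      rw [dot_sub_left, sub_eq_zero] at this
      exact this.symm
    rw [h0, norm_smul, norm_mul, Complex.norm_I, one_mul, ← div_eq_inv_mul, le_div_iff₀ hw]
    have h1 : wt k ^ d ≤ wt (k - l) ^ d * wt l ^ d := by
      rw [← mul_pow]; exact pow_le_pow_left₀ (wt_pos k).le (wt_le_mul k l) d
    calc _ ≤ (‖freq k‖ * ‖c (k - l)‖ * ‖b l‖) * (wt (k - l) ^ d * wt l ^ d) :=
          mul_le_mul (mul_le_mul_of_nonneg_right (norm_dot_le _ _) (norm_nonneg _)) h1 hw.le
            (by positivity)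
      _ = _ := by ring
  have h2 := tsum_of_norm_bounded ((hs.mul_left ‖freq k‖).mul_left (wt k ^ d)⁻¹).hasSum hterm
  rw [tsum_mul_left, tsum_mul_left, ← div_eq_inv_mul, le_div_iff₀ hw] at h2
  rw [mul_comm]
  exact h2.trans (mul_le_mul_of_nonneg_left hC (norm_nonneg _))

theorem continuous_dot (k : Fin n → ℤ) : Continuous (dot k : V n → ℂ) := by
  unfold dot
  fun_prop

theorem RapidOn.continuousOn_advCoeff {T : ℝ} {c a : ℝ → (Fin n → ℤ) → V n} (hc : RapidOn T c)
    (ha : RapidOn T a) (k : Fin n → ℤ) :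
    ContinuousOn (fun s => advCoeff (c s) (a s) k) (Set.Icc 0 T) := by
  obtain ⟨C, hC⟩ := hc.bound 0
  obtain ⟨D, hD⟩ := ha.bound (1 + (n + 1))
  refine continuousOn_tsum (fun l => (continuousOn_const.mul
    ((continuous_dot l).comp_continuousOn (hc.cont (k - l)))).smul (ha.cont l))
    ((summable_wt_inv.mul_left D).mul_left C) fun l s hs => ?_
  have h1 := hC s hs (k - l)
  have h2 := le_mul_wt_inv (hD s hs l)
  rw [pow_zero, one_mul] at h1
  rw [pow_one] at h2
  exact (norm_advTerm_le _ _ _ _).trans (mul_le_mul h1 h2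
    (mul_nonneg (wt_pos l).le (norm_nonneg _)) ((norm_nonneg _).trans h1))

/-- Complex conjugation of the components. -/
def conjV : V n →L[ℝ] V n :=
  LinearMap.toContinuousLinearMap
    { toFun := fun z => WithLp.toLp 2 fun j => (starRingEnd ℂ) (z j)
      map_add' := fun z w => by ext j; simp
      map_smul' := fun r z => by ext j; simp }

theorem conjV_apply (z : V n) (j : Fin n) : conjV z j = (starRingEnd ℂ) (z j) := rfl

theorem conjV_tsum {ι : Type*} {f : ι → V n} (hf : Summable f) :
    conjV (∑' i, f i) = ∑' i, conjV (f i) := conjV.map_tsum hf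

theorem hermitian_iff {a : (Fin n → ℤ) → V n} : Hermitian a ↔ ∀ k, a (-k) = conjV (a k) :=
  ⟨fun h k => by ext j; exact h k j, fun h k j => by rw [h k, conjV_apply]⟩

theorem conjV_smul (z : ℂ) (c : V n) : conjV (z • c) = (starRingEnd ℂ) z • conjV c := by
  ext j; simp [conjV_apply]

theorem Hermitian.lerayOp_advCoeff {c b : (Fin n → ℤ) → V n} (hc : Hermitian c) (hcr : Rapid c)
    (hb : Hermitian b) (hbr : Rapid b) : Hermitian fun k => lerayOp k (advCoeff c b k) := by
  intro k
  refine conj_lerayOp k fun j => ?_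
  rw [← conjV_apply]
  refine congrArg (fun z : V n => z j) ?_
  have h0 : conjV (advCoeff c b k) = ∑' l, conjV ((Complex.I * dot l (c (k - l))) • b l) :=
    conjV_tsum (summable_advTerm hcr hbr k)
  have h2 : advCoeff c b (-k)
      = ∑' l, (Complex.I * dot (-l) (c (-k - -l))) • b (-l) :=
    ((Equiv.neg (Fin n → ℤ)).tsum_eq fun l => (Complex.I * dot l (c (-k - l))) • b l).symm
  rw [h0, h2]
  refine tsum_congr fun l => ?_
  have h1 : dot l (c (-k - -l)) = (starRingEnd ℂ) (dot l (c (k - l))) := by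
    rw [show -k - -l = -(k - l) by abel, hermitian_iff.mp hc]
    simp [dot, conjV_apply]
  rw [dot_neg_left, h1, conjV_smul, hermitian_iff.mp hb l]
  simp

/-- Advection commutes with the summation of a geometrically convergent series. -/
theorem hasSum_advCoeff {c : (Fin n → ℤ) → V n} {q : ℕ → (Fin n → ℤ) → V n} {D C : ℝ}
    (hD : ∀ m, ‖c m‖ ≤ D) (hC : ∀ m l, wt l ^ (1 + (n + 1)) * ‖q m l‖ ≤ C * (1 / 2) ^ m)
    (k : Fin n → ℤ) :
    HasSum (fun m => advCoeff c (q m) k) (advCoeff c (fun l => ∑' m, q m l) k) := by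
  set F : ℕ → (Fin n → ℤ) → V n := fun m l => (Complex.I * dot l (c (k - l))) • q m l with hF
  have hprod : Summable (Function.uncurry F) := by
    have h1 : Summable fun p : ℕ × (Fin n → ℤ) =>
        (D * C * (1 / 2) ^ p.1) * ((wt p.2)⁻¹ ^ (n + 1)) :=
      summable_mul_of_summable_norm (f := fun m : ℕ => D * C * (1 / 2) ^ m)
        (g := fun l : Fin n → ℤ => (wt l)⁻¹ ^ (n + 1))
        (summable_geometric_two.mul_left (D * C)).norm summable_wt_inv.norm
    refine Summable.of_norm_bounded h1 fun p => ?_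
    have h2 := hD (k - p.2)
    have h3 := le_mul_wt_inv (hC p.1 p.2)
    rw [pow_one] at h3
    exact (norm_advTerm_le _ _ _ _).trans ((mul_le_mul h2 h3
      (mul_nonneg (wt_pos _).le (norm_nonneg _)) ((norm_nonneg _).trans h2)).trans
      (le_of_eq (by ring)))
  have hq : ∀ l, Summable fun m => q m l := fun l => by
    refine Summable.of_norm_bounded (summable_geometric_two.mul_left C) fun m => ?_
    exact (le_mul_of_one_le_left (norm_nonneg _) (one_le_pow₀ (one_le_wt l))).trans (hC m l)
  have h2 : advCoeff c (fun l => ∑' m, q m l) k = ∑' m, advCoeff c (q m) k := by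
    have e1 : ∑' m, ∑' l, F m l = ∑' l, ∑' m, F m l := (Summable.tsum_comm hprod).symm
    have e2 : ∀ l, (Complex.I * dot l (c (k - l))) • ∑' m, q m l = ∑' m, F m l :=
      fun l => ((hq l).tsum_const_smul _).symm
    exact (tsum_congr e2).trans e1.symm
  rw [h2]
  exact (hprod.prod : Summable fun m => ∑' l, F m l).hasSum

/-! ### Picard iteration -/

/-- The increments of the Picard iteration for Duhamel's formula: the solution `e^{-ν|k|²t} a_k` of
the heat equation, and from then on the response to the advection of the preceding increment. -/
def picard (ν : ℝ) (c : ℝ → (Fin n → ℤ) → V n) (a₀ : (Fin n → ℤ) → V n) :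
    ℕ → ℝ → (Fin n → ℤ) → V n
  | 0, s, k => Real.exp (-(ν * ‖freq k‖ ^ 2 * s)) • a₀ k
  | m + 1, s, k => Real.exp (-(ν * ‖freq k‖ ^ 2 * s)) • ∫ x in (0 : ℝ)..s,
      Real.exp (ν * ‖freq k‖ ^ 2 * x) • lerayOp k (advCoeff (c x) (picard ν c a₀ m x) k)

theorem integral_exp_mul_le {κ s : ℝ} (hκ : 0 < κ) :
    ∫ x in (0 : ℝ)..s, Real.exp (κ * x) ≤ κ⁻¹ * Real.exp (κ * s) := by
  rw [intervalIntegral.integral_comp_mul_left (fun x => Real.exp x) hκ.ne', integral_exp,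
    smul_eq_mul]
  have := inv_pos.mpr hκ
  have := Real.exp_pos (κ * 0)
  gcongr
  linarith

/-- With the time weight `e^{λt}`, the Picard iteration is a contraction in every weighted
supremum norm: the dissipation gains `|k| / (ν|k|² + λ) ≤ 1 / (2√(νλ))`. -/
theorem exists_picard_le {ν T : ℝ} (hν : 0 < ν) {c : ℝ → (Fin n → ℤ) → V n}
    {a₀ : (Fin n → ℤ) → V n} (hc : RapidOn T c) (ha₀ : Rapid a₀)
    (hdiv : ∀ s ∈ Set.Icc 0 T, ∀ m, dot m (c s m) = 0) (d : ℕ) :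
    ∃ C, 0 ≤ C ∧ ∀ m, ∀ s ∈ Set.Icc 0 T, ∀ k,
      wt k ^ d * ‖picard ν c a₀ m s k‖ ≤ C * (1 / 2) ^ m := by
  obtain ⟨A', hA'⟩ := hc.exists_normW_le d
  set A := max A' 0
  have hA0 : 0 ≤ A := le_max_right _ _
  have hA : ∀ s ∈ Set.Icc 0 T, normW d (c s) ≤ A := fun s hs => (hA' s hs).trans (le_max_left _ _)
  obtain ⟨B', hB'⟩ := ha₀ d
  set B := max B' 0
  have hB0 : 0 ≤ B := le_max_right _ _
  have hB : ∀ k, wt k ^ d * ‖a₀ k‖ ≤ B := fun k => (hB' k).trans (le_max_left _ _)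
  set L : ℝ := A ^ 2 / ν + 1 with hL
  have hL0 : 0 < L := by positivity
  -- Young's inequality, from which the choice of `L` comes
  have hyoung : ∀ x : ℝ, A * x ≤ (1 / 2) * (ν * x ^ 2 + L) := by
    intro x
    have h1 : 0 ≤ (ν * x - A) ^ 2 / ν := by positivity
    have h2 : (ν * x - A) ^ 2 / ν = ν * x ^ 2 - 2 * (A * x) + A ^ 2 / ν := by
      field_simp
      ring
    rw [h2] at h1
    rw [hL]
    linarith
  clear_value L
  have key : ∀ m, ∀ s ∈ Set.Icc 0 T, ∀ k,
      wt k ^ d * ‖picard ν c a₀ m s k‖ ≤ B * (1 / 2) ^ m * Real.exp (L * s) := by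
    intro m
    induction m with
    | zero =>
      intro s hs k
      have hμ : 0 ≤ ν * ‖freq k‖ ^ 2 := by positivity
      rw [picard, norm_smul, Real.norm_of_nonneg (Real.exp_pos _).le, pow_zero, mul_one]
      have h1 : Real.exp (-(ν * ‖freq k‖ ^ 2 * s)) ≤ 1 :=
        Real.exp_le_one_iff.mpr (neg_nonpos.mpr (mul_nonneg hμ hs.1))
      have h2 : 1 ≤ Real.exp (L * s) := Real.one_le_exp (mul_nonneg hL0.le hs.1)
      calc _ = Real.exp (-(ν * ‖freq k‖ ^ 2 * s)) * (wt k ^ d * ‖a₀ k‖) := by ring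
        _ ≤ 1 * B := mul_le_mul h1 (hB k) (wt_norm_nonneg d a₀ k) zero_le_one
        _ ≤ B * Real.exp (L * s) := by rw [one_mul]; exact le_mul_of_one_le_right hB0 h2
    | succ m ih =>
      intro s hs k
      set μ : ℝ := ν * ‖freq k‖ ^ 2 with hμd
      have hμ : 0 ≤ μ := by positivity
      have hκ : 0 < μ + L := by positivity
      have hw : 0 < wt k ^ d := pow_pos (wt_pos k) d
      set G : ℝ := ‖freq k‖ * (A * (B * (1 / 2) ^ m)) with hG
      have hG0 : 0 ≤ G := by positivity
      have hI : ‖∫ x in (0 : ℝ)..s, Real.exp (μ * x) •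
          lerayOp k (advCoeff (c x) (picard ν c a₀ m x) k)‖
          ≤ ∫ x in (0 : ℝ)..s, (wt k ^ d)⁻¹ * G * Real.exp ((μ + L) * x) := by
        refine intervalIntegral.norm_integral_le_of_norm_le hs.1
          (Filter.Eventually.of_forall fun x hx => ?_)
          (Continuous.intervalIntegrable (by fun_prop) _ _)
        have hx' : x ∈ Set.Icc 0 T := ⟨hx.1.le, hx.2.trans hs.2⟩
        have h1 := wt_pow_mul_norm_advCoeff_le_of_div d (hc.rapid hx') (hdiv x hx') (ih x hx') k
        have h2 : ‖freq k‖ * (normW d (c x) * (B * (1 / 2) ^ m * Real.exp (L * x)))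
            ≤ G * Real.exp (L * x) := by
          rw [hG]
          have := hA x hx'
          calc _ ≤ ‖freq k‖ * (A * (B * (1 / 2) ^ m * Real.exp (L * x))) := by gcongr
            _ = _ := by ring
        have h3 : ‖advCoeff (c x) (picard ν c a₀ m x) k‖
            ≤ (wt k ^ d)⁻¹ * (G * Real.exp (L * x)) := by
          rw [← div_eq_inv_mul, le_div_iff₀ hw, mul_comm]
          exact h1.trans h2
        rw [norm_smul, Real.norm_of_nonneg (Real.exp_pos _).le]
        calc _ ≤ Real.exp (μ * x) * ((wt k ^ d)⁻¹ * (G * Real.exp (L * x))) :=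
              mul_le_mul_of_nonneg_left ((norm_lerayOp_le _ _).trans h3) (Real.exp_pos _).le
          _ = _ := by rw [add_mul, Real.exp_add]; ring
      rw [intervalIntegral.integral_const_mul] at hI
      have hI2 := hI.trans (mul_le_mul_of_nonneg_left (integral_exp_mul_le (s := s) hκ)
        (mul_nonneg (inv_nonneg.mpr hw.le) hG0))
      rw [picard, norm_smul, Real.norm_of_nonneg (Real.exp_pos _).le]
      have hgain : G * (μ + L)⁻¹ ≤ B * (1 / 2) ^ (m + 1) := by
        rw [← div_eq_mul_inv, div_le_iff₀ hκ, hG]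
        have h1 := mul_le_mul_of_nonneg_right (hyoung ‖freq k‖)
          (by positivity : 0 ≤ B * (1 / 2) ^ m)
        calc _ = A * ‖freq k‖ * (B * (1 / 2) ^ m) := by ring
          _ ≤ _ := h1
          _ = _ := by rw [pow_succ]; ring
      calc _ ≤ wt k ^ d * (Real.exp (-(μ * s)) *
            ((wt k ^ d)⁻¹ * G * ((μ + L)⁻¹ * Real.exp ((μ + L) * s)))) := by
              gcongr
        _ = (wt k ^ d * (wt k ^ d)⁻¹) * (Real.exp (-(μ * s)) * Real.exp (μ * s)) *
            (G * (μ + L)⁻¹) * Real.exp (L * s) := by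
              rw [add_mul, Real.exp_add]; ring
        _ = G * (μ + L)⁻¹ * Real.exp (L * s) := by
              rw [mul_inv_cancel₀ hw.ne', ← Real.exp_add]; simp
        _ ≤ _ := mul_le_mul_of_nonneg_right hgain (Real.exp_pos _).le
  refine ⟨B * Real.exp (L * T), by positivity, fun m s hs k => (key m s hs k).trans ?_⟩
  have : Real.exp (L * s) ≤ Real.exp (L * T) :=
    Real.exp_le_exp.mpr (mul_le_mul_of_nonneg_left hs.2 hL0.le)
  calc _ ≤ B * (1 / 2) ^ m * Real.exp (L * T) := by gcongr
    _ = _ := by ring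

section Picard

variable {ν T : ℝ} {c : ℝ → (Fin n → ℤ) → V n} {a₀ : (Fin n → ℤ) → V n}

/-- The integrand in Duhamel's formula. -/
def duhamel (ν : ℝ) (c b : ℝ → (Fin n → ℤ) → V n) (k : Fin n → ℤ) (x : ℝ) : V n :=
  Real.exp (ν * ‖freq k‖ ^ 2 * x) • lerayOp k (advCoeff (c x) (b x) k)

theorem RapidOn.continuousOn_duhamel {b : ℝ → (Fin n → ℤ) → V n} (hc : RapidOn T c)
    (hb : RapidOn T b) (k : Fin n → ℤ) : ContinuousOn (duhamel ν c b k) (Set.Icc 0 T) := by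
  have hE : Continuous fun x : ℝ => Real.exp (ν * ‖freq k‖ ^ 2 * x) := by fun_prop
  refine hE.continuousOn.smul ?_
  exact (lerayOp k).continuous.comp_continuousOn (hc.continuousOn_advCoeff hb k)

theorem rapidOn_picard (hν : 0 < ν) (hc : RapidOn T c) (ha₀ : Rapid a₀)
    (hdiv : ∀ s ∈ Set.Icc 0 T, ∀ m, dot m (c s m) = 0) (m : ℕ) :
    RapidOn T (picard ν c a₀ m) := by
  have hbound : ∀ m d, ∃ C, ∀ s ∈ Set.Icc 0 T, ∀ k, wt k ^ d * ‖picard ν c a₀ m s k‖ ≤ C := by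
    intro m d
    obtain ⟨C, _, hC⟩ := exists_picard_le hν hc ha₀ hdiv d
    exact ⟨_, hC m⟩
  induction m with
  | zero =>
    refine ⟨fun k => ?_, hbound 0⟩
    exact Continuous.continuousOn (by simp only [picard]; fun_prop)
  | succ m ih =>
    refine ⟨fun k => ?_, hbound (m + 1)⟩
    have hE : Continuous fun x : ℝ => Real.exp (-(ν * ‖freq k‖ ^ 2 * x)) := by fun_prop
    refine hE.continuousOn.smul fun s hs => ?_
    exact (hasDerivWithinAt_integral_Icc (hc.continuousOn_duhamel (ν := ν) ih k)
      hs).continuousWithinAt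

theorem hermitian_picard (hν : 0 < ν) (hc : RapidOn T c) (ha₀ : Rapid a₀)
    (hdiv : ∀ s ∈ Set.Icc 0 T, ∀ m, dot m (c s m) = 0)
    (hh : ∀ s ∈ Set.Icc 0 T, Hermitian (c s)) (hh₀ : Hermitian a₀) (m : ℕ) :
    ∀ s ∈ Set.Icc 0 T, Hermitian (picard ν c a₀ m s) := by
  induction m with
  | zero =>
    intro s _
    rw [hermitian_iff]
    intro k
    rw [picard, picard, freq_neg, norm_neg, map_smul, hermitian_iff.mp hh₀]
  | succ m ih =>
    intro s hs
    have hm := rapidOn_picard hν hc ha₀ hdiv m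
    rw [hermitian_iff]
    intro k
    have hint : IntervalIntegrable (duhamel ν c (picard ν c a₀ m) k) volume 0 s := by
      refine ContinuousOn.intervalIntegrable ((hc.continuousOn_duhamel hm k).mono ?_)
      rw [Set.uIcc_of_le hs.1]
      exact Set.Icc_subset_Icc_right hs.2
    rw [picard, picard, freq_neg, norm_neg, map_smul]
    congr 1
    refine Eq.trans ?_ (conjV.intervalIntegral_comp_comm hint)
    refine intervalIntegral.integral_congr fun x hx => ?_
    rw [Set.uIcc_of_le hs.1] at hx
    have hx' : x ∈ Set.Icc 0 T := ⟨hx.1, hx.2.trans hs.2⟩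
    have := hermitian_iff.mp ((hh x hx').lerayOp_advCoeff (hc.rapid hx') (ih x hx')
      (hm.rapid hx')) k
    simp only [map_smul, this]

/-- The sum of the Picard increments, which solves the equation. -/
def picardSum (ν : ℝ) (c : ℝ → (Fin n → ℤ) → V n) (a₀ : (Fin n → ℤ) → V n) (s : ℝ)
    (k : Fin n → ℤ) : V n := ∑' m, picard ν c a₀ m s k

theorem summable_picard (hν : 0 < ν) (hc : RapidOn T c) (ha₀ : Rapid a₀)
    (hdiv : ∀ s ∈ Set.Icc 0 T, ∀ m, dot m (c s m) = 0) {s : ℝ} (hs : s ∈ Set.Icc 0 T)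
    (k : Fin n → ℤ) : Summable fun m => picard ν c a₀ m s k := by
  obtain ⟨C, _, hC⟩ := exists_picard_le hν hc ha₀ hdiv 0
  refine Summable.of_norm_bounded (summable_geometric_two.mul_left C) fun m => ?_
  simpa using hC m s hs k

theorem rapidOn_picardSum (hν : 0 < ν) (hc : RapidOn T c) (ha₀ : Rapid a₀)
    (hdiv : ∀ s ∈ Set.Icc 0 T, ∀ m, dot m (c s m) = 0) : RapidOn T (picardSum ν c a₀) := by
  refine ⟨fun k => ?_, fun d => ?_⟩
  · obtain ⟨C, _, hC⟩ := exists_picard_le hν hc ha₀ hdiv 0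
    refine continuousOn_tsum (fun m => (rapidOn_picard hν hc ha₀ hdiv m).cont k)
      (summable_geometric_two.mul_left C) fun m s hs => ?_
    simpa using hC m s hs k
  · obtain ⟨C, _, hC⟩ := exists_picard_le hν hc ha₀ hdiv d
    refine ⟨C * 2, fun s hs k => ?_⟩
    have h1 : ‖wt k ^ d • picardSum ν c a₀ s k‖ ≤ C * 2 := by
      rw [picardSum, ← (summable_picard hν hc ha₀ hdiv hs k).tsum_const_smul]
      refine tsum_of_norm_bounded (hasSum_geometric_two.mul_left C) fun m => ?_
      rw [norm_smul, Real.norm_of_nonneg (pow_nonneg (wt_pos k).le _)]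
      exact hC m s hs k
    rwa [norm_smul, Real.norm_of_nonneg (pow_nonneg (wt_pos k).le _)] at h1

theorem hermitian_picardSum (hν : 0 < ν) (hc : RapidOn T c) (ha₀ : Rapid a₀)
    (hdiv : ∀ s ∈ Set.Icc 0 T, ∀ m, dot m (c s m) = 0)
    (hh : ∀ s ∈ Set.Icc 0 T, Hermitian (c s)) (hh₀ : Hermitian a₀) :
    ∀ s ∈ Set.Icc 0 T, Hermitian (picardSum ν c a₀ s) := by
  intro s hs
  rw [hermitian_iff]
  intro k
  rw [picardSum, picardSum, conjV.map_tsum (summable_picard hν hc ha₀ hdiv hs k)]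
  exact tsum_congr fun m => hermitian_iff.mp (hermitian_picard hν hc ha₀ hdiv hh hh₀ m s hs) k

theorem advCoeff_picardSum (hν : 0 < ν) (hc : RapidOn T c) (ha₀ : Rapid a₀)
    (hdiv : ∀ s ∈ Set.Icc 0 T, ∀ m, dot m (c s m) = 0) {s : ℝ} (hs : s ∈ Set.Icc 0 T)
    (k : Fin n → ℤ) : HasSum (fun m => advCoeff (c s) (picard ν c a₀ m s) k)
      (advCoeff (c s) (picardSum ν c a₀ s) k) := by
  obtain ⟨C, _, hC⟩ := exists_picard_le hν hc ha₀ hdiv (1 + (n + 1))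
  obtain ⟨D, hD⟩ := hc.bound 0
  exact hasSum_advCoeff (fun m => by simpa using hD s hs m) (fun m l => hC m s hs l) k

/-- Duhamel's formula for the sum of the Picard increments. -/
theorem picardSum_eq (hν : 0 < ν) (hc : RapidOn T c) (ha₀ : Rapid a₀)
    (hdiv : ∀ s ∈ Set.Icc 0 T, ∀ m, dot m (c s m) = 0) {s : ℝ} (hs : s ∈ Set.Icc 0 T)
    (k : Fin n → ℤ) : picardSum ν c a₀ s k = Real.exp (-(ν * ‖freq k‖ ^ 2 * s)) •
      (a₀ k + ∫ x in (0 : ℝ)..s, duhamel ν c (picardSum ν c a₀) k x) := by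
  have hmem : ∀ x ∈ Set.uIoc 0 s, x ∈ Set.Icc 0 T := fun x hx => by
    rw [Set.uIoc_of_le hs.1] at hx
    exact ⟨hx.1.le, hx.2.trans hs.2⟩
  obtain ⟨C, hC0, hC⟩ := exists_picard_le hν hc ha₀ hdiv 0
  obtain ⟨A, hA⟩ := hc.exists_normW_le 0
  have hbnd : ∀ m, ∀ x ∈ Set.uIoc 0 s, ‖duhamel ν c (picard ν c a₀ m) k x‖
      ≤ Real.exp (ν * ‖freq k‖ ^ 2 * x) * (‖freq k‖ * (A * C)) * (1 / 2) ^ m := by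
    intro m x hx
    have hx' := hmem x hx
    have h1 := wt_pow_mul_norm_advCoeff_le_of_div 0 (hc.rapid hx') (hdiv x hx') (hC m x hx') k
    rw [pow_zero, one_mul] at h1
    rw [duhamel, norm_smul, Real.norm_of_nonneg (Real.exp_pos _).le]
    calc _ ≤ Real.exp (ν * ‖freq k‖ ^ 2 * x) * (‖freq k‖ * (A * (C * (1 / 2) ^ m))) := by
          refine mul_le_mul_of_nonneg_left ((norm_lerayOp_le _ _).trans (h1.trans ?_))
            (Real.exp_pos _).le
          have := hA x hx'
          gcongr
      _ = _ := by ring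
  have hint : HasSum (fun m => ∫ x in (0 : ℝ)..s, duhamel ν c (picard ν c a₀ m) k x)
      (∫ x in (0 : ℝ)..s, duhamel ν c (picardSum ν c a₀) k x) := by
    refine intervalIntegral.hasSum_integral_of_dominated_convergence
      (fun m x => Real.exp (ν * ‖freq k‖ ^ 2 * x) * (‖freq k‖ * (A * C)) * (1 / 2) ^ m)
      (fun m => ?_) (fun m => Filter.Eventually.of_forall fun x hx => hbnd m x hx)
      (Filter.Eventually.of_forall fun x _ => summable_geometric_two.mul_left _) ?_
      (Filter.Eventually.of_forall fun x hx => ?_)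
    · exact ((hc.continuousOn_duhamel (rapidOn_picard hν hc ha₀ hdiv m) k).mono
        hmem).aestronglyMeasurable measurableSet_uIoc
    · simp only [tsum_mul_left]
      exact Continuous.intervalIntegrable (by fun_prop) _ _
    · exact ((advCoeff_picardSum hν hc ha₀ hdiv (hmem x hx) k).mapL (lerayOp k)).const_smul _
  rw [picardSum, (summable_picard hν hc ha₀ hdiv hs k).tsum_eq_zero_add, smul_add]
  congr 1
  rw [← hint.tsum_eq, ← hint.summable.tsum_const_smul]
  rfl

theorem solvesOn_picardSum (hν : 0 < ν) (hc : RapidOn T c) (ha₀ : Rapid a₀)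
    (hdiv : ∀ s ∈ Set.Icc 0 T, ∀ m, dot m (c s m) = 0) : SolvesOn ν T c (picardSum ν c a₀) := by
  intro s hs k
  have hI := hasDerivWithinAt_integral_Icc
    (hc.continuousOn_duhamel (ν := ν) (rapidOn_picardSum hν hc ha₀ hdiv) k) hs
  have hE : HasDerivWithinAt (fun s : ℝ => Real.exp (-(ν * ‖freq k‖ ^ 2 * s)))
      (Real.exp (-(ν * ‖freq k‖ ^ 2 * s)) * -(ν * ‖freq k‖ ^ 2)) (Set.Icc 0 T) s := by
    simpa using (((hasDerivAt_id s).const_mul (ν * ‖freq k‖ ^ 2)).neg.exp).hasDerivWithinAt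
      (s := Set.Icc 0 T)
  have h := (hE.smul (hI.const_add (a₀ k))).congr
    (fun x hx => picardSum_eq hν hc ha₀ hdiv hx k) (picardSum_eq hν hc ha₀ hdiv hs k)
  convert! h using 1
  have hcancel : Real.exp (-(ν * ‖freq k‖ ^ 2 * s)) • duhamel ν c (picardSum ν c a₀) k s
      = lerayOp k (advCoeff (c s) (picardSum ν c a₀ s) k) := by
    rw [duhamel, smul_smul, ← Real.exp_add, neg_add_cancel, Real.exp_zero, one_smul]
  rw [hcancel, picardSum_eq hν hc ha₀ hdiv hs k, add_comm, smul_smul, ← neg_smul]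
  congr 2
  ring

theorem picardSum_zero (ν : ℝ) (c : ℝ → (Fin n → ℤ) → V n) (a₀ : (Fin n → ℤ) → V n) :
    picardSum ν c a₀ 0 = a₀ := by
  funext k
  rw [picardSum, tsum_eq_single 0]
  · simp [picard]
  · intro m hm
    obtain ⟨m, rfl⟩ := Nat.exists_eq_succ_of_ne_zero hm
    simp [picard]

end Picard

/-! ### Curves of fields and curves of coefficients -/

theorem rapidOn_coeff {f : ℝ → SmoothField n} (hf : ContinuousOn f (Set.Ici 0)) (T : ℝ) :
    RapidOn T (fun s => coeff (f s)) := by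
  have hsub : Set.Icc 0 T ⊆ Set.Ici 0 := Set.Icc_subset_Ici_self
  refine ⟨fun k s hs => (tendsto_coeff (hf s (hsub hs)) k).mono_left (nhdsWithin_mono s hsub),
    fun d => ?_⟩
  have hc : ContinuousOn (fun s => normW d (coeff (f s))) (Set.Icc 0 T) := fun s hs =>
    (tendsto_normW (hf s (hsub hs)) d).mono_left (nhdsWithin_mono s hsub)
  obtain ⟨C, hC⟩ := isCompact_Icc.exists_bound_of_continuousOn hc
  exact ⟨C, fun s hs k => ((rapid_coeff (f s)).le_normW d k).trans
    ((le_abs_self _).trans (hC s hs))⟩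

theorem Icc_mem_nhdsWithin_Ici (s : ℝ) : Set.Icc 0 (s + 1) ∈ 𝓝[Set.Ici 0] s := by
  have h : Set.Iio (s + 1) ∈ 𝓝[Set.Ici 0] s :=
    mem_nhdsWithin_of_mem_nhds (Iio_mem_nhds (lt_add_one s))
  filter_upwards [h, self_mem_nhdsWithin] with x hx hx0
  exact ⟨hx0, hx.le⟩

theorem continuousOn_of_rapidOn {f : ℝ → SmoothField n}
    (hf : ∀ T, RapidOn T (fun s => coeff (f s))) : ContinuousOn f (Set.Ici 0) := by
  intro s hs
  have hmem := Icc_mem_nhdsWithin_Ici s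
  refine tendsto_of_coeff (fun k => ?_) fun d => ?_
  · exact ((hf (s + 1)).cont k s ⟨hs, by linarith⟩).mono_left (nhdsWithin_le_of_mem hmem)
  · obtain ⟨C, hC⟩ := (hf (s + 1)).bound d
    exact ⟨C, Filter.mem_of_superset hmem fun x hx => hC x hx⟩

/-- A curve of fields is differentiable in `C^∞(𝕋ⁿ)ⁿ` as soon as its coefficients are
differentiable and their derivatives are the coefficients of a continuous curve: by the mean value
inequality the difference quotients decay as rapidly as the derivatives. -/
theorem tendsto_slope_of_coeff {f g : ℝ → SmoothField n} (hg : ContinuousOn g (Set.Ici 0))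
    (h : ∀ T, ∀ s ∈ Set.Icc 0 T, ∀ k,
      HasDerivWithinAt (fun s => coeff (f s) k) (coeff (g s) k) (Set.Icc 0 T) s)
    {t : ℝ} (ht : t ∈ Set.Ici (0 : ℝ)) :
    Filter.Tendsto (slope f t) (𝓝[Set.Ici 0 \ {t}] t) (𝓝 (g t)) := by
  have htI : t ∈ Set.Icc 0 (t + 1) := ⟨ht, by linarith⟩
  have hmem := Icc_mem_nhdsWithin_Ici t
  have hslope : ∀ k s, coeff (slope f t s) k = slope (fun s => coeff (f s) k) t s := fun k s => by
    simp only [slope_def_module, map_smul, map_sub, Pi.smul_apply, Pi.sub_apply]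
  refine tendsto_of_coeff (fun k => ?_) fun d => ?_
  · simp only [hslope]
    exact hasDerivWithinAt_iff_tendsto_slope.mp
      ((h (t + 1) t htI k).mono_of_mem_nhdsWithin hmem)
  · obtain ⟨C, hC⟩ := (rapidOn_coeff hg (t + 1)).bound d
    refine ⟨C, ?_⟩
    filter_upwards [nhdsWithin_mono t Set.sdiff_subset hmem, self_mem_nhdsWithin] with s hs hst k
    have hw : 0 < wt k ^ d := pow_pos (wt_pos k) d
    have hne : 0 < ‖s - t‖ := norm_pos_iff.mpr (sub_ne_zero.mpr hst.2)
    have hmv := (convex_Icc 0 (t + 1)).norm_image_sub_le_of_norm_hasDerivWithin_le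
      (f := fun s => coeff (f s) k) (C := C / wt k ^ d) (fun x hx => h (t + 1) x hx k)
      (fun x hx => by rw [le_div_iff₀ hw, mul_comm]; exact hC x hx k) htI hs
    rw [hslope, slope_def_module, norm_smul, norm_inv, ← mul_assoc, mul_comm (wt k ^ d), mul_assoc,
      inv_mul_le_iff₀ hne]
    calc _ ≤ wt k ^ d * (C / wt k ^ d * ‖s - t‖) := by gcongr
      _ = _ := by field_simp

theorem solvesOn_of_isSolution {ν : ℝ} {v u : ℝ → SmoothField n}
    {u₀ : SmoothField n} (hu : IsCr 1 u) (hsol : IsSolution ν v u₀ u) (T : ℝ) :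
    SolvesOn ν T (fun s => coeff (v s)) (fun s => coeff (u s)) := by
  obtain ⟨u', hu', -⟩ := hu
  intro s hs k
  have hs0 : s ∈ Set.Ici (0 : ℝ) := hs.1
  -- the derivative in `C^∞(𝕋ⁿ)ⁿ` is also a pointwise one, and these are unique
  have heq : u' s = rhs ν (v s) (u s) := by
    refine Subtype.ext (funext fun x => ?_)
    refine Eq.trans ?_ (rhs_apply ν (v s) (u s) x).symm
    exact (uniqueDiffOn_Ici (0 : ℝ) s hs0).eq_deriv _ (hasDerivWithinAt_eval (hu' s hs0) x)
      (hsol.2 s hs0 x)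
  rw [← coeff_rhs, ← heq]
  exact (hasDerivWithinAt_coeff (hu' s hs0) k).mono Set.Icc_subset_Ici_self

/-! ### The mean -/

theorem advCoeff_apply_zero {c b : (Fin n → ℤ) → V n} (hdiv : ∀ m, dot m (c m) = 0) :
    advCoeff c b 0 = 0 := by
  have h : ∀ l, (Complex.I * dot l (c (0 - l))) • b l = 0 := fun l => by
    have := hdiv (-l)
    rw [dot_neg_left, neg_eq_zero] at this
    rw [zero_sub, this, mul_zero, zero_smul]
  rw [advCoeff, tsum_congr h, tsum_zero]

/-- The zeroth coefficient is constant in time, since `v · ∇u` has mean zero. -/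
theorem SolvesOn.coeff_zero_eq {ν T : ℝ} {c a : ℝ → (Fin n → ℤ) → V n} (hode : SolvesOn ν T c a)
    (hdiv : ∀ s ∈ Set.Icc 0 T, ∀ m, dot m (c s m) = 0) {s : ℝ} (hs : s ∈ Set.Icc 0 T) :
    a s 0 = a 0 0 := by
  have hf : ‖freq (0 : Fin n → ℤ)‖ = 0 := by simp [freq_zero]
  have hd : ∀ x ∈ Set.Icc 0 T, HasDerivWithinAt (fun s => a s 0) 0 (Set.Icc 0 T) x := by
    intro x hx
    simpa [hf, advCoeff_apply_zero (hdiv x hx)] using hode x hx 0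
  have h := (convex_Icc 0 T).norm_image_sub_le_of_norm_hasDerivWithin_le
    (f := fun s => a s 0) (C := 0) hd (fun x _ => by simp) ⟨le_rfl, hs.1.trans hs.2⟩ hs
  rw [zero_mul, norm_le_zero_iff, sub_eq_zero] at h
  exact h

theorem integral_cell_eq_of_coeff {f g : SmoothField n} (h : coeff f 0 = coeff g 0) :
    ∫ x in cell n, f x = ∫ x in cell n, g x := by
  have hint : ∀ f : SmoothField n, IntegrableOn f (cell n) := fun f =>
    integrableOn_cell f.2.1.continuous
  ext j
  have hj : ∀ f : SmoothField n, (∫ x in cell n, f x) j = ∫ x in cell n, f x j := fun f =>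
    ((EuclideanSpace.proj (𝕜 := ℝ) j).integral_comp_comm (hint f)).symm
  have hc : ∀ f : SmoothField n, coeff f 0 j
      = ((2 * Real.pi : ℝ) : ℂ)⁻¹ ^ n * ((∫ x in cell n, f x j : ℝ) : ℂ) := fun f => by
    rw [coeff_def, fourierVec, ← integral_complex_ofReal]
    simp [freq_zero]
  have hj' := congrArg (fun z : V n => z j) h
  simp only [hc] at hj'
  rw [hj, hj]
  have hpi : ((2 * Real.pi : ℝ) : ℂ)⁻¹ ^ n ≠ 0 :=
    pow_ne_zero _ (inv_ne_zero (by exact_mod_cast (by positivity : (2 * Real.pi : ℝ) ≠ 0)))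
  exact_mod_cast mul_left_cancel₀ hpi hj'

/-! ### A priori bounds in closed form -/

section Bounds

variable {ν T : ℝ} {c a : ℝ → (Fin n → ℤ) → V n}

/-- Young's inequality `A x ≤ ν x² + A² / (4ν)`: the dissipation absorbs the loss of a derivative in
the production term. -/
theorem mul_le_dissipation {ν : ℝ} (hν : 0 < ν) (A x : ℝ) :
    A * x ≤ ν * x ^ 2 + 1 / (4 * ν) * A ^ 2 := by
  have h : ν * x ^ 2 + 1 / (4 * ν) * A ^ 2 - A * x = ν * (x - A / (2 * ν)) ^ 2 := by
    field_simp
    ring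
  have := mul_nonneg hν.le (sq_nonneg (x - A / (2 * ν)))
  linarith

theorem intervalIntegrable_seqA (hT : 0 ≤ T) (hc : RapidOn T c) (d : ℕ) :
    IntervalIntegrable (fun s => seqA d (c s)) volume 0 T :=
  ContinuousOn.intervalIntegrable (by rw [Set.uIcc_of_le hT]; exact hc.continuousOn_seqA d)

/-- For `d ≤ 1` there are no terms in which at least two derivatives fall on the velocity. -/
theorem seqA_le_of_le_one (hT : 0 ≤ T) (hc : RapidOn T c) (ha : RapidOn T a)
    (hh : ∀ s ∈ Set.Icc 0 T, Hermitian (c s)) (hode : SolvesOn ν T c a) {β₀ : ℝ → ℝ}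
    (hβ₀ : ContinuousOn β₀ (Set.Icc 0 T)) {d : ℕ} (hd : d ≤ 1)
    (hβ : ∀ s ∈ Set.Icc 0 T, ∀ l : Fin n → ℤ, l ≠ 0 →
      seqA 0 (c s) * ‖freq l‖ ≤ ν * ‖freq l‖ ^ 2 + β₀ s) :
    seqA d (a T) ≤ seqA d (a 0) *
      Real.exp ((∫ s in (0 : ℝ)..T, β₀ s) + d * ∫ s in (0 : ℝ)..T, seqA 1 (c s)) := by
  have h := seqA_le hT hc ha hh hode hβ₀ d hβ
  have hβi : IntervalIntegrable β₀ volume 0 T :=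
    ContinuousOn.intervalIntegrable (by rwa [Set.uIcc_of_le hT])
  rw [Finset.Icc_eq_empty (by omega)] at h
  simp only [Finset.sum_empty, mul_zero, intervalIntegral.integral_zero, add_zero] at h
  rwa [intervalIntegral.integral_add hβi ((intervalIntegrable_seqA hT hc 1).const_mul _),
    intervalIntegral.integral_const_mul, mul_comm] at h

theorem seqA_le_of_young (hν : 0 < ν) (hT : 0 ≤ T) (hc : RapidOn T c) (ha : RapidOn T a)
    (hh : ∀ s ∈ Set.Icc 0 T, Hermitian (c s)) (hode : SolvesOn ν T c a) {d : ℕ} (hd : d ≤ 1) :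
    seqA d (a T) ≤ seqA d (a 0) * Real.exp ((1 / (4 * ν) * ∫ s in (0 : ℝ)..T, seqA 0 (c s) ^ 2)
      + d * ∫ s in (0 : ℝ)..T, seqA 1 (c s)) := by
  have h := seqA_le_of_le_one hT hc ha hh hode (β₀ := fun s => 1 / (4 * ν) * seqA 0 (c s) ^ 2)
    (continuousOn_const.mul ((hc.continuousOn_seqA 0).pow 2)) hd
    fun s _ l _ => mul_le_dissipation hν _ _
  rwa [intervalIntegral.integral_const_mul] at h

/-- Since `|l| ≥ 1` for `l ≠ 0`, a small velocity leaves an exponential damping at rate `δ`. -/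
theorem seqA_le_of_small (hT : 0 ≤ T) (hc : RapidOn T c) (ha : RapidOn T a)
    (hh : ∀ s ∈ Set.Icc 0 T, Hermitian (c s)) (hode : SolvesOn ν T c a) {δ : ℝ} (hδ : 0 ≤ δ)
    (hsmall : ∀ s ∈ Set.Icc 0 T, seqA 0 (c s) + δ ≤ ν) {d : ℕ} (hd : d ≤ 1) :
    seqA d (a T) ≤ seqA d (a 0) * Real.exp (-δ * T + d * ∫ s in (0 : ℝ)..T, seqA 1 (c s)) := by
  have h := seqA_le_of_le_one hT hc ha hh hode (β₀ := fun _ => -δ) continuousOn_const hd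
    fun s hs l hl => by
      have h1 := one_le_norm_freq hl
      have h2 := hsmall s hs
      have h3 := seqA_nonneg 0 (c s)
      nlinarith [mul_le_mul_of_nonneg_right h2 (sq_nonneg ‖freq l‖),
        mul_nonneg h3 (mul_nonneg (by linarith : 0 ≤ ‖freq l‖) (sub_nonneg.mpr h1)),
        mul_nonneg hδ (by nlinarith : 0 ≤ ‖freq l‖ ^ 2 - 1)]
  simpa [mul_comm T] using h

theorem seqA_le_sum (hν : 0 < ν) (hT : 0 ≤ T) (hc : RapidOn T c) (ha : RapidOn T a)
    (hh : ∀ s ∈ Set.Icc 0 T, Hermitian (c s)) (hode : SolvesOn ν T c a) (d : ℕ) :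
    seqA d (a T) ≤ Real.exp (1 / (4 * ν) * (∫ s in (0 : ℝ)..T, seqA 0 (c s) ^ 2)
        + d * ∫ s in (0 : ℝ)..T, seqA 1 (c s)) *
      (seqA d (a 0) + ∑ j ∈ Finset.Icc 2 d, (d.choose j : ℝ) * (∫ s in (0 : ℝ)..T, seqA j (c s)) *
        sSup ((fun s => seqA (d + 1 - j) (a s)) '' Set.Icc 0 T)) := by
  set β₀ : ℝ → ℝ := fun s => 1 / (4 * ν) * seqA 0 (c s) ^ 2 with hβ₀d
  have hβ₀ : ContinuousOn β₀ (Set.Icc 0 T) :=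
    continuousOn_const.mul ((hc.continuousOn_seqA 0).pow 2)
  have h := seqA_le hT hc ha hh hode hβ₀ d fun s _ l _ => mul_le_dissipation hν _ _
  have hβi : IntervalIntegrable β₀ volume 0 T :=
    ContinuousOn.intervalIntegrable (by rwa [Set.uIcc_of_le hT])
  set β : ℝ → ℝ := fun x => β₀ x + d * seqA 1 (c x) with hβd
  have hβc : ContinuousOn β (Set.Icc 0 T) :=
    hβ₀.add (continuousOn_const.mul (hc.continuousOn_seqA 1))
  have hβpos : ∀ x, 0 ≤ β x := fun x => by
    have := seqA_nonneg 1 (c x)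
    positivity
  have hsplit : ∫ x in (0 : ℝ)..T, β x = 1 / (4 * ν) * (∫ s in (0 : ℝ)..T, seqA 0 (c s) ^ 2)
      + d * ∫ s in (0 : ℝ)..T, seqA 1 (c s) := by
    rw [hβd, intervalIntegral.integral_add hβi ((intervalIntegrable_seqA hT hc 1).const_mul _),
      intervalIntegral.integral_const_mul, intervalIntegral.integral_const_mul]
  rw [hsplit] at h
  refine h.trans (mul_le_mul_of_nonneg_left (add_le_add le_rfl ?_) (Real.exp_pos _).le)
  set S : ℕ → ℝ := fun j => sSup ((fun s => seqA (d + 1 - j) (a s)) '' Set.Icc 0 T) with hS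
  have hle : ∀ j, ∀ s ∈ Set.Icc 0 T, seqA (d + 1 - j) (a s) ≤ S j := fun j s hs =>
    le_csSup (isCompact_Icc.image_of_continuousOn (ha.continuousOn_seqA _)).bddAbove
      (Set.mem_image_of_mem _ hs)
  have hterm : ∀ j ∈ Finset.Icc 2 d,
      IntervalIntegrable (fun s => (d.choose j : ℝ) * seqA j (c s) * S j) volume 0 T := fun j _ =>
    ((intervalIntegrable_seqA hT hc j).const_mul _).mul_const _
  have hwc : ContinuousOn (fun s => Real.exp (-∫ x in (0 : ℝ)..s, β x)) (Set.Icc 0 T) :=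
    Real.continuous_exp.comp_continuousOn (ContinuousOn.neg fun s hs =>
      (hasDerivWithinAt_integral_Icc hβc hs).continuousWithinAt)
  calc _ ≤ ∫ s in (0 : ℝ)..T, ∑ j ∈ Finset.Icc 2 d, (d.choose j : ℝ) * seqA j (c s) * S j := by
        refine intervalIntegral.integral_mono_on hT ?_ 
          (by simpa only [Finset.sum_fn] using IntervalIntegrable.sum _ hterm) ?_
        · refine ContinuousOn.intervalIntegrable ?_
          rw [Set.uIcc_of_le hT]
          exact hwc.mul (continuousOn_finsetSum _ fun j _ => continuousOn_const.mul
            ((hc.continuousOn_seqA _).mul (ha.continuousOn_seqA _)))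
        · intro s hs
          have hw1 : Real.exp (-∫ x in (0 : ℝ)..s, β x) ≤ 1 :=
            Real.exp_le_one_iff.mpr (neg_nonpos.mpr
              (intervalIntegral.integral_nonneg hs.1 fun x _ => hβpos x))
          have hnn : ∀ j ∈ Finset.Icc 2 d,
              0 ≤ (d.choose j : ℝ) * (seqA j (c s) * seqA (d + 1 - j) (a s)) := fun j _ =>
            mul_nonneg (Nat.cast_nonneg _) (mul_nonneg (seqA_nonneg _ _) (seqA_nonneg _ _))
          refine (mul_le_of_le_one_left (Finset.sum_nonneg hnn) hw1).trans
            (Finset.sum_le_sum fun j _ => ?_)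
          rw [mul_assoc]
          exact mul_le_mul_of_nonneg_left
            (mul_le_mul_of_nonneg_left (hle j s hs) (seqA_nonneg _ _)) (Nat.cast_nonneg _)
    _ = _ := by
        rw [intervalIntegral.integral_finsetSum hterm]
        refine Finset.sum_congr rfl fun j _ => ?_
        rw [intervalIntegral.integral_mul_const, intervalIntegral.integral_const_mul]

/-- A solution with zero initial value vanishes: the coefficient at `0` is constant, and the bound
for `d = 0` controls all others. -/
theorem SolvesOn.eq_zero (hν : 0 < ν) (hT : 0 ≤ T) (hc : RapidOn T c) (ha : RapidOn T a)
    (hh : ∀ s ∈ Set.Icc 0 T, Hermitian (c s))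
    (hdiv : ∀ s ∈ Set.Icc 0 T, ∀ m, dot m (c s m) = 0) (hode : SolvesOn ν T c a)
    (h0 : a 0 = 0) : a T = 0 := by
  have hTm : T ∈ Set.Icc 0 T := ⟨hT, le_rfl⟩
  have h := seqA_le_of_young hν hT hc ha hh hode zero_le_one
  have hz : seqA 0 (a 0) = 0 := by
    rw [h0, seqA]
    simp [termA]
  rw [hz, zero_mul] at h
  have hsum := (ha.rapid hTm).summable_termA 0
  funext k
  by_cases hk : k = 0
  · rw [hk, hode.coeff_zero_eq hdiv hTm, h0]
  · have h1 := (hsum.le_tsum k fun l _ => termA_nonneg 0 (a T) l).trans h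
    rw [termA_of_ne _ _ hk, pow_zero, one_mul, norm_le_zero_iff] at h1
    exact h1

end Bounds

/-! ### Existence and uniqueness in `C^∞(𝕋ⁿ)ⁿ` -/

theorem advCoeff_sub {c a b : (Fin n → ℤ) → V n} (hc : Rapid c) (ha : Rapid a) (hb : Rapid b)
    (k : Fin n → ℤ) : advCoeff c (fun l => a l - b l) k = advCoeff c a k - advCoeff c b k := by
  simp only [advCoeff, smul_sub]
  exact (summable_advTerm hc ha k).tsum_sub (summable_advTerm hc hb k)

theorem RapidOn.sub {T : ℝ} {a b : ℝ → (Fin n → ℤ) → V n} (ha : RapidOn T a) (hb : RapidOn T b) :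
    RapidOn T (fun s k => a s k - b s k) := by
  refine ⟨fun k => (ha.cont k).sub (hb.cont k), fun d => ?_⟩
  obtain ⟨C, hC⟩ := ha.bound d
  obtain ⟨D, hD⟩ := hb.bound d
  refine ⟨C + D, fun s hs k => ?_⟩
  calc _ ≤ wt k ^ d * (‖a s k‖ + ‖b s k‖) :=
        mul_le_mul_of_nonneg_left (norm_sub_le _ _) (pow_nonneg (wt_pos k).le d)
    _ ≤ _ := by rw [mul_add]; exact add_le_add (hC s hs k) (hD s hs k)

theorem SolvesOn.sub {ν T : ℝ} {c a b : ℝ → (Fin n → ℤ) → V n} (hc : RapidOn T c)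
    (ha : RapidOn T a) (hb : RapidOn T b) (hsa : SolvesOn ν T c a) (hsb : SolvesOn ν T c b) :
    SolvesOn ν T c (fun s k => a s k - b s k) := by
  intro s hs k
  have h := (hsa s hs k).sub (hsb s hs k)
  convert! h using 1
  rw [advCoeff_sub (hc.rapid hs) (ha.rapid hs) (hb.rapid hs), map_sub, smul_sub]
  abel

section Flow

variable {ν : ℝ} {v : ℝ → SmoothField n} {u₀ : SmoothField n}

theorem dot_coeff_eq_zero (hvdiv : ∀ t, 0 ≤ t → ∀ x, divergence (v t) x = 0) (T : ℝ) :
    ∀ s ∈ Set.Icc 0 T, ∀ m, dot m (coeff (v s) m) = 0 := fun s hs =>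
  dot_coeff_of_divergence (hvdiv s hs.1)

/-- Two solutions with the same initial value agree: their difference solves the equation with zero
initial value. -/
theorem eqOn_of_solvesOn (hν : 0 < ν) (hv : ContinuousOn v (Set.Ici 0))
    (hvdiv : ∀ t, 0 ≤ t → ∀ x, divergence (v t) x = 0) {u w : ℝ → SmoothField n}
    (hu : ContinuousOn u (Set.Ici 0)) (hw : ContinuousOn w (Set.Ici 0))
    (hsu : ∀ T, SolvesOn ν T (fun s => coeff (v s)) (fun s => coeff (u s)))
    (hsw : ∀ T, SolvesOn ν T (fun s => coeff (v s)) (fun s => coeff (w s)))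
    (h0 : w 0 = u 0) : Set.EqOn w u (Set.Ici 0) := by
  intro T hT
  have hc := rapidOn_coeff hv T
  have ha := rapidOn_coeff hw T
  have hb := rapidOn_coeff hu T
  have h := ((hsw T).sub hc ha hb (hsu T)).eq_zero hν hT hc (ha.sub hb)
    (fun s _ => hermitian_coeff (v s)) (dot_coeff_eq_zero hvdiv T) (by simp [h0, Pi.zero_def])
  exact coeff_injective (funext fun k => sub_eq_zero.mp (congrFun h k))

/-- The Picard series synthesizes to a continuous curve of smooth fields. -/
theorem exists_curve (hν : 0 < ν) (hv : ContinuousOn v (Set.Ici 0))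
    (hvdiv : ∀ t, 0 ≤ t → ∀ x, divergence (v t) x = 0) :
    ∃ u : ℝ → SmoothField n, u 0 = u₀ ∧ ContinuousOn u (Set.Ici 0) ∧
      ∀ T, SolvesOn ν T (fun s => coeff (v s)) (fun s => coeff (u s)) := by
  set p := picardSum ν (fun s => coeff (v s)) (coeff u₀) with hp
  have hR : ∀ T, RapidOn T p := fun T =>
    rapidOn_picardSum hν (rapidOn_coeff hv T) (rapid_coeff u₀) (dot_coeff_eq_zero hvdiv T)
  have hH : ∀ T, ∀ s ∈ Set.Icc 0 T, Hermitian (p s) := fun T =>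
    hermitian_picardSum hν (rapidOn_coeff hv T) (rapid_coeff u₀) (dot_coeff_eq_zero hvdiv T)
      (fun s _ => hermitian_coeff (v s)) (hermitian_coeff u₀)
  have hmax : ∀ t : ℝ, max t 0 ∈ Set.Icc 0 (max t 0) := fun t => ⟨le_max_right _ _, le_rfl⟩
  -- the curve is continued to negative times by its initial value
  set u : ℝ → SmoothField n := fun t => ((hR (max t 0)).rapid (hmax t)).field
  have hcoeff : ∀ t ∈ Set.Ici (0 : ℝ), coeff (u t) = p t := fun t ht =>
    (((hR (max t 0)).rapid (hmax t)).coeff_field (hH _ _ (hmax t))).trans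
      (congrArg p (max_eq_left ht))
  have hsolves : ∀ T, SolvesOn ν T (fun s => coeff (v s)) (fun s => coeff (u s)) := by
    intro T s hs k
    have h := solvesOn_picardSum hν (rapidOn_coeff hv T) (rapid_coeff u₀)
      (dot_coeff_eq_zero hvdiv T) s hs k
    rw [← hp, ← hcoeff s hs.1] at h
    exact h.congr (fun x hx => congrFun (hcoeff x hx.1) k) (congrFun (hcoeff s hs.1) k)
  refine ⟨u, coeff_injective ?_, continuousOn_of_rapidOn fun T => ⟨fun k s hs =>
    (hsolves T s hs k).continuousWithinAt, fun d => ?_⟩, hsolves⟩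
  · rw [hcoeff 0 Set.self_mem_Ici, hp, picardSum_zero]
  · obtain ⟨C, hC⟩ := (hR T).bound d
    refine ⟨C, fun s hs k => ?_⟩
    rw [hcoeff s hs.1]
    exact hC s hs k

/-- Bootstrap in time: the right-hand side is as regular in time as `v` and `u`, so that
`u` is one degree more regular than `v`. -/
theorem isCr_of_tendsto_slope {u : ℝ → SmoothField n} (hu : ContinuousOn u (Set.Ici 0))
    (hslope : ∀ t ∈ Set.Ici (0 : ℝ),
      Filter.Tendsto (slope u t) (𝓝[Set.Ici 0 \ {t}] t) (𝓝 (rhs ν (v t) (u t)))) {r : ℕ}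
    (hv : IsCr r v) : IsCr (r + 1) u := by
  have h : ∀ j ≤ r + 1, IsCr j u := by
    intro j
    induction j with
    | zero => exact fun _ => hu
    | succ j ih =>
      intro hj
      exact ⟨_, hslope, (hv.of_le (by omega)).rhs (ih (by omega)) ν⟩
  exact h _ le_rfl

end Flow

end

end TorusFlow

theorem mainTheorem2 (n r : ℕ) (hn : 2 ≤ n) (ν : ℝ) (hν : 0 < ν)
    (v : ℝ → TorusFlow.SmoothField n) (hv : TorusFlow.IsCr r v)
    (hvdiv : ∀ t, 0 ≤ t → ∀ x, TorusFlow.divergence (v t) x = 0)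
    (u₀ : TorusFlow.SmoothField n) (hu₀ : ∀ x, TorusFlow.divergence u₀ x = 0) :
    ∃ u : ℝ → TorusFlow.SmoothField n,
      TorusFlow.IsCr (r + 1) u ∧ TorusFlow.IsSolution ν v u₀ u ∧
      -- uniqueness, among all solutions that are `C¹` in time
      (∀ w : ℝ → TorusFlow.SmoothField n, TorusFlow.IsCr 1 w → TorusFlow.IsSolution ν v u₀ w →
        Set.EqOn w u (Set.Ici 0)) ∧
      -- conservation of the mean
      (∀ t, 0 ≤ t → ∫ x in TorusFlow.cell n, u t x = ∫ x in TorusFlow.cell n, u₀ x) ∧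
      -- all seminorms of the solution are finite, locally uniformly in time
      (∀ d : ℕ, ∀ t, 0 ≤ t →
        Summable (fun k : {k : Fin n → ℤ // k ≠ 0} =>
          ‖TorusFlow.freq k.1‖ ^ d * ‖TorusFlow.fourierVec (u t) k.1‖) ∧
        BddAbove ((fun s => TorusFlow.normA d (u s)) '' Set.Icc 0 t)) ∧
      -- the bound for `d = 0`
      (∀ t, 0 ≤ t → TorusFlow.normA 0 (u t) ≤ TorusFlow.normA 0 u₀ *
        Real.exp (1 / (4 * ν) * ∫ s in (0 : ℝ)..t, TorusFlow.normA 0 (v s) ^ 2)) ∧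
      -- the bound for `d = 1`
      (∀ t, 0 ≤ t → TorusFlow.normA 1 (u t) ≤ TorusFlow.normA 1 u₀ *
        Real.exp ((∫ s in (0 : ℝ)..t, TorusFlow.normA 1 (v s)) +
          1 / (4 * ν) * ∫ s in (0 : ℝ)..t, TorusFlow.normA 0 (v s) ^ 2)) ∧
      -- the bounds for `d ≥ 2`
      (∀ d : ℕ, 2 ≤ d → ∀ t, 0 ≤ t → TorusFlow.normA d (u t) ≤
        Real.exp (1 / (4 * ν) * (∫ s in (0 : ℝ)..t, TorusFlow.normA 0 (v s) ^ 2) +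
          d * ∫ s in (0 : ℝ)..t, TorusFlow.normA 1 (v s)) *
        (TorusFlow.normA d u₀ + ∑ j ∈ Finset.Icc 2 d,
          (d.choose j : ℝ) * (∫ s in (0 : ℝ)..t, TorusFlow.normA j (v s)) *
            sSup ((fun s => TorusFlow.normA (d + 1 - j) (u s)) '' Set.Icc 0 t))) ∧
      -- decay when `v` is small compared with the viscosity
      (∀ τ δ : ℝ, 0 ≤ τ → 0 ≤ δ →
        (∀ t ∈ Set.Icc 0 τ, TorusFlow.normA 0 (v t) + δ ≤ ν) →
        ∀ t ∈ Set.Icc 0 τ,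
          TorusFlow.normA 0 (u t) ≤ TorusFlow.normA 0 u₀ * Real.exp (-δ * t) ∧
          TorusFlow.normA 1 (u t) ≤ TorusFlow.normA 1 u₀ *
            Real.exp ((∫ s in (0 : ℝ)..t, TorusFlow.normA 1 (v s)) - δ * t)) := by
  open TorusFlow in
  have hvc : ContinuousOn v (Set.Ici 0) := hv.continuousOn
  obtain ⟨u, rfl, huc, hsolves⟩ := exists_curve (u₀ := u₀) hν hvc hvdiv
  have hslope : ∀ t ∈ Set.Ici (0 : ℝ), Filter.Tendsto (slope u t)
      (nhdsWithin t (Set.Ici 0 \ {t})) (nhds (rhs ν (v t) (u t))) := fun t ht =>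
    tendsto_slope_of_coeff (g := fun t => rhs ν (v t) (u t))
      (IsCr.rhs (r := 0) hvc huc ν)
      (fun T s hs k => by rw [coeff_rhs]; exact hsolves T s hs k) ht
  have hc := rapidOn_coeff hvc
  have ha := rapidOn_coeff huc
  have hh : ∀ T : ℝ, ∀ s ∈ Set.Icc 0 T, Hermitian (coeff (v s)) := fun _ s _ =>
    hermitian_coeff (v s)
  refine ⟨u, isCr_of_tendsto_slope huc hslope hv, ⟨rfl, fun t ht x => ?_⟩, fun w hw hsw => ?_,
    fun t ht => ?_, fun d t ht => ⟨?_, ?_⟩, fun t ht => ?_, fun t ht => ?_, fun d _ t ht => ?_,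
    fun τ δ _ hδ hsmall t ht => ?_⟩
  · rw [← rhs_apply]
    exact hasDerivWithinAt_eval (hslope t ht) x
  · exact eqOn_of_solvesOn hν hvc hvdiv huc hw.of_succ.continuousOn hsolves
      (fun T => solvesOn_of_isSolution hw hsw T) hsw.1
  · exact integral_cell_eq_of_coeff ((hsolves t).coeff_zero_eq (dot_coeff_eq_zero hvdiv t)
      ⟨ht, le_rfl⟩)
  · refine (((rapid_coeff (u t)).summable_termA d).comp_injective
      Subtype.val_injective).congr fun k => ?_
    rw [Function.comp_apply, termA_of_ne _ _ k.2, coeff_def]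
  · simp only [normA_eq]
    exact (isCompact_Icc.image_of_continuousOn ((ha t).continuousOn_seqA d)).bddAbove
  · simp only [normA_eq]
    simpa using seqA_le_of_young hν ht (hc t) (ha t) (hh t) (hsolves t) zero_le_one
  · simp only [normA_eq]
    simpa [add_comm] using seqA_le_of_young hν ht (hc t) (ha t) (hh t) (hsolves t) le_rfl
  · simp only [normA_eq]
    exact seqA_le_sum hν ht (hc t) (ha t) (hh t) (hsolves t) d
  · simp only [normA_eq] at hsmall ⊢
    have h := fun d hd => seqA_le_of_small ht.1 (hc t) (ha t) (hh t) (hsolves t) hδ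
      (fun s hs => hsmall s ⟨hs.1, hs.2.trans ht.2⟩) (d := d) hd
    refine ⟨by simpa using h 0 zero_le_one, ?_⟩
    have h1 := h 1 le_rfl
    rw [Nat.cast_one, one_mul, neg_mul, neg_add_eq_sub] at h1
    exact h1
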